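/- Let $k\ge 2$ and $s\ge 1$ be integers with $\gcd(k,s)=1$. The rosette knot $R^k_s\subset\mathbb R^3$ is the closure of the $s$-string braid $(\sigma_1\sigma_2^{-1}\sigma_3\sigma_4^{-1}\cdots\sigma_{s-1}^{(-1)^s})^k$. For positive integers $s,n,m$ and a phase $\phi\in\mathbb R$ let $Z(s,n,m,\phi)$ be the closed billiard curve $t\mapsto (f(t),g(mt+\phi))$, $t\in[0,1]$, in the cylinder $\{(z,x)\in\mathbb C\times\mathbb R: |z|\le 1,\ 0\le x\le 1\}$, where $f$ runs with constant speed along the closed polygon with successive vertices $f(j/n)=e^{2\pi i sj/n}$, $j=0,\dots,n$, and $g(x)=2\,\bigl|x-\lfloor x\rfloor-\tfrac12\bigr|$. A billiard knot in the cylinder is a simple closed polygon contained in the cylinder all of whose vertices are points where the boundary of the cylinder is smooth, and which is reflected at each vertex in the tangent plane of the boundary. Then $R^k_s$ is the cylinder knot $Z(s,k(s+1),k)$; that is: (i) there is a phase $\phi$ for which $Z(s,k(s+1),k,\phi)$ is a billiard knot in the cylinder that is ambient isotopic to $R^k_s$; (ii) for every phase $\phi$ for which $Z(s,k(s+1),k,\phi)$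 has no self-intersections, it is ambient isotopic to $R^k_s$ or to the mirror image of $R^k_s$. -/

import Mathlib

namespace CylinderKnots

noncomputable section

/-! ### Knots as subsets of `ℂ × ℝ` (three-dimensional space), up to ambient isotopy -/

/-- `K` and `K'` are ambient isotopic in `ℂ × ℝ`. -/
def AmbientIsotopic (K K' : Set (ℂ × ℝ)) : Prop :=
  ∃ H : unitInterval → (ℂ × ℝ) ≃ₜ (ℂ × ℝ),
    Continuous (fun p : unitInterval × (ℂ × ℝ) => H p.1 p.2) ∧
      (∀ x, H 0 x = x) ∧ H 1 '' K = K'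

/-- The mirror image of a subset of `ℂ × ℝ`, under the reflection `(z, x) ↦ (conj z, x)`. -/
def mirror (K : Set (ℂ × ℝ)) : Set (ℂ × ℝ) :=
  (fun p : ℂ × ℝ => (starRingEnd ℂ p.1, p.2)) '' K

/-! ### Billiard knots in the cylinder -/

/-- The solid cylinder `D² × [0, 1]`. -/
def cylinder : Set (ℂ × ℝ) :=
  {p | ‖p.1‖ ≤ 1 ∧ 0 ≤ p.2 ∧ p.2 ≤ 1}

/-- `p` is a point at which the boundary of the cylinder is smooth, and the velocity `w` is the
reflection of the velocity `v` at the tangent plane of the boundary at `p`. The first alternative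
is the lateral wall (unit normal `(p.1, 0)`), the second one the floor and the ceiling
(unit normal `(0, 1)`). -/
def Reflects (p v w : ℂ × ℝ) : Prop :=
  (‖p.1‖ = 1 ∧ 0 < p.2 ∧ p.2 < 1 ∧
    w = (v.1 - ((2 * (v.1 * starRingEnd ℂ p.1).re : ℝ) : ℂ) * p.1, v.2)) ∨
  (‖p.1‖ < 1 ∧ (p.2 = 0 ∨ p.2 = 1) ∧ w = (v.1, -v.2))

/-- `γ` runs once (in time `1`) through a billiard knot in the cylinder: it is a simple closed
curve in the cylinder which at every time has an incoming velocity `v` and an outgoing velocity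
`w` and moves along straight segments shortly before and after that time; at its vertices
(where `v ≠ w`) the boundary of the cylinder is smooth and the curve is reflected there. -/
def IsBilliardKnot (γ : ℝ → ℂ × ℝ) : Prop :=
  Function.Periodic γ 1 ∧ Set.InjOn γ (Set.Ico 0 1) ∧ (∀ t, γ t ∈ cylinder) ∧
    ∀ t, ∃ v w : ℂ × ℝ, (v = w ∨ Reflects (γ t) v w) ∧
      ∃ δ : ℝ, 0 < δ ∧ ∀ u ∈ Set.Icc (0 : ℝ) δ, γ (t - u) = γ t - u • v ∧ γ (t + u) = γ t + u • w

/-- The projected billiard curve in the unit disc: it runs with constant speed along the segments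
joining the successive points `exp (2πi (s/n) j)`, `j = 0, 1, 2, …`, the `j`-th of which is
reached at time `j / n`. -/
def planarCurve (s n : ℕ) (t : ℝ) : ℂ :=
  let e : ℤ → ℂ := fun j => Complex.exp (2 * Real.pi * Complex.I * (s / n) * j)
  ((1 - Int.fract (n * t) : ℝ) : ℂ) * e ⌊n * t⌋ + ((Int.fract (n * t) : ℝ) : ℂ) * e (⌊n * t⌋ + 1)

/-- The sawtooth function. -/
def sawtooth (t : ℝ) : ℝ := 2 * |t - ⌊t⌋ - 1 / 2|

/-- The billiard curve `Z(s, n, m, φ)`, with rotation number `s`, with `n` reflections at the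
lateral wall, `m` maxima and phase `φ`. -/
def billiardCurve (s n m : ℕ) (φ : ℝ) (t : ℝ) : ℂ × ℝ :=
  (planarCurve s n t, sawtooth (m * t + φ))

/-! ### Closed braids -/

/-- The letter `(i, ε)` of a braid word on `s` strings stands for `σ_{i+1} ^ ε`. -/
abbrev BraidWord (s : ℕ) : Type := List (Fin (s - 1) × ℤˣ)

/-- The points `(1, 0), …, (s, 0)` of the plane. -/
def basePoints (s : ℕ) : Set (ℝ × ℝ) :=
  {q | ∃ j : ℕ, 1 ≤ j ∧ j ≤ s ∧ q = ((j : ℝ), 0)}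

/-- The positions of the `s` strings at time `u ∈ [0, 1]` of the elementary geometric braid
`σ_{i+1} ^ ε`: the points `(i + 1, 0)` and `(i + 2, 0)` are exchanged by a half turn about their
midpoint, in the sense given by `ε`, and the other ones do not move. -/
def letterSlice (s : ℕ) (a : Fin (s - 1) × ℤˣ) (u : ℝ) : Set (ℝ × ℝ) :=
  let c : ℝ := (a.1 : ℕ) + 3 / 2
  let ε : ℝ := ((a.2 : ℤ) : ℝ)
  {q | ∃ j : ℕ, 1 ≤ j ∧ j ≤ s ∧ j ≠ (a.1 : ℕ) + 1 ∧ j ≠ (a.1 : ℕ) + 2 ∧ q = ((j : ℝ), 0)} ∪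
    {(c - Real.cos (Real.pi * u) / 2, ε * Real.sin (Real.pi * u) / 2),
      (c + Real.cos (Real.pi * u) / 2, -(ε * Real.sin (Real.pi * u) / 2))}

/-- The positions of the `s` strings at time `t ∈ [0, 1]` of the geometric braid of the word `b`,
whose letters are performed one after the other, in times of equal length. (At time `1`, and for
the empty word, these are the base points.) -/
def wordSlice {s : ℕ} (b : BraidWord s) (t : ℝ) : Set (ℝ × ℝ) :=
  match b[⌊b.length * t⌋₊]? with
  | some a => letterSlice s a (Int.fract (b.length * t))
  | none => basePoints s

/-- The closure of the braid given by a word: the braid is bent once around the axis `{0} × ℝ`.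
The first coordinate of a slice is the distance from the axis, the second one is the height. -/
def braidClosure {s : ℕ} (b : BraidWord s) : Set (ℂ × ℝ) :=
  {p | ∃ t ∈ Set.Icc (0 : ℝ) 1, ∃ q ∈ wordSlice b t,
    p = ((q.1 : ℂ) * Complex.exp (2 * Real.pi * Complex.I * t), q.2)}

/-- The word `(σ₁ σ₂⁻¹ σ₃ σ₄⁻¹ ⋯ σ_{s-1}^{(-1)^s}) ^ k`. -/
def rosetteWord (s k : ℕ) : BraidWord s :=
  (List.replicate k
    ((List.finRange (s - 1)).map fun i : Fin (s - 1) => (i, (-1 : ℤˣ) ^ (i : ℕ)))).flatten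

/-- The rosette link `R^k_s`. -/
def rosette (s k : ℕ) : Set (ℂ × ℝ) := braidClosure (rosetteWord s k)

end

end CylinderKnots

namespace CylinderKnots

open Set Filter Topology
open scoped NNReal unitInterval

/-! ### Ambient isotopy -/

/-! All curves involved have one shape, `toricCurve`: a profile of period 1 in the half plane
(distance from the axis, height) is carried round the axis, making `s` turns while the parameter
runs over `k` periods. As `k` and `s` are coprime, the strings above one angle have the profile
parameters `w + N / s` modulo 1. So the curve is embedded exactly when `P (w + N / s) ≠ P w` for `s
∤ N`, a condition in which `k` does not occur.

Knots can therefore be deformed by deforming profiles. During a linear homotopy of Lipschitz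
profiles with disjoint strings, the velocity is a Lipschitz function of the moving point. It extends
to all of space, and a displacement with small Lipschitz constant perturbs the identity to a
homeomorphism; short steps are then chained (`ambientIsotopic_of_linear_homotopy`,
`ambientIsotopic_of_segment`). The working criterion is `ambientIsotopic_of_same_order`: it suffices
to look at the crossings, where two strings have equal distance from the axis, and to check that
their heights are ordered alike in both profiles.

The billiard curve, parametrized by its angle instead of time, has a profile with the same crossings
and the same order of heights as the Lissajous profile with frequencies `s + 1` (distance) and `1`
(height). A quarter turn of the profile plane exchanges the two frequencies. Afterwards the distance
is a simple tent, two crossing strings lie symmetrically in the period, and because `s + 1 ≡ 1`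
modulo `s` the phase enters the order of heights at every crossing only through the sign of `sin
(2πχ)` (`dualLissajous_crossing`). Hence there are self-intersections if this sine vanishes (for `s
≥ 2`), and otherwise just two cases, which are mirror images of each other.

These crossing signs are also those of a spiral whose distance grows during half of the period while
the height oscillates, and then decreases at height 0. The outward phase can be compressed from `1 /
2` to `1 / s` of the period without any collision. Then one string runs outwards past all the
others, alternately above and below, while each of these moves inwards by one place: this is one
factor of the rosette word. -/

theorem AmbientIsotopic.trans {K K' K'' : Set (ℂ × ℝ)} (h : AmbientIsotopic K K')
    (h' : AmbientIsotopic K' K'') : AmbientIsotopic K K'' := by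
  obtain ⟨H, hc, h0, h1⟩ := h
  obtain ⟨G, gc, g0, g1⟩ := h'
  refine ⟨fun u => (H u).trans (G u), ?_, fun x => by simp [h0, g0], ?_⟩
  · exact gc.comp (continuous_fst.prodMk hc)
  · rw [← g1, ← h1, image_image]
    rfl

theorem AmbientIsotopic.symm {K K' : Set (ℂ × ℝ)} (h : AmbientIsotopic K K') :
    AmbientIsotopic K' K := by
  obtain ⟨H, hc, h0, h1⟩ := h
  -- The isotopy is run backwards after undoing its final map, so that it starts at the identity.
  refine ⟨fun u => (H 1).symm.trans (H (σ u)), ?_, fun x => ?_, ?_⟩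
  · exact hc.comp ((unitInterval.continuous_symm.comp continuous_fst).prodMk
      ((H 1).symm.continuous.comp continuous_snd))
  · simp
  · rw [← h1, image_image]
    simp [h0]

/-- Conjugating an ambient isotopy by a homeomorphism. -/
theorem AmbientIsotopic.image {K K' : Set (ℂ × ℝ)} (h : AmbientIsotopic K K')
    (e : (ℂ × ℝ) ≃ₜ (ℂ × ℝ)) : AmbientIsotopic (e '' K) (e '' K') := by
  obtain ⟨H, hc, h0, h1⟩ := h
  refine ⟨fun u => (e.symm.trans (H u)).trans e, ?_, fun x => by simp [h0], ?_⟩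
  · exact e.continuous.comp (hc.comp (continuous_fst.prodMk
      (e.symm.continuous.comp continuous_snd)))
  · rw [← h1, image_image, image_image]
    simp

/-- A displacement with Lipschitz constant less than one is realized by an ambient isotopy. -/
theorem ambientIsotopic_of_lipschitz {g : ℂ × ℝ → ℂ × ℝ} {c : ℝ≥0} (hg : LipschitzWith c g)
    (hc : c < 1) (K : Set (ℂ × ℝ)) : AmbientIsotopic K ((fun x => x + g x) '' K) := by
  have key : ∀ u : I, ApproximatesLinearOn (fun x => x + (u : ℝ) • g x)
      ((ContinuousLinearEquiv.refl ℝ (ℂ × ℝ) : (ℂ × ℝ) ≃L[ℝ] (ℂ × ℝ)) :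
        (ℂ × ℝ) →L[ℝ] (ℂ × ℝ)) univ c := by
    intro u x _ y _
    have e : x + (u : ℝ) • g x - (y + (u : ℝ) • g y) -
        ((ContinuousLinearEquiv.refl ℝ (ℂ × ℝ) : (ℂ × ℝ) ≃L[ℝ] (ℂ × ℝ)) :
        (ℂ × ℝ) →L[ℝ] (ℂ × ℝ)) (x - y) = (u : ℝ) • (g x - g y) := by
      simp only [ContinuousLinearEquiv.coe_coe, ContinuousLinearEquiv.coe_refl', id, smul_sub]
      abel
    rw [e, norm_smul, Real.norm_eq_abs, abs_of_nonneg u.2.1]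
    calc (u : ℝ) * ‖g x - g y‖ ≤ 1 * ‖g x - g y‖ := by
          gcongr
          exact u.2.2
      _ ≤ c * ‖x - y‖ := by
          rw [one_mul]
          exact hg.norm_sub_le x y
  have hN : Subsingleton (ℂ × ℝ) ∨ c < ‖((ContinuousLinearEquiv.refl ℝ (ℂ × ℝ)).symm :
      (ℂ × ℝ) →L[ℝ] (ℂ × ℝ))‖₊⁻¹ := by
    right
    have : ‖((ContinuousLinearEquiv.refl ℝ (ℂ × ℝ)).symm :
      (ℂ × ℝ) →L[ℝ] (ℂ × ℝ))‖₊ = 1 := by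
      apply NNReal.eq
      exact ContinuousLinearMap.norm_id
    rw [this]
    simpa using hc
  refine ⟨fun u => (key u).toHomeomorph _ hN, ?_, fun x => ?_, ?_⟩
  · change Continuous fun p : I × (ℂ × ℝ) => p.2 + (p.1 : ℝ) • g p.2
    have := hg.continuous
    fun_prop
  · change x + ((0 : I) : ℝ) • g x = x
    simp
  · change (fun x => x + ((1 : I) : ℝ) • g x) '' K = _
    simp

/-- A linear homotopy of parametrized sets whose velocity is Lipschitz, with a uniform constant, in
terms of the moving points is realized by an ambient isotopy. -/
theorem ambientIsotopic_of_linear_homotopy {γ δ : ℝ → ℂ × ℝ} {C : ℝ≥0}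
    (h : ∀ u ∈ Icc (0 : ℝ) 1, ∀ w w' : ℝ, ‖(δ w - γ w) - (δ w' - γ w')‖ ≤
      C * ‖(γ w + u • (δ w - γ w)) - (γ w' + u • (δ w' - γ w'))‖) :
    AmbientIsotopic (range γ) (range δ) := by
  let F : ℝ → ℝ → ℂ × ℝ := fun u w => γ w + u • (δ w - γ w)
  have loc : ∀ u ∈ Icc (0 : ℝ) 1, ∀ v : ℝ,
      lipschitzExtensionConstant (ℂ × ℝ) * (C * Real.toNNReal |v - u|) < 1 →
      AmbientIsotopic (range (F u)) (range (F v)) := by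
    intro u hu v hv
    -- The choice of a parameter by `invFun` does no harm: by the hypothesis, parameters of the same
    -- point have the same velocity (`hz` below).
    let d : ℂ × ℝ → ℂ × ℝ := fun p => (v - u) • (δ (Function.invFun (F u) p) -
      γ (Function.invFun (F u) p))
    have inv : ∀ w, F u (Function.invFun (F u) (F u w)) = F u w :=
      fun w => Function.invFun_eq ⟨w, rfl⟩
    have hd : LipschitzOnWith (C * Real.toNNReal |v - u|) d (range (F u)) := by
      refine LipschitzOnWith.of_dist_le_mul ?_
      rintro _ ⟨w, rfl⟩ _ ⟨w', rfl⟩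
      rw [dist_eq_norm, dist_eq_norm]
      simp only [d]
      rw [← smul_sub, norm_smul, Real.norm_eq_abs]
      have := h u hu (Function.invFun (F u) (F u w)) (Function.invFun (F u) (F u w'))
      change _ ≤ (C : ℝ) * ‖F u _ - F u _‖ at this
      rw [inv, inv] at this
      push_cast
      rw [Real.coe_toNNReal _ (abs_nonneg _)]
      calc _ ≤ |v - u| * (C * ‖F u w - F u w'‖) := by gcongr
        _ = _ := by ring
    -- Extending a vector-valued Lipschitz map multiplies its constant by
    -- `lipschitzExtensionConstant`; this is why that factor appears in the smallness condition on
    -- `v - u`.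
    obtain ⟨g, hg, hgd⟩ := hd.extend_finite_dimension
    convert ambientIsotopic_of_lipschitz hg hv (range (F u)) using 1
    rw [← range_comp]
    congr 1
    funext w
    simp only [Function.comp]
    rw [← hgd ⟨w, rfl⟩]
    have hz : (δ (Function.invFun (F u) (F u w)) - γ (Function.invFun (F u) (F u w))) =
        δ w - γ w := by
      have := h u hu (Function.invFun (F u) (F u w)) w
      change _ ≤ (C : ℝ) * ‖F u _ - F u _‖ at this
      rw [inv, sub_self, norm_zero, mul_zero] at this
      exact sub_eq_zero.1 (norm_le_zero_iff.1 this)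
    simp only [d]
    rw [hz]
    simp only [F]
    module
  have main : AmbientIsotopic (range (F 0)) (range (F 1)) := by
    refine isPreconnected_Icc.induction₂' (s := Icc (0 : ℝ) 1)
      (fun u v => AmbientIsotopic (range (F u)) (range (F v))) ?_ ?_
      (left_mem_Icc.2 zero_le_one) (right_mem_Icc.2 zero_le_one)
    · intro u hu
      have ht : Tendsto (fun v : ℝ => lipschitzExtensionConstant (ℂ × ℝ) *
          (C * Real.toNNReal |v - u|)) (𝓝 u) (𝓝 0) := by
        have : Continuous (fun v : ℝ => lipschitzExtensionConstant (ℂ × ℝ) *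
          (C * Real.toNNReal |v - u|)) := by fun_prop
        simpa using this.tendsto u
      filter_upwards [nhdsWithin_le_nhds (ht.eventually_lt_const zero_lt_one)] with v hv
      exact ⟨loc u hu v hv, (loc u hu v hv).symm⟩
    · intro x y z _ _ _ h1 h2
      exact h1.trans h2
  simpa [F] using main

/-! ### Closed braids with rotational symmetry -/

/-- The curve with the profile `P` (distance from the axis, height), the angle of which grows by
`s` turns while the parameter grows by `k`. -/
noncomputable def toricCurve (s k : ℕ) (P : ℝ → ℝ × ℝ) (w : ℝ) : ℂ × ℝ :=
  (((P w).1 : ℂ) * Complex.exp ((2 * Real.pi * (s / k) * w : ℝ) * Complex.I), (P w).2)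

/-- Admissible profiles: Lipschitz functions of period `1` with values in the right half plane. -/
structure IsProfile (P : ℝ → ℝ × ℝ) : Prop where
  periodic : Function.Periodic P 1
  lipschitz : ∃ L : ℝ≥0, LipschitzWith L P
  pos : ∀ w, 0 < (P w).1

/-- The strings of the closed braid with profile `P` are disjoint. -/
def Separated (s : ℕ) (P : ℝ → ℝ × ℝ) : Prop :=
  ∀ (w : ℝ) (N : ℤ), ¬ (s : ℤ) ∣ N → P (w + N / s) ≠ P w

theorem IsProfile.continuous {P : ℝ → ℝ × ℝ} (h : IsProfile P) : Continuous P :=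
  h.lipschitz.choose_spec.continuous

theorem periodic_add_int {E : Type*} {f : ℝ → E} (h : Function.Periodic f 1) (x : ℝ) (n : ℤ) :
    f (x + n) = f x := by
  simpa using h.int_mul n x

/-- Compactness: by periodicity only `w ∈ [0, 1]` and the residues `1, …, s - 1` of `N` matter, so
disjointness yields a positive distance that is uniform over the whole family. -/
theorem exists_separation_bound {X : Type*} [TopologicalSpace X] [CompactSpace X] {s : ℕ}
    (hs : 0 < s) {P : X → ℝ → ℝ × ℝ} (hc : Continuous fun p : X × ℝ => P p.1 p.2)
    (hp : ∀ x, Function.Periodic (P x) 1) (h : ∀ x, Separated s (P x)) :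
    ∃ m > 0, ∀ x w (N : ℤ), ¬ (s : ℤ) ∣ N → m ≤ ‖P x (w + N / s) - P x w‖ := by
  have hs' : (s : ℝ) ≠ 0 := by positivity
  have hK : IsCompact ((univ : Set X) ×ˢ (Icc (0 : ℝ) 1 ×ˢ (Icc (1 : ℤ) (s - 1)))) :=
    isCompact_univ.prod (isCompact_Icc.prod (Set.finite_Icc _ _).isCompact)
  have hf : Continuous (fun p : X × ℝ × ℤ => ‖P p.1 (p.2.1 + p.2.2 / s) - P p.1 p.2.1‖) := by
    have h1 : Continuous (fun p : X × ℝ × ℤ => P p.1 (p.2.1 + p.2.2 / s)) :=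
      hc.comp (continuous_fst.prodMk ((continuous_fst.comp continuous_snd).add
        ((continuous_of_discreteTopology (f := fun n : ℤ => (n : ℝ) / s)).comp
          (continuous_snd.comp continuous_snd))))
    have h2 : Continuous (fun p : X × ℝ × ℤ => P p.1 p.2.1) :=
      hc.comp (continuous_fst.prodMk (continuous_fst.comp continuous_snd))
    exact (h1.sub h2).norm
  obtain ⟨m, hm, hle⟩ := hK.exists_forall_le' hf.continuousOn (a := 0) (by
    rintro ⟨x, w, N⟩ ⟨-, -, h1, h2⟩
    simp only at h1 h2 ⊢
    rw [norm_pos_iff, sub_ne_zero]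
    refine h x w N fun hd => ?_
    have := Int.le_of_dvd (by omega) hd
    omega)
  refine ⟨m, hm, fun x w N hN => ?_⟩
  have hmod : N % s ≠ 0 := fun h0 => hN (Int.dvd_of_emod_eq_zero h0)
  have h1 := Int.emod_nonneg N (b := s) (by omega)
  have h2 := Int.emod_lt_of_pos N (b := s) (by omega)
  have := hle (x, Int.fract w, N % s) ⟨mem_univ _, ⟨Int.fract_nonneg _, (Int.fract_lt_one _).le⟩,
    by simp only; omega, by simp only; omega⟩
  simp only at this
  have e1 : P x (Int.fract w) = P x w := by
    conv_rhs => rw [← Int.fract_add_floor w]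
    rw [periodic_add_int (hp x)]
  have e2 : P x (Int.fract w + (N % s : ℤ) / s) = P x (w + N / s) := by
    have e : w + N / s = Int.fract w + (N % s : ℤ) / s + ((⌊w⌋ + N / s : ℤ) : ℝ) := by
      have h4 : (N : ℝ) = (N % s : ℤ) + s * (N / s : ℤ) := by
        exact_mod_cast (Int.emod_add_mul_ediv N s).symm
      nth_rewrite 1 [h4]
      rw [Int.fract]
      push_cast
      field_simp
      ring
    rw [e, periodic_add_int (hp x)]
  rwa [e1, e2] at this

theorem norm_exp_sub_exp_le (a b : ℝ) :
    ‖Complex.exp (a * Complex.I) - Complex.exp (b * Complex.I)‖ ≤ |a - b| := by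
  have e : Complex.exp (a * Complex.I) - Complex.exp (b * Complex.I) =
      Complex.exp (b * Complex.I) * (Complex.exp (Complex.I * (a - b : ℝ)) - 1) := by
    rw [mul_sub, ← Complex.exp_add]
    push_cast
    ring_nf
  rw [e, norm_mul, Complex.norm_exp_ofReal_mul_I, one_mul]
  exact Real.norm_exp_I_mul_ofReal_sub_one_le

/-- Points of a half plane bounded by the axis and of another one, at a given angle, are at least
a multiple of this angle apart. -/
theorem mul_le_norm_polar_sub {c ρ ρ' θ θ' x : ℝ} (q : ℤ) (hc : 0 < c) (h : c ≤ ρ) (h' : c ≤ ρ')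
    (hx : |x| ≤ Real.pi) (hθ : θ' = θ + x + 2 * Real.pi * q) :
    2 * c / Real.pi * |x| ≤ ‖(ρ : ℂ) * Complex.exp (θ * Complex.I) -
      (ρ' : ℂ) * Complex.exp (θ' * Complex.I)‖ := by
  have e : (ρ : ℂ) * Complex.exp (θ * Complex.I) - (ρ' : ℂ) * Complex.exp (θ' * Complex.I) =
      Complex.exp (θ * Complex.I) * (ρ - ρ' * Complex.exp (x * Complex.I)) := by
    have : Complex.exp (θ' * Complex.I) =
        Complex.exp (θ * Complex.I) * Complex.exp (x * Complex.I) := by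
      rw [← Complex.exp_add, Complex.exp_eq_exp_iff_exists_int]
      refine ⟨q, ?_⟩
      rw [hθ]
      push_cast
      ring
    rw [this]
    ring
  rw [e, norm_mul, Complex.norm_exp_ofReal_mul_I, one_mul]
  have hsin : 2 / Real.pi * |x / 2| ≤ |Real.sin (x / 2)| := by
    apply Real.mul_abs_le_abs_sin
    rw [abs_div, abs_two]
    linarith
  have e2 : 2 * c / Real.pi * |x| = 2 * c * (2 / Real.pi * |x / 2|) := by
    rw [abs_div, abs_two]
    ring
  rw [e2]
  refine le_trans (mul_le_mul_of_nonneg_left hsin (by positivity)) ?_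
  -- The square of the distance is `(ρ - ρ')² + 4 ρ ρ' sin² (x / 2)`, and `ρ ρ' ≥ c²`.
  apply le_of_sq_le_sq _ (norm_nonneg _)
  rw [← Complex.normSq_eq_norm_sq, Complex.exp_mul_I, Complex.normSq_apply, mul_pow, sq_abs]
  simp only [Complex.sub_re, Complex.sub_im, Complex.ofReal_re, Complex.ofReal_im,
    Complex.add_re, Complex.add_im,
    ← Complex.ofReal_cos, ← Complex.ofReal_sin, Complex.mul_re, Complex.mul_im, Complex.I_re,
    Complex.I_im]
  have hcos : Real.cos x = 1 - 2 * Real.sin (x / 2) ^ 2 := by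
    have := Real.cos_two_mul (x / 2)
    rw [Real.cos_sq', mul_div_cancel₀ x two_ne_zero] at this
    linarith
  have hs2 := Real.sin_sq_add_cos_sq x
  have hρ : c * c ≤ ρ * ρ' := mul_le_mul h h' hc.le (hc.le.trans h)
  have := mul_le_mul_of_nonneg_right hρ (sq_nonneg (Real.sin (x / 2)))
  have e3 : ρ' ^ 2 * (Real.sin x ^ 2 + Real.cos x ^ 2) = ρ' ^ 2 := by rw [hs2, mul_one]
  have e4 : ρ * ρ' * Real.cos x = ρ * ρ' - 2 * (ρ * ρ' * Real.sin (x / 2) ^ 2) := by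
    rw [hcos]
    ring
  nlinarith [sq_nonneg (ρ - ρ')]

theorem IsProfile.exists_lipschitz_toricCurve {P : ℝ → ℝ × ℝ} (h : IsProfile P) (s k : ℕ) :
    ∃ L : ℝ≥0, LipschitzWith L (toricCurve s k P) := by
  obtain ⟨L, hL⟩ := h.lipschitz
  obtain ⟨M, hM⟩ := isCompact_Icc.exists_bound_of_continuousOn (s := Icc (0 : ℝ) 1)
    h.continuous.continuousOn
  have hM' : ∀ w, ‖P w‖ ≤ M := fun w => by
    have := hM (Int.fract w) ⟨Int.fract_nonneg _, (Int.fract_lt_one _).le⟩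
    rwa [← periodic_add_int h.periodic _ ⌊w⌋, Int.fract_add_floor] at this
  have hM0 : 0 ≤ M := (norm_nonneg _).trans (hM' 0)
  let A : ℝ := |2 * Real.pi * (s / k)|
  refine ⟨Real.toNNReal (L + M * A), LipschitzWith.of_dist_le_mul fun w w' => ?_⟩
  have hA : 0 ≤ A := abs_nonneg _
  rw [Real.coe_toNNReal _ (by positivity), dist_eq_norm, dist_eq_norm]
  have hd : ‖P w - P w'‖ ≤ L * ‖w - w'‖ := hL.norm_sub_le w w'
  have hLw : L * ‖w - w'‖ ≤ (L + M * A) * ‖w - w'‖ := by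
    apply mul_le_mul_of_nonneg_right _ (norm_nonneg _)
    have := mul_nonneg hM0 hA
    linarith
  refine (Prod.norm_def _).trans_le (max_le ?_ ?_)
  · simp only [toricCurve, Prod.fst_sub]
    set a : ℝ := 2 * Real.pi * (s / k) * w
    set b : ℝ := 2 * Real.pi * (s / k) * w'
    have e : ((P w).1 : ℂ) * Complex.exp (a * Complex.I) -
        ((P w').1 : ℂ) * Complex.exp (b * Complex.I) =
        ((P w - P w').1 : ℝ) * Complex.exp (a * Complex.I) +
        ((P w').1 : ℂ) * (Complex.exp (a * Complex.I) - Complex.exp (b * Complex.I)) := by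
      simp only [Prod.fst_sub]
      push_cast
      ring
    rw [e]
    refine (norm_add_le _ _).trans ?_
    rw [norm_mul, norm_mul, Complex.norm_exp_ofReal_mul_I, mul_one, Complex.norm_real,
      Complex.norm_real, add_mul]
    refine add_le_add ((norm_fst_le _).trans hd) ?_
    have hab : |a - b| = A * ‖w - w'‖ := by
      simp only [a, b, A, Real.norm_eq_abs]
      rw [← mul_sub, abs_mul]
    rw [mul_assoc, ← hab]
    exact mul_le_mul ((norm_fst_le _).trans (hM' w')) (norm_exp_sub_exp_le a b) (norm_nonneg _) hM0
  · refine le_trans ?_ (hd.trans hLw)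
    exact norm_snd_le (P w - P w')

theorem toricCurve_periodic {s k : ℕ} (hk : 0 < k) {P : ℝ → ℝ × ℝ} (h : Function.Periodic P 1)
    (w : ℝ) (M : ℤ) : toricCurve s k P (w + k * M) = toricCurve s k P w := by
  have e : P (w + k * M) = P w := by
    have := periodic_add_int h w (k * M)
    push_cast at this
    exact this
  have hk' : (k : ℝ) ≠ 0 := by positivity
  simp only [toricCurve, e]
  congr 2
  rw [Complex.exp_eq_exp_iff_exists_int]
  refine ⟨s * M, ?_⟩
  have : (2 * Real.pi * (s / k) * (w + k * M) : ℝ) =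
      (2 * Real.pi * (s / k) * w + 2 * Real.pi * (s * M) : ℝ) := by
    field_simp
  rw [this]
  push_cast
  ring

/-- A linear homotopy of profiles during which the strings remain disjoint gives an ambient
isotopy. -/
theorem ambientIsotopic_of_segment {s k : ℕ} (hs : 0 < s) (hk : 0 < k) (hks : Nat.Coprime k s)
    {P Q : ℝ → ℝ × ℝ} (hP : IsProfile P) (hQ : IsProfile Q)
    (h : ∀ u ∈ Icc (0 : ℝ) 1, Separated s fun w => P w + u • (Q w - P w)) :
    AmbientIsotopic (range (toricCurve s k P)) (range (toricCurve s k Q)) := by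
  have hs' : (0 : ℝ) < s := by positivity
  have hk' : (0 : ℝ) < k := by positivity
  have hlin : ∀ u w : ℝ, toricCurve s k P w + u • (toricCurve s k Q w - toricCurve s k P w) =
      toricCurve s k (fun w => P w + u • (Q w - P w)) w := by
    intro u w
    ext1
    · simp [toricCurve]
      ring
    · simp [toricCurve]
  obtain ⟨m, hm, hsep⟩ := exists_separation_bound (X := I) hs
    (P := fun u w => P w + (u : ℝ) • (Q w - P w))
    (by have := hP.continuous; have := hQ.continuous; fun_prop)
    (fun u w => by simp only [hP.periodic w, hQ.periodic w]) (fun u => h u u.2)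
  obtain ⟨c, hc, hcle⟩ : ∃ c > 0, ∀ w, c ≤ (P w).1 ∧ c ≤ (Q w).1 := by
    obtain ⟨c, hc, hle⟩ := (isCompact_Icc (a := (0 : ℝ)) (b := 1)).exists_forall_le'
      (f := fun w => min (P w).1 (Q w).1) (a := 0)
      (by have := hP.continuous; have := hQ.continuous; fun_prop)
      (fun w _ => lt_min (hP.pos w) (hQ.pos w))
    refine ⟨c, hc, fun w => ?_⟩
    have := hle (Int.fract w) ⟨Int.fract_nonneg _, (Int.fract_lt_one _).le⟩
    rw [← periodic_add_int hP.periodic _ ⌊w⌋, ← periodic_add_int hQ.periodic _ ⌊w⌋,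
      Int.fract_add_floor] at this
    exact le_min_iff.1 this
  obtain ⟨L₁, hL₁⟩ := hP.exists_lipschitz_toricCurve s k
  obtain ⟨L₂, hL₂⟩ := hQ.exists_lipschitz_toricCurve s k
  set γ := toricCurve s k P
  set δ := toricCurve s k Q
  let L : ℝ := L₁ + L₂ + 1
  have hL : 0 < L := by positivity
  have hγ : ∀ w w', ‖γ w - γ w'‖ ≤ L₁ * |w - w'| := fun w w' => hL₁.norm_sub_le w w'
  have hδ : ∀ w w', ‖δ w - δ w'‖ ≤ L₂ * |w - w'| := fun w w' => hL₂.norm_sub_le w w'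
  have hΔ : ∀ w w', ‖(δ w - γ w) - (δ w' - γ w')‖ ≤ L * |w - w'| := fun w w' => by
    rw [sub_sub_sub_comm]
    refine (norm_sub_le _ _).trans ?_
    have := hγ w w'
    have := hδ w w'
    have := abs_nonneg (w - w')
    simp only [L]
    nlinarith
  have hΔp : ∀ w w' (M : ℤ), ‖(δ w - γ w) - (δ w' - γ w')‖ ≤ L * |w' - w - k * M| := by
    intro w w' M
    have := hΔ (w + k * M) w'
    rw [show γ (w + k * M) = γ w from toricCurve_periodic hk hP.periodic w M,
      show δ (w + k * M) = δ w from toricCurve_periodic hk hQ.periodic w M] at this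
    rwa [← abs_neg, show -(w' - w - k * M) = w + k * M - w' by ring]
  let c₁ : ℝ := 4 * c * s / k
  have hc₁ : 0 < c₁ := by positivity
  -- The first summand serves pairs of nearby points on the same strand, the second one pairs on
  -- different strands.
  let C : ℝ := L / c₁ + L * k * (1 + L / c₁) / m
  have hC : 0 ≤ C := by positivity
  refine ambientIsotopic_of_linear_homotopy (C := Real.toNNReal C) fun u hu w w' => ?_
  rw [Real.coe_toNNReal _ hC]
  set X := ‖(γ w + u • (δ w - γ w)) - (γ w' + u • (δ w' - γ w'))‖ with hX
  have hX0 : 0 ≤ X := norm_nonneg _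
  -- The parameters at the angle of `w` are `w + k q / s`. The nearest one to `w'` is chosen; the
  -- offset `e` is proportional to the angle between the two half planes, which is at most `π`.
  let q : ℤ := round (s * (w' - w) / k)
  let e : ℝ := w' - w - k * q / s
  have heq : w' = w + k * q / s + e := by simp only [e]; ring
  have he : |e| ≤ k / (2 * s) := by
    have := abs_sub_round (s * (w' - w) / k)
    have e1 : e = (s * (w' - w) / k - q) * (k / s) := by
      simp only [e]
      field_simp
    rw [e1, abs_mul, abs_of_pos (by positivity : (0 : ℝ) < k / s)]
    calc _ ≤ 1 / 2 * ((k : ℝ) / s) := by gcongr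
      _ = _ := by ring
  have hang : c₁ * |e| ≤ X := by
    rw [hX, hlin, hlin]
    refine le_trans ?_ (norm_fst_le _)
    simp only [toricCurve, Prod.fst_sub]
    have hcu : ∀ w, c ≤ (P w + u • (Q w - P w)).1 := fun w => by
      have h1 := (hcle w).1
      have h2 := (hcle w).2
      have h3 := hu.1
      have h4 := hu.2
      simp only [Prod.fst_add, Prod.smul_fst, Prod.fst_sub, smul_eq_mul]
      nlinarith
    have := mul_le_norm_polar_sub (c := c) (θ := 2 * Real.pi * (s / k) * w)
      (θ' := 2 * Real.pi * (s / k) * w') (x := 2 * Real.pi * (s / k) * e) q hc (hcu w) (hcu w')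
      (by
        rw [abs_mul, abs_of_pos (by positivity)]
        calc _ ≤ 2 * Real.pi * ((s : ℝ) / k) * (k / (2 * s)) := by gcongr
          _ = Real.pi := by field_simp)
      (by
        conv_lhs => rw [heq]
        field_simp
        ring)
    refine le_trans (le_of_eq ?_) this
    rw [abs_mul, abs_of_pos (by positivity : (0 : ℝ) < 2 * Real.pi * (s / k))]
    simp only [c₁]
    have := Real.pi_pos
    field_simp
    ring
  by_cases hq : (s : ℤ) ∣ q
  · obtain ⟨M, hM⟩ := hq
    refine (hΔp w w' M).trans ?_
    have e1 : w' - w - k * M = e := by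
      simp only [e, hM]
      push_cast
      field_simp
    rw [e1]
    calc L * |e| = L / c₁ * (c₁ * |e|) := by field_simp
      _ ≤ L / c₁ * X := by gcongr
      _ ≤ C * X := by
          gcongr
          simp only [C]
          have : 0 ≤ L * k * (1 + L / c₁) / m := by positivity
          linarith
  · have hkq : ¬ (s : ℤ) ∣ k * q := fun hd => hq
      ((Int.isCoprime_iff_gcd_eq_one.2 (by simpa using hks.symm)).dvd_of_dvd_mul_left hd)
    -- Moving `w'` back by `e` costs at most `L |e|` and brings both points into one half plane,
    -- where their distance is that of the profiles of two different strings.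
    have hm1 : m ≤ X + L * |e| := by
      have h1 := hsep ⟨u, hu⟩ w (k * q) hkq
      have e0 : w + ((k * q : ℤ) : ℝ) / s = w' - e := by
        simp only [e]
        push_cast
        ring
      simp only [e0] at h1
      have h2 : ‖(P (w' - e) + u • (Q (w' - e) - P (w' - e))) - (P w + u • (Q w - P w))‖ ≤
          ‖(γ (w' - e) + u • (δ (w' - e) - γ (w' - e))) - (γ w + u • (δ w - γ w))‖ := by
        rw [hlin, hlin]
        set R := fun w => P w + u • (Q w - P w) with hR
        have hexp : Complex.exp ((2 * Real.pi * (s / k) * (w' - e) : ℝ) * Complex.I) =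
            Complex.exp ((2 * Real.pi * (s / k) * w : ℝ) * Complex.I) := by
          rw [Complex.exp_eq_exp_iff_exists_int]
          refine ⟨q, ?_⟩
          have : (2 * Real.pi * (s / k) * (w' - e) : ℝ) =
              (2 * Real.pi * (s / k) * w + 2 * Real.pi * q : ℝ) := by
            simp only [e]
            field_simp
            ring
          rw [this]
          push_cast
          ring
        change ‖R (w' - e) - R w‖ ≤ _
        rw [Prod.norm_def, Prod.norm_def]
        apply le_of_eq
        congr 1
        simp only [toricCurve, Prod.fst_sub]
        rw [hexp, ← sub_mul, norm_mul, Complex.norm_exp_ofReal_mul_I, mul_one,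
          ← Complex.ofReal_sub, Complex.norm_real]
      refine h1.trans (h2.trans ?_)
      have e2 : (γ (w' - e) + u • (δ (w' - e) - γ (w' - e))) - (γ w + u • (δ w - γ w)) =
          -((γ w + u • (δ w - γ w)) - (γ w' + u • (δ w' - γ w'))) +
          ((1 - u) • (γ (w' - e) - γ w') + u • (δ (w' - e) - δ w')) := by module
      rw [e2]
      refine (norm_add_le _ _).trans (add_le_add (by rw [norm_neg]) ?_)
      refine (norm_add_le _ _).trans ?_
      rw [norm_smul, norm_smul, Real.norm_eq_abs, Real.norm_eq_abs, abs_of_nonneg hu.1,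
        abs_of_nonneg (sub_nonneg.2 hu.2)]
      have h3 := hγ (w' - e) w'
      have h4 := hδ (w' - e) w'
      rw [show w' - e - w' = -e by ring, abs_neg] at h3 h4
      have h5 := hu.1
      have h6 := hu.2
      have h7 : (1 - u) * ‖γ (w' - e) - γ w'‖ ≤ 1 * (L₁ * |e|) :=
        mul_le_mul (by linarith) h3 (norm_nonneg _) zero_le_one
      have h8 : u * ‖δ (w' - e) - δ w'‖ ≤ 1 * (L₂ * |e|) :=
        mul_le_mul (by linarith) h4 (norm_nonneg _) zero_le_one
      have := abs_nonneg e
      simp only [L]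
      nlinarith
    have hm2 : m ≤ (1 + L / c₁) * X := by
      have : L * |e| ≤ L / c₁ * X := by
        calc L * |e| = L / c₁ * (c₁ * |e|) := by field_simp
          _ ≤ _ := by gcongr
      linarith
    -- On different strands a crude bound is enough: the velocities have period `k`, hence differ by
    -- at most `L k`, while `X` is bounded below by a multiple of `m`.
    refine (hΔp w w' (round ((w' - w) / k))).trans ?_
    have h1 : |w' - w - k * (round ((w' - w) / k) : ℤ)| ≤ k := by
      have := abs_sub_round ((w' - w) / k)
      have e1 : w' - w - k * (round ((w' - w) / k) : ℤ) =
          ((w' - w) / k - (round ((w' - w) / k) : ℤ)) * k := by field_simp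
      rw [e1, abs_mul, abs_of_pos hk']
      nlinarith
    calc L * |w' - w - k * (round ((w' - w) / k) : ℤ)| ≤ L * k := by gcongr
      _ = L * k / m * m := by field_simp
      _ ≤ L * k / m * ((1 + L / c₁) * X) := by gcongr
      _ = L * k * (1 + L / c₁) / m * X := by ring
      _ ≤ C * X := by
          gcongr
          simp only [C]
          have : 0 ≤ L / c₁ := by positivity
          linarith

/-- A linear homotopy of profiles is an isotopy if, for any two strings at the same angle, the order
of their distances from the axis or the order of their heights is the same at both ends. -/
theorem ambientIsotopic_of_same_order {s k : ℕ} (hs : 0 < s) (hk : 0 < k) (hks : Nat.Coprime k s)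
    {P Q : ℝ → ℝ × ℝ} (hP : IsProfile P) (hQ : IsProfile Q)
    (h : ∀ (w : ℝ) (N : ℤ), ¬ (s : ℤ) ∣ N →
      0 < ((P (w + N / s)).1 - (P w).1) * ((Q (w + N / s)).1 - (Q w).1) ∨
      0 < ((P (w + N / s)).2 - (P w).2) * ((Q (w + N / s)).2 - (Q w).2)) :
    AmbientIsotopic (range (toricCurve s k P)) (range (toricCurve s k Q)) := by
  have key : ∀ a b u : ℝ, u ∈ Icc (0 : ℝ) 1 → 0 < a * b → a + u * (b - a) ≠ 0 := by
    rintro a b u ⟨h0, h1⟩ hab h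
    have h2 : (1 - u) * a ^ 2 + u * (a * b) = 0 := by linear_combination a * h
    have ha : 0 < a ^ 2 := by
      have : a ≠ 0 := by rintro rfl; simp at hab
      positivity
    rcases h0.eq_or_lt with rfl | h0
    · linarith
    · have := mul_pos h0 hab
      have := mul_nonneg (sub_nonneg.2 h1) ha.le
      linarith
  refine ambientIsotopic_of_segment hs hk hks hP hQ fun u hu w N hN e => ?_
  rcases h w N hN with h | h
  · refine key _ _ u hu h ?_
    have := congrArg Prod.fst e
    simp only [Prod.fst_add, Prod.smul_fst, Prod.fst_sub, smul_eq_mul] at this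
    linear_combination this
  · refine key _ _ u hu h ?_
    have := congrArg Prod.snd e
    simp only [Prod.snd_add, Prod.smul_snd, Prod.snd_sub, smul_eq_mul] at this
    linear_combination this

/-- A continuous family of profiles with disjoint strings gives an ambient isotopy. -/
theorem ambientIsotopic_of_family {s k : ℕ} (hs : 0 < s) (hk : 0 < k) (hks : Nat.Coprime k s)
    {a b : ℝ} (hab : a ≤ b) {P : ℝ → ℝ → ℝ × ℝ}
    (hc : Continuous fun p : Icc a b × ℝ => P p.1 p.2)
    (hP : ∀ μ ∈ Icc a b, IsProfile (P μ)) (h : ∀ μ ∈ Icc a b, Separated s (P μ)) :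
    AmbientIsotopic (range (toricCurve s k (P a))) (range (toricCurve s k (P b))) := by
  obtain ⟨m, hm, hsep⟩ := exists_separation_bound (X := Icc a b) hs (P := fun μ => P μ) hc
    (fun μ => (hP μ μ.2).periodic) (fun μ => h μ μ.2)
  refine isPreconnected_Icc.induction₂ (s := Icc a b)
      (fun u v => AmbientIsotopic (range (toricCurve s k (P u))) (range (toricCurve s k (P v))))
      ?_ (fun x y z _ _ _ h1 h2 => h1.trans h2) (fun x y _ _ h => h.symm)
      (left_mem_Icc.2 hab) (right_mem_Icc.2 hab)
  intro μ hμ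
  -- If every string moves by less than `m / 2`, strings at mutual distance at least `m` stay
  -- disjoint along the straight homotopy; so neighbouring members of the family are isotopic.
  have hev : ∀ᶠ ν : Icc a b in 𝓝 ⟨μ, hμ⟩, ∀ w ∈ Icc (0 : ℝ) 1, ‖P ν w - P μ w‖ < m / 2 := by
    apply (isCompact_Icc (a := (0 : ℝ)) (b := 1)).eventually_forall_of_forall_eventually
    intro w _
    have hc' : Continuous fun p : Icc a b × ℝ => ‖P p.1 p.2 - P μ p.2‖ :=
      (hc.sub ((hP μ hμ).continuous.comp continuous_snd)).norm
    have := hc'.tendsto (⟨μ, hμ⟩, w)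
    simp only [sub_self, norm_zero] at this
    exact this.eventually_lt_const (half_pos hm)
  rw [nhdsWithin_eq_map_subtype_coe hμ, eventually_map]
  filter_upwards [hev] with ν hν
  have hν' : ∀ w, ‖P ν w - P μ w‖ < m / 2 := fun w => by
    have := hν (Int.fract w) ⟨Int.fract_nonneg _, (Int.fract_lt_one _).le⟩
    rwa [← periodic_add_int (hP ν ν.2).periodic _ ⌊w⌋, ← periodic_add_int (hP μ hμ).periodic _ ⌊w⌋,
      Int.fract_add_floor] at this
  refine ambientIsotopic_of_segment hs hk hks (hP μ hμ) (hP ν ν.2) fun u hu w N hN e => ?_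
  have h1 := hsep ⟨μ, hμ⟩ w N hN
  simp only at h1 e
  have e2 : P μ (w + N / s) - P μ w =
      u • (P ν w - P μ w) - u • (P ν (w + N / s) - P μ (w + N / s)) := by
    rw [sub_eq_sub_iff_add_eq_add, e]
    abel
  have hb : ∀ w, ‖u • (P ν w - P μ w)‖ < m / 2 := fun w => by
    rw [norm_smul, Real.norm_eq_abs, abs_of_nonneg hu.1]
    have := hν' w
    have := norm_nonneg (P ν w - P μ w)
    nlinarith [hu.1, hu.2]
  rw [e2] at h1
  have := norm_sub_le (u • (P ν w - P μ w)) (u • (P ν (w + N / s) - P μ (w + N / s)))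
  linarith [hb w, hb (w + N / s)]

/-! ### Rotations, reflections and the mirror image -/

/-- Rotation about the axis. -/
noncomputable def axialRotation (θ : ℝ) : (ℂ × ℝ) ≃ₜ (ℂ × ℝ) :=
  (Homeomorph.mulLeft₀ (Complex.exp (θ * Complex.I)) (Complex.exp_ne_zero _)).prodCongr
    (Homeomorph.refl ℝ)

/-- Translating the parameter of a profile rotates the closed braid. -/
theorem ambientIsotopic_translate (s k : ℕ) (P : ℝ → ℝ × ℝ) (c : ℝ) :
    AmbientIsotopic (range (toricCurve s k P)) (range (toricCurve s k fun w => P (w + c))) := by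
  let θ : ℝ := -(2 * Real.pi * (s / k) * c)
  refine ⟨fun u => axialRotation (u * θ), ?_, fun x => ?_, ?_⟩
  · change Continuous fun p : I × (ℂ × ℝ) =>
      (Complex.exp (((p.1 : ℝ) * θ : ℝ) * Complex.I) * p.2.1, p.2.2)
    fun_prop
  · refine Prod.ext ?_ rfl
    simp [axialRotation]
  · rw [← range_comp]
    have : (⇑(axialRotation ((1 : I) * θ)) ∘ toricCurve s k P) ∘ (fun w => w + c) =
        toricCurve s k fun w => P (w + c) := by
      funext w
      have e : Complex.exp ((2 * Real.pi * (s / k) * (w + c) : ℝ) * Complex.I) =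
          Complex.exp ((2 * Real.pi * (s / k) * w : ℝ) * Complex.I) *
          Complex.exp ((2 * Real.pi * (s / k) * c : ℝ) * Complex.I) := by
        rw [← Complex.exp_add]
        push_cast
        ring_nf
      refine Prod.ext ?_ rfl
      change Complex.exp (((((1 : I) : ℝ) * θ : ℝ) : ℂ) * Complex.I) * (((P (w + c)).1 : ℂ) *
        Complex.exp ((2 * Real.pi * (s / k) * (w + c) : ℝ) * Complex.I)) =
        ((P (w + c)).1 : ℂ) * Complex.exp ((2 * Real.pi * (s / k) * w : ℝ) * Complex.I)
      rw [e]
      have e' : Complex.exp (((((1 : I) : ℝ) * θ : ℝ) : ℂ) * Complex.I) *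
          Complex.exp ((2 * Real.pi * (s / k) * c : ℝ) * Complex.I) = 1 := by
        rw [← Complex.exp_add, ← Complex.exp_zero]
        congr 1
        simp only [θ, Set.Icc.coe_one]
        push_cast
        ring
      linear_combination ((P (w + c)).1 : ℂ) *
        Complex.exp ((2 * Real.pi * (s / k) * w : ℝ) * Complex.I) * e'
    rw [← this]
    exact ((Equiv.addRight c).surjective.range_comp _).symm

/-- The reflection in the horizontal plane. -/
noncomputable def heightReflection : (ℂ × ℝ) ≃ₜ (ℂ × ℝ) :=
  (Homeomorph.refl ℂ).prodCongr (Homeomorph.neg ℝ)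

/-- Rotation about the line `ℝ × {0}`. -/
noncomputable def lineRotation (θ : ℝ) : (ℂ × ℝ) ≃ₜ (ℂ × ℝ) where
  toFun p := (⟨p.1.re, Real.cos θ * p.1.im - Real.sin θ * p.2⟩,
    Real.sin θ * p.1.im + Real.cos θ * p.2)
  invFun p := (⟨p.1.re, Real.cos θ * p.1.im + Real.sin θ * p.2⟩,
    -Real.sin θ * p.1.im + Real.cos θ * p.2)
  left_inv p := by
    have := Real.sin_sq_add_cos_sq θ
    refine Prod.ext (Complex.ext rfl ?_) ?_
    · simp only
      linear_combination p.1.im * this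
    · simp only
      linear_combination p.2 * this
  right_inv p := by
    have := Real.sin_sq_add_cos_sq θ
    refine Prod.ext (Complex.ext rfl ?_) ?_
    · simp only
      linear_combination p.1.im * this
    · simp only
      linear_combination p.2 * this
  continuous_toFun := by
    simp only [Complex.mk_eq_add_mul_I]
    fun_prop
  continuous_invFun := by
    simp only [Complex.mk_eq_add_mul_I]
    fun_prop

/-- The two reflections differ by a half turn about the real axis, which is reached from the
identity through rotations. -/
theorem ambientIsotopic_heightReflection_mirror (K : Set (ℂ × ℝ)) :
    AmbientIsotopic (heightReflection '' K) (mirror K) := by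
  refine ⟨fun u => lineRotation (u * Real.pi), ?_, fun x => ?_, ?_⟩
  · change Continuous fun p : I × (ℂ × ℝ) =>
      ((⟨p.2.1.re, Real.cos (p.1 * Real.pi) * p.2.1.im - Real.sin (p.1 * Real.pi) * p.2.2⟩ : ℂ),
        Real.sin (p.1 * Real.pi) * p.2.1.im + Real.cos (p.1 * Real.pi) * p.2.2)
    simp only [Complex.mk_eq_add_mul_I]
    fun_prop
  · simp [lineRotation]
  · rw [image_image, mirror]
    congr 1
    funext p
    refine Prod.ext (Complex.ext ?_ ?_) ?_ <;> simp [lineRotation, heightReflection]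

theorem heightReflection_image_toricKnot (s k : ℕ) (P : ℝ → ℝ × ℝ) :
    heightReflection '' range (toricCurve s k P) =
      range (toricCurve s k fun w => ((P w).1, -(P w).2)) := by
  rw [← range_comp]
  rfl

/-! ### Lipschitz functions of period one and the sawtooth function -/

/-- `f` is Lipschitz continuous, with some constant. -/
def IsLipschitz {α β : Type*} [PseudoEMetricSpace α] [PseudoEMetricSpace β] (f : α → β) : Prop :=
  ∃ L : ℝ≥0, LipschitzWith L f

namespace IsLipschitz

variable {α β γ : Type*} [PseudoEMetricSpace α] [PseudoEMetricSpace β] [PseudoEMetricSpace γ]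

theorem comp {g : β → γ} {f : α → β} : IsLipschitz g → IsLipschitz f →
    IsLipschitz fun x => g (f x)
  | ⟨_, hg⟩, ⟨_, hf⟩ => ⟨_, hg.comp hf⟩

theorem prodMk {f : α → β} {g : α → γ} : IsLipschitz f → IsLipschitz g →
    IsLipschitz fun x => (f x, g x)
  | ⟨_, hf⟩, ⟨_, hg⟩ => ⟨_, hf.prodMk hg⟩

theorem const (c : β) : IsLipschitz fun _ : α => c := ⟨0, LipschitzWith.const c⟩

theorem add {f g : α → ℝ} : IsLipschitz f → IsLipschitz g → IsLipschitz fun x => f x + g x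
  | ⟨_, hf⟩, ⟨_, hg⟩ => ⟨_, hf.add hg⟩

theorem sub {f g : α → ℝ} : IsLipschitz f → IsLipschitz g → IsLipschitz fun x => f x - g x
  | ⟨_, hf⟩, ⟨_, hg⟩ => ⟨_, hf.sub hg⟩

theorem min {f g : α → ℝ} : IsLipschitz f → IsLipschitz g → IsLipschitz fun x => min (f x) (g x)
  | ⟨_, hf⟩, ⟨_, hg⟩ => ⟨_, hf.min hg⟩

theorem max {f g : α → ℝ} : IsLipschitz f → IsLipschitz g → IsLipschitz fun x => max (f x) (g x)
  | ⟨_, hf⟩, ⟨_, hg⟩ => ⟨_, hf.max hg⟩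

theorem const_mul {f : α → ℝ} (hf : IsLipschitz f) (c : ℝ) : IsLipschitz fun x => c * f x :=
  IsLipschitz.comp (g := fun y : ℝ => c * y) ⟨_, lipschitzWith_smul c⟩ hf

theorem abs {f : α → ℝ} (hf : IsLipschitz f) : IsLipschitz fun x => |f x| :=
  IsLipschitz.comp (g := fun y : ℝ => |y|) ⟨1, lipschitzWith_one_norm (E := ℝ)⟩ hf

theorem sin {f : α → ℝ} (hf : IsLipschitz f) : IsLipschitz fun x => Real.sin (f x) :=
  IsLipschitz.comp ⟨1, Real.lipschitzWith_sin⟩ hf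

theorem cos {f : α → ℝ} (hf : IsLipschitz f) : IsLipschitz fun x => Real.cos (f x) :=
  IsLipschitz.comp ⟨1, Real.lipschitzWith_cos⟩ hf

theorem sum {ι : Type*} (t : Finset ι) {f : ι → α → ℝ} (hf : ∀ i, IsLipschitz (f i)) :
    IsLipschitz fun x => ∑ i ∈ t, f i x := by
  classical
  induction t using Finset.induction_on with
  | empty => simpa using const (0 : ℝ)
  | insert i t hi ih =>
    simp only [Finset.sum_insert hi]
    exact (hf i).add ih

theorem id : IsLipschitz fun x : α => x := ⟨1, LipschitzWith.id⟩

theorem affine (a b : ℝ) : IsLipschitz fun x : ℝ => a * x + b :=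
  (id.const_mul a).add (const b)

end IsLipschitz

/-- If an integer lies between the two arguments, the path from one value to the other is broken at
the common value `g 0 = g 1`. -/
theorem lipschitzWith_comp_fract {E : Type*} [PseudoMetricSpace E] {g : ℝ → E} {L : ℝ≥0}
    (hg : LipschitzOnWith L g (Icc 0 1)) (h : g 0 = g 1) :
    LipschitzWith L fun x => g (Int.fract x) := by
  have mem : ∀ x : ℝ, Int.fract x ∈ Icc (0 : ℝ) 1 :=
    fun x => ⟨Int.fract_nonneg x, (Int.fract_lt_one x).le⟩
  have key : ∀ a b : ℝ, a ≤ b → dist (g (Int.fract a)) (g (Int.fract b)) ≤ L * dist a b := by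
    intro a b hab
    rw [dist_comm a b, Real.dist_eq, abs_of_nonneg (sub_nonneg.2 hab)]
    rcases (Int.floor_le_floor hab).eq_or_lt with hf | hf
    · refine (hg.dist_le_mul _ (mem a) _ (mem b)).trans ?_
      rw [dist_comm, Real.dist_eq, Int.fract, Int.fract, hf, sub_sub_sub_cancel_right,
        abs_of_nonneg (sub_nonneg.2 hab)]
    · have h1 := hg.dist_le_mul _ (mem a) _ (right_mem_Icc.2 zero_le_one)
      have h2 := hg.dist_le_mul _ (left_mem_Icc.2 zero_le_one) _ (mem b)
      rw [dist_comm (Int.fract a), Real.dist_eq, abs_of_nonneg (sub_nonneg.2 (mem a).2)] at h1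
      rw [dist_comm 0, Real.dist_eq, sub_zero, abs_of_nonneg (mem b).1, h] at h2
      have h3 : (⌊a⌋ : ℝ) + 1 ≤ ⌊b⌋ := by exact_mod_cast hf
      have h4 : (1 - Int.fract a) + Int.fract b ≤ b - a := by
        rw [Int.fract, Int.fract]
        linarith
      calc _ ≤ _ := dist_triangle _ (g 1) _
        _ ≤ L * ((1 - Int.fract a) + Int.fract b) := by linarith
        _ ≤ _ := by gcongr
  refine LipschitzWith.of_dist_le_mul fun a b => ?_
  rcases le_total a b with hab | hab
  · exact key a b hab
  · rw [dist_comm, dist_comm a]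
    exact key b a hab

theorem IsLipschitz.comp_fract {E : Type*} [PseudoMetricSpace E] {g : ℝ → E} (hg : IsLipschitz g)
    (h : g 0 = g 1) : IsLipschitz fun x => g (Int.fract x) :=
  ⟨hg.choose, lipschitzWith_comp_fract (hg.choose_spec.lipschitzOnWith) h⟩

theorem sawtooth_eq (t : ℝ) : sawtooth t = 2 * |Int.fract t - 1 / 2| := rfl

theorem sawtooth_nonneg (t : ℝ) : 0 ≤ sawtooth t := by
  rw [sawtooth_eq]
  positivity

theorem sawtooth_le_one (t : ℝ) : sawtooth t ≤ 1 := by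
  rw [sawtooth_eq]
  have := abs_le.2 (⟨by linarith [Int.fract_nonneg t], by linarith [Int.fract_lt_one t]⟩ :
    -(1 / 2 : ℝ) ≤ Int.fract t - 1 / 2 ∧ Int.fract t - 1 / 2 ≤ 1 / 2)
  linarith

theorem sawtooth_add_int (t : ℝ) (n : ℤ) : sawtooth (t + n) = sawtooth t := by
  rw [sawtooth_eq, sawtooth_eq, Int.fract_add_intCast]

theorem isLipschitz_sawtooth : IsLipschitz sawtooth :=
  IsLipschitz.comp_fract (g := fun t => 2 * |t - 1 / 2|)
    ((IsLipschitz.id.sub (IsLipschitz.const _)).abs.const_mul 2) (by norm_num)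

/-- This makes the cosine a strictly increasing function of the sawtooth, so comparisons of sawtooth
values become trigonometry. -/
theorem cos_two_pi_mul (t : ℝ) :
    Real.cos (2 * Real.pi * t) = -Real.cos (Real.pi * sawtooth t) := by
  have h : Real.cos (2 * Real.pi * t) = Real.cos (2 * Real.pi * Int.fract t) := by
    rw [Int.fract, mul_sub, show 2 * Real.pi * (⌊t⌋ : ℝ) = ⌊t⌋ * (2 * Real.pi) by ring,
      Real.cos_sub_int_mul_two_pi]
  rw [h, sawtooth_eq, ← Real.cos_sub_pi]
  rcases le_total (1 / 2) (Int.fract t) with h | h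
  · rw [abs_of_nonneg (by linarith), ← Real.cos_sub_two_pi]
    ring_nf
  · rw [abs_of_nonpos (by linarith), ← Real.cos_neg]
    ring_nf

/-- The sawtooth function and the cosine order any two values in the same way. -/
theorem sawtooth_sub_mul_cos_sub_pos {a b : ℝ} (h : sawtooth a ≠ sawtooth b) :
    0 < (sawtooth a - sawtooth b) *
      (Real.cos (2 * Real.pi * a) - Real.cos (2 * Real.pi * b)) := by
  have mem : ∀ t, Real.pi * sawtooth t ∈ Icc 0 Real.pi := fun t =>
    ⟨mul_nonneg Real.pi_pos.le (sawtooth_nonneg t),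
      mul_le_of_le_one_right Real.pi_pos.le (sawtooth_le_one t)⟩
  rw [cos_two_pi_mul, cos_two_pi_mul]
  rcases lt_or_gt_of_ne h with h | h
  · have := Real.strictAntiOn_cos (mem a) (mem b) (mul_lt_mul_of_pos_left h Real.pi_pos)
    exact mul_pos_of_neg_of_neg (by linarith) (by linarith)
  · have := Real.strictAntiOn_cos (mem b) (mem a) (mul_lt_mul_of_pos_left h Real.pi_pos)
    exact mul_pos (by linarith) (by linarith)

theorem cos_sub_cos_eq (a b : ℝ) : Real.cos (2 * Real.pi * a) - Real.cos (2 * Real.pi * b) =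
    -2 * (Real.sin (Real.pi * (a + b)) * Real.sin (Real.pi * (a - b))) := by
  rw [Real.cos_sub_cos]
  ring_nf

/-- The sum-to-product formula for the cosines decides which of two sawtooth values is larger. All
crossing signs below are computed in this way. -/
theorem sawtooth_sub_mul_sin_neg {a b : ℝ}
    (h : Real.sin (Real.pi * (a + b)) * Real.sin (Real.pi * (a - b)) ≠ 0) :
    (sawtooth a - sawtooth b) *
      (Real.sin (Real.pi * (a + b)) * Real.sin (Real.pi * (a - b))) < 0 := by
  have hne : sawtooth a ≠ sawtooth b := by
    intro e
    have := cos_sub_cos_eq a b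
    rw [cos_two_pi_mul, cos_two_pi_mul, e, sub_self] at this
    apply h
    linarith
  have := sawtooth_sub_mul_cos_sub_pos hne
  rw [cos_sub_cos_eq] at this
  linarith

theorem sin_pi_mul_eq_zero_iff {x : ℝ} : Real.sin (Real.pi * x) = 0 ↔ ∃ n : ℤ, x = n := by
  rw [Real.sin_eq_zero_iff]
  refine exists_congr fun n => ?_
  rw [mul_comm, mul_right_inj' Real.pi_ne_zero, eq_comm]

theorem sin_mul_sin_eq_zero_of_sawtooth_eq {a b : ℝ} (h : sawtooth a = sawtooth b) :
    Real.sin (Real.pi * (a + b)) * Real.sin (Real.pi * (a - b)) = 0 := by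
  by_contra hne
  have := sawtooth_sub_mul_sin_neg hne
  rw [h, sub_self, zero_mul] at this
  exact lt_irrefl _ this

theorem int_of_sawtooth_eq {a b : ℝ} (h : sawtooth a = sawtooth b) (hab : ∀ n : ℤ, a - b ≠ n) :
    ∃ n : ℤ, a + b = n := by
  rcases mul_eq_zero.1 (sin_mul_sin_eq_zero_of_sawtooth_eq h) with h | h
  · exact sin_pi_mul_eq_zero_iff.1 h
  · obtain ⟨n, hn⟩ := sin_pi_mul_eq_zero_iff.1 h
    exact absurd hn (hab n)

theorem div_ne_int {s : ℕ} (hs : 0 < s) {N : ℤ} (hN : ¬ (s : ℤ) ∣ N) (n : ℤ) :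
    (N : ℝ) / s ≠ n := by
  have hs' : (s : ℝ) ≠ 0 := by positivity
  intro h
  apply hN
  refine ⟨n, ?_⟩
  rw [div_eq_iff hs'] at h
  have : (N : ℝ) = ((s * n : ℤ) : ℝ) := by
    push_cast
    linarith
  exact_mod_cast this

/-! ### Lissajous profiles -/

/-- Distances and heights oscillate with the frequencies `s + 1` and `1`. -/
noncomputable def lissajous (s : ℕ) (φ w : ℝ) : ℝ × ℝ :=
  (1 + sawtooth ((s + 1) * w), sawtooth (w + φ))

/-- Distances and heights oscillate with the frequencies `1` and `s + 1`. -/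
noncomputable def dualLissajous (s : ℕ) (χ w : ℝ) : ℝ × ℝ :=
  (2 - sawtooth w, sawtooth ((s + 1) * w + χ))

theorem sawtooth_freq_periodic (s : ℕ) (χ w : ℝ) :
    sawtooth ((s + 1) * (w + 1) + χ) = sawtooth ((s + 1) * w + χ) := by
  rw [← sawtooth_add_int ((s + 1) * w + χ) (s + 1)]
  push_cast
  ring_nf

theorem isProfile_lissajous (s : ℕ) (φ : ℝ) : IsProfile (lissajous s φ) where
  periodic w := by
    have h1 := sawtooth_freq_periodic s 0 w
    have h2 := sawtooth_add_int (w + φ) 1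
    simp only [add_zero, Int.cast_one] at h1 h2
    simp only [lissajous, h1, add_right_comm w 1 φ, h2]
  lipschitz := by
    refine IsLipschitz.prodMk (IsLipschitz.add (IsLipschitz.const 1) ?_) ?_
    · exact isLipschitz_sawtooth.comp (IsLipschitz.id.const_mul _)
    · exact isLipschitz_sawtooth.comp (IsLipschitz.id.add (IsLipschitz.const _))
  pos w := by
    have := sawtooth_nonneg ((s + 1) * w)
    simp only [lissajous]
    linarith

theorem isProfile_dualLissajous (s : ℕ) (χ : ℝ) : IsProfile (dualLissajous s χ) where
  periodic w := by
    have h2 := sawtooth_add_int w 1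
    simp only [Int.cast_one] at h2
    simp only [dualLissajous, sawtooth_freq_periodic, h2]
  lipschitz := by
    refine IsLipschitz.prodMk (IsLipschitz.sub (IsLipschitz.const 2) isLipschitz_sawtooth) ?_
    exact isLipschitz_sawtooth.comp (IsLipschitz.affine _ _)
  pos w := by
    have := sawtooth_le_one w
    simp only [dualLissajous]
    linarith

theorem IsProfile.translate {P : ℝ → ℝ × ℝ} (h : IsProfile P) (c : ℝ) :
    IsProfile fun w => P (w + c) where
  periodic w := by
    change P (w + 1 + c) = P (w + c)
    rw [add_right_comm, h.periodic]
  lipschitz := IsLipschitz.comp h.lipschitz (IsLipschitz.id.add (IsLipschitz.const c))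
  pos w := h.pos _

theorem separated_translate {s : ℕ} {P : ℝ → ℝ × ℝ} (c : ℝ) :
    Separated s (fun w => P (w + c)) ↔ Separated s P := by
  refine ⟨fun h w N hN => ?_, fun h w N hN => ?_⟩
  · have := h (w - c) N hN
    simp only at this
    rwa [show w - c + N / s + c = w + N / s by ring, sub_add_cancel] at this
  · have := h (w + c) N hN
    simp only
    rwa [add_right_comm] at this

/-- The two Lissajous profiles are obtained from each other by a quarter turn. -/
theorem separated_lissajous_iff {s : ℕ} {φ : ℝ} :
    Separated s (lissajous s φ) ↔ Separated s (dualLissajous s (-((s + 1) * φ))) := by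
  rw [← separated_translate (P := dualLissajous s _) φ]
  refine forall_congr' fun w => forall_congr' fun N => imp_congr_right fun _ => not_congr ?_
  simp only [lissajous, dualLissajous, Prod.mk.injEq]
  rw [show ((s : ℝ) + 1) * (w + N / s + φ) + -((s + 1) * φ) = (s + 1) * (w + N / s) by ring,
    show ((s : ℝ) + 1) * (w + φ) + -((s + 1) * φ) = (s + 1) * w by ring]
  constructor
  · rintro ⟨h1, h2⟩
    exact ⟨by linarith, by linarith⟩
  · rintro ⟨h1, h2⟩
    exact ⟨by linarith, by linarith⟩

/-- After a translation of the parameter by `φ`, the dual profile is a quarter turn `J` of the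
original one, up to a constant. In the linear homotopy the difference of two strings is multiplied
by `(1 - u) + u J`, whose determinant `(1 - u)² + u²` is positive, so no collision is created. -/
theorem ambientIsotopic_lissajous_dual {s k : ℕ} (hs : 0 < s) (hk : 0 < k)
    (hks : Nat.Coprime k s) {φ : ℝ} (h : Separated s (lissajous s φ)) :
    AmbientIsotopic (range (toricCurve s k (lissajous s φ)))
      (range (toricCurve s k (dualLissajous s (-((s + 1) * φ))))) := by
  refine AmbientIsotopic.trans ?_ (ambientIsotopic_translate s k _ φ).symm
  refine ambientIsotopic_of_segment hs hk hks (isProfile_lissajous s φ)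
    ((isProfile_dualLissajous s _).translate φ) fun u hu w N hN e => h w N hN ?_
  simp only [lissajous, dualLissajous, Prod.ext_iff, Prod.fst_add, Prod.smul_fst, Prod.fst_sub,
    smul_eq_mul, Prod.snd_add, Prod.smul_snd, Prod.snd_sub] at e ⊢
  rw [show ((s : ℝ) + 1) * (w + N / s + φ) + -((s + 1) * φ) = (s + 1) * (w + N / s) by ring,
    show ((s : ℝ) + 1) * (w + φ) + -((s + 1) * φ) = (s + 1) * w by ring] at e
  set a := sawtooth ((s + 1) * (w + N / s))
  set b := sawtooth ((s + 1) * w)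
  set c := sawtooth (w + N / s + φ)
  set d := sawtooth (w + φ)
  obtain ⟨e1, e2⟩ := e
  have hpos : 0 < (1 - u) ^ 2 + u ^ 2 := by nlinarith [sq_nonneg (1 - 2 * u)]
  have h1 : ((1 - u) ^ 2 + u ^ 2) * (a - b) = 0 := by linear_combination (1 - u) * e1 + u * e2
  have h2 : ((1 - u) ^ 2 + u ^ 2) * (c - d) = 0 := by linear_combination -u * e1 + (1 - u) * e2
  have h3 := (mul_eq_zero.1 h1).resolve_left hpos.ne'
  have h4 := (mul_eq_zero.1 h2).resolve_left hpos.ne'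
  exact ⟨by linarith, by linarith⟩

/-- The order of the heights where two strings of a Lissajous profile cross. -/
theorem dualLissajous_crossing {s : ℕ} (hs : 0 < s) {χ w : ℝ} {N : ℤ} (hN : ¬ (s : ℤ) ∣ N)
    (hw : sawtooth (w + N / s) = sawtooth w) : ∃ M A : ℤ, w + N / s + w = M ∧ ¬ (s : ℤ) ∣ A ∧
      2 * (w + N / s) = A / s ∧
      Real.sin (Real.pi * ((s + 1) * (w + N / s) + χ + ((s + 1) * w + χ))) *
        Real.sin (Real.pi * ((s + 1) * (w + N / s) + χ - ((s + 1) * w + χ))) =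
      (-1) ^ A * Real.sin (2 * Real.pi * χ) * Real.sin (2 * Real.pi * (w + N / s)) := by
  have hs' : (s : ℝ) ≠ 0 := by positivity
  obtain ⟨M, hM⟩ := int_of_sawtooth_eq hw fun n => by
    rw [add_sub_cancel_left]
    exact div_ne_int hs hN n
  have hA : 2 * (w + N / s) = ((s * M + N : ℤ) : ℝ) / s := by
    have hNs : (s : ℝ) * (N / s) = N := mul_div_cancel₀ _ hs'
    rw [eq_div_iff hs']
    push_cast
    linear_combination (s : ℝ) * hM + hNs
  refine ⟨M, s * M + N, hM, fun hd => hN ((Int.dvd_add_right (dvd_mul_right _ _)).1 hd), hA, ?_⟩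
  set w' := w + N / s
  have hw' : w = M - w' := eq_sub_of_add_eq' hM
  have h1 : Real.pi * ((s + 1) * w' + χ + ((s + 1) * w + χ)) =
      2 * Real.pi * χ + ((s + 1) * M : ℤ) * Real.pi := by
    rw [hw']
    push_cast
    ring
  have h2 : Real.pi * ((s + 1) * w' + χ - ((s + 1) * w + χ)) =
      2 * Real.pi * w' + (s * M + N : ℤ) * Real.pi - ((s + 1) * M : ℤ) * Real.pi := by
    rw [div_eq_mul_inv] at hA
    have : (s : ℝ) * (2 * w') = ((s * M + N : ℤ) : ℝ) := by
      rw [hA]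
      field_simp
    rw [hw', ← this]
    push_cast
    ring
  rw [h1, h2, Real.sin_add_int_mul_pi, Real.sin_sub_int_mul_pi, Real.sin_add_int_mul_pi]
  -- The sum and the difference of the arguments contribute the same sign, which cancels; only the
  -- sign of `A` survives.
  have h3 : ((-1 : ℝ) ^ ((s + 1) * M : ℤ)) * ((-1 : ℝ) ^ ((s + 1) * M : ℤ)) = 1 := by
    rw [← mul_zpow]
    norm_num
  linear_combination (Real.sin (2 * Real.pi * χ)) * (-1) ^ (s * M + N : ℤ) *
    Real.sin (2 * Real.pi * w') * h3

theorem sin_two_pi_ne_zero {s : ℕ} (hs : 0 < s) {w : ℝ} {A : ℤ} (hA : ¬ (s : ℤ) ∣ A)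
    (h : 2 * w = A / s) : Real.sin (2 * Real.pi * w) ≠ 0 := by
  rw [show 2 * Real.pi * w = Real.pi * (2 * w) by ring, h, Ne, sin_pi_mul_eq_zero_iff]
  rintro ⟨n, hn⟩
  exact div_ne_int hs hA n hn

theorem separated_dualLissajous {s : ℕ} (hs : 0 < s) {χ : ℝ}
    (hχ : Real.sin (2 * Real.pi * χ) ≠ 0) : Separated s (dualLissajous s χ) := by
  intro w N hN e
  simp only [dualLissajous, Prod.mk.injEq] at e
  obtain ⟨M, A, -, hA, hA', h⟩ := dualLissajous_crossing hs (χ := χ) hN (by linarith [e.1])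
  rw [sin_mul_sin_eq_zero_of_sawtooth_eq e.2] at h
  refine mul_ne_zero (mul_ne_zero (zpow_ne_zero A (by norm_num)) hχ)
    (sin_two_pi_ne_zero hs hA hA') h.symm

/-- The strings with parameters `±1 / (2s)` are at the same distance from the axis for every phase,
and a vanishing sine makes their heights equal. -/
theorem sin_ne_zero_of_separated_dualLissajous {s : ℕ} (hs : 2 ≤ s) {χ : ℝ}
    (h : Separated s (dualLissajous s χ)) : Real.sin (2 * Real.pi * χ) ≠ 0 := by
  intro h0
  have h1 : ¬ (s : ℤ) ∣ 1 := fun hd => by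
    have := Int.le_of_dvd one_pos hd
    omega
  have e : -(1 / (2 * s) : ℝ) + (1 : ℤ) / s = 1 / (2 * s) := by
    push_cast
    field_simp
    norm_num
  have hsaw : sawtooth (-(1 / (2 * s) : ℝ) + (1 : ℤ) / s) = sawtooth (-(1 / (2 * s) : ℝ)) := by
    by_contra hne
    have := sawtooth_sub_mul_cos_sub_pos hne
    rw [e, mul_neg, Real.cos_neg, sub_self, mul_zero] at this
    exact lt_irrefl _ this
  apply h (-(1 / (2 * s))) 1 h1
  obtain ⟨M, A, -, -, -, h2⟩ := dualLissajous_crossing (by omega) (χ := χ) h1 hsaw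
  simp only [dualLissajous, Prod.mk.injEq]
  refine ⟨by rw [hsaw], ?_⟩
  by_contra hne
  have := sawtooth_sub_mul_cos_sub_pos hne
  rw [cos_sub_cos_eq, h2, h0] at this
  simp at this

/-! ### Spiral profiles -/

/-- While the fractional part of the parameter grows from `0` to `μ`, the distance from the axis
grows and the height oscillates; then the distance decreases at the height `0`. -/
noncomputable def spiral (s : ℕ) (μ w : ℝ) : ℝ × ℝ :=
  (1 + min (Int.fract w / μ) ((1 - Int.fract w) / (1 - μ)),
    Real.sin (Real.pi * ((s - 1) * min (Int.fract w / μ) 1)))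

theorem sin_pi_mul_sub_one (s : ℕ) : Real.sin (Real.pi * ((s : ℝ) - 1)) = 0 :=
  sin_pi_mul_eq_zero_iff.2 ⟨s - 1, by push_cast; rfl⟩

theorem isProfile_spiral (s : ℕ) {μ : ℝ} (h0 : 0 < μ) (h1 : μ < 1) : IsProfile (spiral s μ) where
  periodic w := by simp [spiral]
  lipschitz := by
    refine IsLipschitz.comp_fract (g := fun t => ((1 + min (t / μ) ((1 - t) / (1 - μ)),
      Real.sin (Real.pi * ((s - 1) * min (t / μ) 1))) : ℝ × ℝ)) ?_ ?_
    · have hd : IsLipschitz fun t : ℝ => t / μ := by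
        simp only [div_eq_inv_mul]
        exact IsLipschitz.id.const_mul _
      refine IsLipschitz.prodMk ((IsLipschitz.const 1).add (hd.min ?_)) ?_
      · simp only [div_eq_inv_mul]
        exact ((IsLipschitz.const 1).sub IsLipschitz.id).const_mul _
      · exact (((hd.min (IsLipschitz.const 1)).const_mul _).const_mul _).sin
    · have h2 : 0 < 1 - μ := by linarith
      have h3 : min (1 / μ) 1 = 1 := min_eq_right ((one_le_div h0).2 h1.le)
      simp only [zero_div, sub_zero, sub_self, h3, min_eq_left (one_div_pos.2 h2).le,
        min_eq_right (one_div_pos.2 h0).le, mul_one, sin_pi_mul_sub_one, min_eq_left zero_le_one,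
        mul_zero, Real.sin_zero]
  pos w := by
    have h2 := div_nonneg (Int.fract_nonneg w) h0.le
    have h3 : 0 ≤ (1 - Int.fract w) / (1 - μ) :=
      div_nonneg (by linarith [Int.fract_lt_one w]) (by linarith)
    have := le_min h2 h3
    simp only [spiral]
    linarith

theorem continuous_spiral (s : ℕ) {a b : ℝ} (ha : 0 < a) (hb : b < 1) :
    Continuous fun p : Icc a b × ℝ => spiral s p.1 p.2 := by
  have h0 : ∀ p : Icc a b × ℝ, 0 < (p.1 : ℝ) := fun p => ha.trans_le p.1.2.1
  have h1 : ∀ p : Icc a b × ℝ, (p.1 : ℝ) < 1 := fun p => p.1.2.2.trans_lt hb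
  refine ContinuousOn.comp_fract (s := fun p : Icc a b × ℝ => p.2)
    (f := fun (p : Icc a b × ℝ) t => ((1 + min (t / p.1) ((1 - t) / (1 - p.1)),
      Real.sin (Real.pi * ((s - 1) * min (t / p.1) 1))) : ℝ × ℝ)) ?_ continuous_snd ?_
  · apply Continuous.continuousOn
    have c1 : Continuous fun q : (Icc a b × ℝ) × ℝ => q.2 / (q.1.1 : ℝ) :=
      continuous_snd.div (by fun_prop) fun q => (h0 q.1).ne'
    have c2 : Continuous fun q : (Icc a b × ℝ) × ℝ => (1 - q.2) / (1 - (q.1.1 : ℝ)) :=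
      (by fun_prop : Continuous fun q : (Icc a b × ℝ) × ℝ => 1 - q.2).div (by fun_prop)
        fun q => by linarith [h1 q.1]
    exact ((continuous_const.add (c1.min c2))).prodMk (Real.continuous_sin.comp
      (continuous_const.mul (continuous_const.mul (c1.min continuous_const))))
  · intro p
    have h2 : 0 < 1 - (p.1 : ℝ) := by linarith [h1 p]
    have h3 : min (1 / (p.1 : ℝ)) 1 = 1 := min_eq_right ((one_le_div (h0 p)).2 (h1 p).le)
    simp only [zero_div, sub_zero, sub_self, h3, min_eq_left (one_div_pos.2 h2).le,
        min_eq_right (one_div_pos.2 (h0 p)).le, mul_one, sin_pi_mul_sub_one,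
        min_eq_left zero_le_one, mul_zero, Real.sin_zero]

/-- Two strings of a spiral are at the same distance from the axis only if one of them moves
outwards and the other one inwards; then this distance is determined by their difference. -/
theorem tent_crossing {μ f g : ℝ} (h0 : 0 < μ) (h1 : μ < 1) (hfg : f < g)
    (h : min (f / μ) ((1 - f) / (1 - μ)) = min (g / μ) ((1 - g) / (1 - μ))) :
    f / μ = 1 - (g - f) ∧ μ < g := by
  have h2 : 0 < 1 - μ := by linarith
  have e1 : f / μ < g / μ := div_lt_div_of_pos_right hfg h0
  have e2 : (1 - g) / (1 - μ) < (1 - f) / (1 - μ) := div_lt_div_of_pos_right (by linarith) h2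
  rcases le_total g μ with hg | hg
  · have e3 : g / μ ≤ (1 - g) / (1 - μ) := by
      rw [div_le_div_iff₀ h0 h2]
      nlinarith
    rw [min_eq_left e3, min_eq_left (by linarith)] at h
    linarith
  · have e3 : (1 - g) / (1 - μ) ≤ g / μ := by
      rw [div_le_div_iff₀ h2 h0]
      nlinarith
    rw [min_eq_right e3] at h
    have e4 : f / μ = (1 - g) / (1 - μ) := by
      rcases min_choice (f / μ) ((1 - f) / (1 - μ)) with h' | h'
      · rw [← h, h']
      · rw [h'] at h
        linarith
    have e5 : f * (1 - μ) = (1 - g) * μ := by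
      rwa [div_eq_div_iff h0.ne' h2.ne'] at e4
    refine ⟨?_, ?_⟩
    · rw [div_eq_iff h0.ne']
      linarith
    · rcases hg.eq_or_lt with rfl | hg
      · exfalso
        have : f * (1 - μ) < μ * (1 - μ) := mul_lt_mul_of_pos_right hfg h2
        linarith
      · exact hg

theorem fract_sub_fract_mul {s : ℕ} (hs : 0 < s) {N : ℤ} (hN : ¬ (s : ℤ) ∣ N) (w : ℝ) :
    ∃ A : ℤ, ¬ (s : ℤ) ∣ A ∧ Int.fract (w + N / s) - Int.fract w = A / s := by
  have hs' : (s : ℝ) ≠ 0 := by positivity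
  refine ⟨N - s * (⌊w + N / s⌋ - ⌊w⌋), fun hd => hN ?_, ?_⟩
  · exact (dvd_sub_left (dvd_mul_right _ _)).1 hd
  · rw [Int.fract, Int.fract]
    push_cast
    field_simp
    ring

/-- At a crossing the fractional parts differ by `A / s` and, by `tent_crossing`, the outward string
has completed the proportion `1 - A / s` of its way, whatever `μ` is. Its height is therefore `± sin
(π A / s) ≠ 0`, while the inward string has height 0. -/
theorem separated_spiral {s : ℕ} (hs : 0 < s) {μ : ℝ} (h0 : 0 < μ) (h1 : μ < 1) :
    Separated s (spiral s μ) := by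
  have hs' : (s : ℝ) ≠ 0 := by positivity
  have key : ∀ (f g : ℝ) (A : ℤ), 0 ≤ f → g < 1 → f < g → g - f = A / s →
      ((1 + min (f / μ) ((1 - f) / (1 - μ)), Real.sin (Real.pi * ((s - 1) * min (f / μ) 1))) :
        ℝ × ℝ) ≠
      (1 + min (g / μ) ((1 - g) / (1 - μ)), Real.sin (Real.pi * ((s - 1) * min (g / μ) 1))) := by
    intro f g A hf hg hfg hA e
    rw [Prod.mk.injEq] at e
    obtain ⟨e1, e2⟩ := e
    obtain ⟨e3, e4⟩ := tent_crossing h0 h1 hfg (by linarith)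
    rw [e3, min_eq_left (by linarith), min_eq_right ((one_le_div h0).2 e4.le), mul_one,
      sin_pi_mul_sub_one] at e2
    have e5 : Real.pi * ((s - 1) * (1 - (g - f))) =
        (s - A - 1 : ℤ) * Real.pi + Real.pi * (g - f) := by
      rw [hA]
      push_cast
      field_simp
      ring
    rw [e5, add_comm, Real.sin_add_int_mul_pi] at e2
    have e6 : 0 < Real.sin (Real.pi * (g - f)) :=
      Real.sin_pos_of_pos_of_lt_pi (mul_pos Real.pi_pos (by linarith))
        (mul_lt_of_lt_one_right Real.pi_pos (by linarith))
    exact mul_ne_zero (zpow_ne_zero _ (by norm_num)) e6.ne' e2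
  intro w N hN e
  obtain ⟨A, hA, hA'⟩ := fract_sub_fract_mul hs hN w
  rcases lt_trichotomy (Int.fract w) (Int.fract (w + N / s)) with h | h | h
  · exact key _ _ A (Int.fract_nonneg _) (Int.fract_lt_one _) h hA' e.symm
  · rw [h, sub_self, eq_comm, div_eq_zero_iff] at hA'
    rcases hA' with hA' | hA'
    · apply hA
      rw [show A = 0 by exact_mod_cast hA']
      exact dvd_zero _
    · exact hs' hA'
  · refine key _ _ (-A) (Int.fract_nonneg _) (Int.fract_lt_one _) h ?_ e
    push_cast
    rw [neg_div, ← hA']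
    ring

theorem ambientIsotopic_spiral {s k : ℕ} (hs : 2 ≤ s) (hk : 0 < k) (hks : Nat.Coprime k s) :
    AmbientIsotopic (range (toricCurve s k (spiral s (1 / s))))
      (range (toricCurve s k (spiral s (1 / 2)))) := by
  have hs' : (2 : ℝ) ≤ s := by exact_mod_cast hs
  have ha : (0 : ℝ) < 1 / s := by positivity
  refine ambientIsotopic_of_family (by omega) hk hks
    (one_div_le_one_div_of_le two_pos hs') (continuous_spiral s ha (by norm_num)) ?_ ?_
  · intro μ hμ
    exact isProfile_spiral s (ha.trans_le hμ.1) (by linarith [hμ.2])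
  · intro μ hμ
    exact separated_spiral (by omega) (ha.trans_le hμ.1) (by linarith [hμ.2])

theorem IsProfile.mul_height {P : ℝ → ℝ × ℝ} (h : IsProfile P) (ε : ℝ) :
    IsProfile fun w => ((P w).1, ε * (P w).2) where
  periodic w := by simp only [h.periodic w]
  lipschitz := by
    have h1 : IsLipschitz fun w => (P w).1 :=
      IsLipschitz.comp ⟨1, LipschitzWith.prod_fst⟩ h.lipschitz
    have h2 : IsLipschitz fun w => (P w).2 :=
      IsLipschitz.comp ⟨1, LipschitzWith.prod_snd⟩ h.lipschitz
    exact h1.prodMk (h2.const_mul ε)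
  pos w := h.pos w

/-- For `μ = 1 / 2` both profiles have the same tent as distance, so only the heights at crossings
have to be compared. Both height differences have the sign of `-(-1) ^ A * sin (2πw')`, up to the
factors `sin (2πχ)` and `ε`, whose product is positive. -/
theorem ambientIsotopic_dualLissajous_spiral {s k : ℕ} (hs : 2 ≤ s) (hk : 0 < k)
    (hks : Nat.Coprime k s) {χ ε : ℝ} (h : 0 < ε * Real.sin (2 * Real.pi * χ)) :
    AmbientIsotopic (range (toricCurve s k (dualLissajous s χ)))
      (range (toricCurve s k fun w => ((spiral s (1 / 2) w).1, ε * (spiral s (1 / 2) w).2))) := by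
  have hs0 : 0 < s := by omega
  have hs' : (s : ℝ) ≠ 0 := by positivity
  refine ambientIsotopic_of_same_order hs0 hk hks (isProfile_dualLissajous s χ)
    ((isProfile_spiral s (by norm_num) (by norm_num)).mul_height ε) fun w N hN => ?_
  have htent : ∀ w, (spiral s (1 / 2) w).1 = 2 - sawtooth w := fun w => by
    simp only [spiral, sawtooth_eq]
    rw [show (1 : ℝ) - 1 / 2 = 1 / 2 by norm_num]
    rcases le_total (Int.fract w) (1 / 2) with h | h
    · rw [abs_of_nonpos (by linarith), min_eq_left (by linarith)]
      ring
    · rw [abs_of_nonneg (by linarith), min_eq_right (by linarith)]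
      ring
  by_cases hw : sawtooth (w + N / s) = sawtooth w
  swap
  · left
    simp only [htent, dualLissajous]
    exact mul_self_pos.2 fun h => hw (by linarith)
  right
  obtain ⟨M, A, hM, hA, hA', hsin⟩ := dualLissajous_crossing hs0 (χ := χ) hN hw
  have hne := sin_two_pi_ne_zero hs0 hA hA'
  set w' := w + N / s with hw'
  have hsp : (spiral s (1 / 2) w').2 - (spiral s (1 / 2) w).2 =
      -((-1) ^ A * Real.sin (2 * Real.pi * w')) := by
    have e1 : ∀ v : ℝ, Int.fract v ≤ 1 / 2 →
        (spiral s (1 / 2) v).2 = Real.sin (2 * Real.pi * ((s - 1) * v)) := fun v hv => by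
      simp only [spiral]
      rw [min_eq_left (by linarith), Int.fract]
      rw [show Real.pi * ((s - 1) * ((v - ⌊v⌋) / (1 / 2))) =
        2 * Real.pi * ((s - 1) * v) - ((s - 1) * ⌊v⌋ : ℤ) * (2 * Real.pi) by push_cast; ring,
        Real.sin_sub_int_mul_two_pi]
    have e2 : ∀ v : ℝ, 1 / 2 ≤ Int.fract v → (spiral s (1 / 2) v).2 = 0 := fun v hv => by
      simp only [spiral]
      rw [min_eq_right (by linarith), mul_one, sin_pi_mul_sub_one]
    have e3 : Real.sin (2 * Real.pi * ((s - 1) * w')) =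
        -((-1) ^ A * Real.sin (2 * Real.pi * w')) := by
      rw [← Real.sin_int_mul_pi_sub]
      congr 1
      have : (A : ℝ) = s * (2 * w') := by
        rw [hA']
        field_simp
      rw [this]
      ring
    have e4 : Real.sin (2 * Real.pi * ((s - 1) * w)) =
        -Real.sin (2 * Real.pi * ((s - 1) * w')) := by
      rw [show w = M - w' by linarith, ← Real.sin_neg,
        ← Real.sin_add_int_mul_two_pi _ (-((s - 1) * M))]
      congr 1
      push_cast
      ring
    -- The crossing strings lie symmetrically in the period, so one of them is in the outward half
    -- and the other one in the inward half, at height 0.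
    have e5 : Int.fract w + Int.fract w' = 1 := by
      have e6 : Int.fract w + Int.fract w' = ((M - ⌊w⌋ - ⌊w'⌋ : ℤ) : ℝ) := by
        rw [Int.fract, Int.fract]
        push_cast
        linarith
      have h1 := Int.fract_lt_one w
      have h2 := Int.fract_lt_one w'
      have h3 := Int.fract_nonneg w
      have h4 : 0 < Int.fract w' := by
        refine lt_of_le_of_ne (Int.fract_nonneg w') fun h0 => hne ?_
        rw [show 2 * Real.pi * w' = ((2 * ⌊w'⌋ : ℤ) : ℝ) * Real.pi by
          rw [← Int.fract_add_floor w', ← h0]; push_cast; simp; ring]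
        exact Real.sin_int_mul_pi _
      have h5 : (0 : ℝ) < ((M - ⌊w⌋ - ⌊w'⌋ : ℤ) : ℝ) := by rw [← e6]; linarith
      have h6 : ((M - ⌊w⌋ - ⌊w'⌋ : ℤ) : ℝ) < 2 := by rw [← e6]; linarith
      have h7 : 0 < M - ⌊w⌋ - ⌊w'⌋ := by exact_mod_cast h5
      have h8 : M - ⌊w⌋ - ⌊w'⌋ < 2 := by exact_mod_cast h6
      have : M - ⌊w⌋ - ⌊w'⌋ = 1 := by omega
      rw [e6, this]
      norm_num
    rcases le_total (Int.fract w') (1 / 2) with h5 | h5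
    · rw [e1 w' h5, e2 w (by linarith), e3, sub_zero]
    · rw [e2 w' h5, e1 w (by linarith), e4, e3]
      ring
  simp only [dualLissajous]
  rw [← mul_sub, hsp]
  have hprod : Real.sin (2 * Real.pi * χ) ≠ 0 := by
    intro h0
    rw [h0, mul_zero] at h
    exact lt_irrefl _ h
  have hsgn : ((-1 : ℝ) ^ A) ≠ 0 := zpow_ne_zero _ (by norm_num)
  have hneg := sawtooth_sub_mul_sin_neg (a := (s + 1) * w' + χ) (b := (s + 1) * w + χ) (by
    rw [hsin]
    exact mul_ne_zero (mul_ne_zero hsgn hprod) hne)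
  rw [hsin] at hneg
  set D := sawtooth ((s + 1) * w' + χ) - sawtooth ((s + 1) * w + χ)
  set S := Real.sin (2 * Real.pi * χ)
  set T := (-1) ^ A * Real.sin (2 * Real.pi * w')
  have h1 : 0 < -(D * T * S) * (ε * S) := mul_pos (by simp only [T]; linarith) h
  have h2 : -(D * T * S) * (ε * S) = D * (ε * -T) * S ^ 2 := by ring
  rw [h2] at h1
  exact pos_of_mul_pos_left h1 (sq_nonneg S)

/-! ### Billiard profiles -/

/-- Half the angle under which an edge of the projected billiard curve is seen from the centre. -/
noncomputable def halfAngle (s k : ℕ) : ℝ := Real.pi * (s / (k * (s + 1)))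

theorem halfAngle_pos {s k : ℕ} (hs : 0 < s) (hk : 2 ≤ k) : 0 < halfAngle s k := by
  have : 0 < k := by omega
  have := Real.pi_pos
  rw [halfAngle]
  positivity

theorem halfAngle_lt {s k : ℕ} (hk : 2 ≤ k) : halfAngle s k < Real.pi / 2 := by
  have hk' : (2 : ℝ) ≤ k := by exact_mod_cast hk
  have hs' : (0 : ℝ) ≤ s := by positivity
  rw [halfAngle, div_eq_mul_one_div Real.pi 2]
  apply mul_lt_mul_of_pos_left _ Real.pi_pos
  rw [div_lt_div_iff₀ (by positivity) two_pos]
  nlinarith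

/-- The proportion in which the point seen at the fraction `f` of its angle divides an edge. -/
noncomputable def edgeFraction (α f : ℝ) : ℝ :=
  1 / 2 + Real.tan (2 * α * (f - 1 / 2)) / (2 * Real.tan α)

section

variable {α : ℝ}

theorem edgeAngle_mem_Ioo (h0 : 0 < α) (h1 : α < Real.pi / 2) {f : ℝ} (hf : f ∈ Icc (0 : ℝ) 1) :
    2 * α * (f - 1 / 2) ∈ Ioo (-(Real.pi / 2)) (Real.pi / 2) := by
  obtain ⟨hf0, hf1⟩ := hf
  constructor <;> nlinarith

theorem edgeFraction_zero (h0 : 0 < α) (h1 : α < Real.pi / 2) : edgeFraction α 0 = 0 := by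
  have := Real.tan_pos_of_pos_of_lt_pi_div_two h0 h1
  rw [edgeFraction, show 2 * α * (0 - 1 / 2) = -α by ring, Real.tan_neg]
  field_simp
  norm_num

theorem edgeFraction_one (h0 : 0 < α) (h1 : α < Real.pi / 2) : edgeFraction α 1 = 1 := by
  have := Real.tan_pos_of_pos_of_lt_pi_div_two h0 h1
  rw [edgeFraction, show 2 * α * (1 - 1 / 2) = α by ring]
  field_simp
  norm_num

theorem edgeFraction_one_sub (f : ℝ) : edgeFraction α (1 - f) = 1 - edgeFraction α f := by
  rw [edgeFraction, edgeFraction, show 2 * α * (1 - f - 1 / 2) = -(2 * α * (f - 1 / 2)) by ring,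
    Real.tan_neg]
  ring

theorem strictMonoOn_edgeFraction (h0 : 0 < α) (h1 : α < Real.pi / 2) :
    StrictMonoOn (edgeFraction α) (Icc 0 1) := by
  intro f hf g hg hfg
  have h2 := Real.tan_pos_of_pos_of_lt_pi_div_two h0 h1
  have := Real.strictMonoOn_tan (edgeAngle_mem_Ioo h0 h1 hf) (edgeAngle_mem_Ioo h0 h1 hg)
    (by nlinarith : 2 * α * (f - 1 / 2) < 2 * α * (g - 1 / 2))
  have := div_lt_div_of_pos_right this (by positivity : 0 < 2 * Real.tan α)
  simp only [edgeFraction]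
  linarith

theorem contDiffOn_edgeFraction (h0 : 0 < α) (h1 : α < Real.pi / 2) :
    ContDiffOn ℝ 1 (edgeFraction α) (Icc 0 1) := by
  intro f hf
  apply ContDiffAt.contDiffWithinAt
  have hc : Real.cos (2 * α * (f - 1 / 2)) ≠ 0 :=
    (Real.cos_pos_of_mem_Ioo (edgeAngle_mem_Ioo h0 h1 hf)).ne'
  have h2 : ContDiffAt ℝ 1 Real.tan (2 * α * (f - 1 / 2)) := Real.contDiffAt_tan.2 hc
  have h3 : ContDiffAt ℝ 1 (fun f : ℝ => 2 * α * (f - 1 / 2)) f := by fun_prop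
  exact contDiffAt_const.add ((h2.comp f h3).div_const _)

/-- The time at which the point is seen at the angle `2 α z`, if every edge takes the time `1`. -/
noncomputable def edgeTime (α z : ℝ) : ℝ := ⌊z⌋ + edgeFraction α (Int.fract z)

theorem edgeFraction_fract_mem (h0 : 0 < α) (h1 : α < Real.pi / 2) (z : ℝ) :
    edgeFraction α (Int.fract z) ∈ Ico (0 : ℝ) 1 := by
  have hf : Int.fract z ∈ Icc (0 : ℝ) 1 := ⟨Int.fract_nonneg z, (Int.fract_lt_one z).le⟩
  constructor
  · rw [← edgeFraction_zero h0 h1]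
    exact (strictMonoOn_edgeFraction h0 h1).monotoneOn (left_mem_Icc.2 zero_le_one) hf hf.1
  · rw [← edgeFraction_one h0 h1]
    exact (strictMonoOn_edgeFraction h0 h1) hf (right_mem_Icc.2 zero_le_one) (Int.fract_lt_one z)

theorem floor_edgeTime (h0 : 0 < α) (h1 : α < Real.pi / 2) (z : ℝ) : ⌊edgeTime α z⌋ = ⌊z⌋ := by
  have := edgeFraction_fract_mem h0 h1 z
  rw [Int.floor_eq_iff, edgeTime]
  exact ⟨by linarith [this.1], by linarith [this.2]⟩

theorem fract_edgeTime (h0 : 0 < α) (h1 : α < Real.pi / 2) (z : ℝ) :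
    Int.fract (edgeTime α z) = edgeFraction α (Int.fract z) := by
  rw [Int.fract, floor_edgeTime h0 h1, edgeTime, add_sub_cancel_left]

theorem edgeTime_add_int (z : ℝ) (n : ℤ) : edgeTime α (z + n) = edgeTime α z + n := by
  rw [edgeTime, edgeTime, Int.floor_add_intCast, Int.fract_add_intCast]
  push_cast
  ring

theorem edgeTime_neg (h0 : 0 < α) (h1 : α < Real.pi / 2) (z : ℝ) :
    edgeTime α (-z) = -edgeTime α z := by
  by_cases h : Int.fract z = 0
  · have hz : z = 0 + (⌊z⌋ : ℤ) := by
      rw [zero_add]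
      exact (sub_eq_zero.1 h)
    have e0 : edgeTime α 0 = 0 := by simp [edgeTime, edgeFraction_zero h0 h1]
    have e1 := edgeTime_add_int (α := α) 0 ⌊z⌋
    have e2 := edgeTime_add_int (α := α) 0 (-⌊z⌋)
    rw [← hz] at e1
    rw [show (0 : ℝ) + ((-⌊z⌋ : ℤ) : ℝ) = -z by push_cast; linarith] at e2
    rw [e1, e2, e0]
    push_cast
    ring
  · have hf := Int.fract_neg h
    have hfl : (⌊-z⌋ : ℝ) = -⌊z⌋ - 1 := by
      have h2 := Int.fract_add_floor (-z)
      have h3 := Int.fract_add_floor z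
      rw [hf] at h2
      linarith
    rw [edgeTime, edgeTime, hf, edgeFraction_one_sub, hfl]
    ring

theorem strictMono_edgeTime (h0 : 0 < α) (h1 : α < Real.pi / 2) : StrictMono (edgeTime α) := by
  intro z z' hz
  rcases (Int.floor_le_floor hz.le).eq_or_lt with h | h
  · have hf : Int.fract z < Int.fract z' := by
      rw [Int.fract, Int.fract, h]
      linarith
    have := strictMonoOn_edgeFraction h0 h1 ⟨Int.fract_nonneg z, (Int.fract_lt_one z).le⟩
      ⟨Int.fract_nonneg z', (Int.fract_lt_one z').le⟩ hf
    rw [edgeTime, edgeTime, h]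
    linarith
  · have h2 := (edgeFraction_fract_mem h0 h1 z).2
    have h3 := (edgeFraction_fract_mem h0 h1 z').1
    have h4 : (⌊z⌋ : ℝ) + 1 ≤ ⌊z'⌋ := by exact_mod_cast h
    rw [edgeTime, edgeTime]
    linarith

theorem surjective_edgeTime (h0 : 0 < α) (h1 : α < Real.pi / 2) :
    Function.Surjective (edgeTime α) := by
  intro t
  have := intermediate_value_Icc (zero_le_one' ℝ) (contDiffOn_edgeFraction h0 h1).continuousOn
  rw [edgeFraction_zero h0 h1, edgeFraction_one h0 h1] at this
  obtain ⟨f, hf, hft⟩ := this ⟨Int.fract_nonneg t, (Int.fract_lt_one t).le⟩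
  have hf1 : f ≠ 1 := by
    rintro rfl
    rw [edgeFraction_one h0 h1] at hft
    exact (Int.fract_lt_one t).ne hft.symm
  have hff : Int.fract f = f := Int.fract_eq_self.2 ⟨hf.1, lt_of_le_of_ne hf.2 hf1⟩
  have hfl : ⌊f⌋ = 0 := Int.floor_eq_zero_iff.2 ⟨hf.1, lt_of_le_of_ne hf.2 hf1⟩
  refine ⟨f + ⌊t⌋, ?_⟩
  rw [edgeTime_add_int, edgeTime, hff, hfl, hft]
  push_cast
  rw [zero_add, Int.fract_add_floor]

/-- The difference from the identity is periodic and smooth on a period with equal end values. -/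
theorem isLipschitz_edgeTime (h0 : 0 < α) (h1 : α < Real.pi / 2) : IsLipschitz (edgeTime α) := by
  obtain ⟨L, hL⟩ := (contDiffOn_edgeFraction h0 h1).exists_lipschitzOnWith one_ne_zero
    (convex_Icc 0 1) isCompact_Icc
  have h2 : LipschitzOnWith (L + 1) (fun f => edgeFraction α f - f) (Icc 0 1) :=
    hL.sub LipschitzWith.id.lipschitzOnWith
  have h3 := lipschitzWith_comp_fract h2
    (by rw [edgeFraction_zero h0 h1, edgeFraction_one h0 h1]; norm_num)
  have h4 : edgeTime α = fun z => z + (edgeFraction α (Int.fract z) - Int.fract z) := by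
    funext z
    have := Int.fract_add_floor z
    rw [edgeTime]
    linarith
  rw [h4]
  exact IsLipschitz.id.add ⟨_, h3⟩

/-- The distance from the centre, as a function of the sawtooth of the angle. -/
noncomputable def edgeDistance (α v : ℝ) : ℝ := Real.cos α / Real.cos (α * v)

theorem cos_mul_pos_of_mem (h0 : 0 < α) (h1 : α < Real.pi / 2) {v : ℝ} (hv : v ∈ Icc (0 : ℝ) 1) :
    0 < Real.cos (α * v) := by
  obtain ⟨hv0, hv1⟩ := hv
  have := Real.pi_pos
  exact Real.cos_pos_of_mem_Ioo ⟨by nlinarith, by nlinarith⟩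

theorem edgeDistance_pos (h0 : 0 < α) (h1 : α < Real.pi / 2) {v : ℝ} (hv : v ∈ Icc (0 : ℝ) 1) :
    0 < edgeDistance α v :=
  div_pos (Real.cos_pos_of_mem_Ioo ⟨by linarith, h1⟩) (cos_mul_pos_of_mem h0 h1 hv)

theorem strictMonoOn_edgeDistance (h0 : 0 < α) (h1 : α < Real.pi / 2) :
    StrictMonoOn (edgeDistance α) (Icc 0 1) := by
  intro v hv v' hv' h
  have hπ := Real.pi_pos
  have : Real.cos (α * v') < Real.cos (α * v) :=
    Real.cos_lt_cos_of_nonneg_of_le_pi_div_two (mul_nonneg h0.le hv.1)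
      (by nlinarith [hv'.1, hv'.2]) (mul_lt_mul_of_pos_left h h0)
  exact div_lt_div_of_pos_left (Real.cos_pos_of_mem_Ioo ⟨by linarith, h1⟩)
    (cos_mul_pos_of_mem h0 h1 hv') this

theorem isLipschitz_edgeDistance_sawtooth (h0 : 0 < α) (h1 : α < Real.pi / 2) :
    IsLipschitz fun z => edgeDistance α (sawtooth z) := by
  have h2 : ContDiffOn ℝ 1 (edgeDistance α) (Icc 0 1) := by
    refine ContDiffOn.div contDiffOn_const ?_ fun v hv => (cos_mul_pos_of_mem h0 h1 hv).ne'
    exact (Real.contDiff_cos.comp (contDiff_const.mul contDiff_id)).contDiffOn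
  obtain ⟨L, hL⟩ := h2.exists_lipschitzOnWith one_ne_zero (convex_Icc 0 1) isCompact_Icc
  obtain ⟨L', hL'⟩ := isLipschitz_sawtooth
  refine ⟨L * L', ?_⟩
  rw [← lipschitzOnWith_univ]
  exact hL.comp hL'.lipschitzOnWith fun z _ => ⟨sawtooth_nonneg z, sawtooth_le_one z⟩

end

/-- The profile of a billiard curve. -/
noncomputable def billiardProfile (s k : ℕ) (φ w : ℝ) : ℝ × ℝ :=
  (edgeDistance (halfAngle s k) (sawtooth ((s + 1) * w)),
    sawtooth (edgeTime (halfAngle s k) ((s + 1) * w) / (s + 1) + φ))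

theorem isProfile_billiardProfile {s k : ℕ} (hs : 0 < s) (hk : 2 ≤ k) (φ : ℝ) :
    IsProfile (billiardProfile s k φ) where
  periodic w := by
    have h1 := sawtooth_freq_periodic s 0 w
    simp only [add_zero] at h1
    have e : ((s : ℝ) + 1) * (w + 1) = (s + 1) * w + ((s + 1 : ℤ) : ℝ) := by
      push_cast
      ring
    have e2 : (edgeTime (halfAngle s k) ((s + 1) * w) + ((s + 1 : ℤ) : ℝ)) / (s + 1) + φ =
        edgeTime (halfAngle s k) ((s + 1) * w) / (s + 1) + φ + ((1 : ℤ) : ℝ) := by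
      push_cast
      field_simp
      ring
    simp only [billiardProfile, h1]
    rw [e, edgeTime_add_int, e2, sawtooth_add_int]
  lipschitz := by
    have h0 := halfAngle_pos hs hk
    have h1 := halfAngle_lt (s := s) hk
    have hz : IsLipschitz fun w : ℝ => ((s : ℝ) + 1) * w := IsLipschitz.id.const_mul _
    refine IsLipschitz.prodMk ((isLipschitz_edgeDistance_sawtooth h0 h1).comp hz) ?_
    refine isLipschitz_sawtooth.comp (IsLipschitz.add ?_ (IsLipschitz.const _))
    simp only [div_eq_inv_mul]
    exact ((isLipschitz_edgeTime h0 h1).comp hz).const_mul _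
  pos w := edgeDistance_pos (halfAngle_pos hs hk) (halfAngle_lt hk)
    ⟨sawtooth_nonneg _, sawtooth_le_one _⟩

theorem sin_mul_sin_pos {e : ℤ} {x y : ℝ} (hx : x ∈ Ioo (e : ℝ) (e + 1))
    (hy : y ∈ Ioo (e : ℝ) (e + 1)) : 0 < Real.sin (Real.pi * x) * Real.sin (Real.pi * y) := by
  have key : ∀ z ∈ Ioo (e : ℝ) (e + 1), ∃ c > 0, Real.sin (Real.pi * z) = (-1) ^ e * c := by
    intro z hz
    refine ⟨Real.sin (Real.pi * (z - e)), Real.sin_pos_of_pos_of_lt_pi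
      (mul_pos Real.pi_pos (by linarith [hz.1]))
      (mul_lt_of_lt_one_right Real.pi_pos (by linarith [hz.2])), ?_⟩
    rw [← Real.sin_add_int_mul_pi]
    congr 1
    ring
  obtain ⟨c, hc, ec⟩ := key x hx
  obtain ⟨d, hd, ed⟩ := key y hy
  have h3 : ((-1 : ℝ) ^ e) * ((-1 : ℝ) ^ e) = 1 := by
    rw [← mul_zpow]
    norm_num
  rw [ec, ed, show ((-1 : ℝ) ^ e * c) * ((-1) ^ e * d) = ((-1) ^ e * (-1) ^ e) * (c * d) by ring,
    h3, one_mul]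
  exact mul_pos hc hd

/-- Two pairs of values of the sawtooth function are ordered in the same way if their arguments have
the same sum and if the signs of the sines of the differences agree. -/
theorem sawtooth_same_order {a b a' b' : ℝ} (h : a + b = a' + b')
    (hs : 0 < Real.sin (Real.pi * (a - b)) * Real.sin (Real.pi * (a' - b'))) :
    (sawtooth a = sawtooth b ↔ sawtooth a' = sawtooth b') ∧
      (sawtooth a ≠ sawtooth b → 0 < (sawtooth a - sawtooth b) * (sawtooth a' - sawtooth b')) := by
  set x := Real.sin (Real.pi * (a - b))
  set y := Real.sin (Real.pi * (a' - b'))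
  set S := Real.sin (Real.pi * (a + b)) with hS
  have hx : x ≠ 0 := left_ne_zero_of_mul hs.ne'
  have hy : y ≠ 0 := right_ne_zero_of_mul hs.ne'
  have h1 : S * x ≠ 0 → (sawtooth a - sawtooth b) * (S * x) < 0 := sawtooth_sub_mul_sin_neg
  have h2 : S * y ≠ 0 → (sawtooth a' - sawtooth b') * (S * y) < 0 := by
    rw [hS, h]
    exact sawtooth_sub_mul_sin_neg
  have e1 : sawtooth a = sawtooth b ↔ S = 0 := by
    refine ⟨fun e => (mul_eq_zero.1 (sin_mul_sin_eq_zero_of_sawtooth_eq e)).resolve_right hx,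
      fun e => ?_⟩
    by_contra hne
    have := sawtooth_sub_mul_cos_sub_pos hne
    rw [cos_sub_cos_eq, ← hS, e] at this
    simp at this
  have e2 : sawtooth a' = sawtooth b' ↔ S = 0 := by
    refine ⟨fun e => ?_, fun e => ?_⟩
    · have := sin_mul_sin_eq_zero_of_sawtooth_eq e
      rw [← h] at this
      exact (mul_eq_zero.1 this).resolve_right hy
    · by_contra hne
      have := sawtooth_sub_mul_cos_sub_pos hne
      rw [cos_sub_cos_eq, ← h, ← hS, e] at this
      simp at this
  refine ⟨e1.trans e2.symm, fun hne => ?_⟩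
  have hS0 : S ≠ 0 := fun h => hne (e1.2 h)
  have h3 := mul_pos_of_neg_of_neg (h1 (mul_ne_zero hS0 hx)) (h2 (mul_ne_zero hS0 hy))
  have h4 : (sawtooth a - sawtooth b) * (S * x) * ((sawtooth a' - sawtooth b') * (S * y)) =
      (sawtooth a - sawtooth b) * (sawtooth a' - sawtooth b') * (S ^ 2 * (x * y)) := by ring
  rw [h4] at h3
  exact pos_of_mul_pos_left h3 (mul_nonneg (sq_nonneg S) hs.le)

theorem freq_div_ne_int {s : ℕ} (hs : 0 < s) {N : ℤ} (hN : ¬ (s : ℤ) ∣ N) (n : ℤ) :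
    ((s : ℝ) + 1) * (N / s) ≠ n := by
  have hs' : (s : ℝ) ≠ 0 := by positivity
  intro h
  refine div_ne_int hs hN (n - N) ?_
  push_cast
  rw [← h]
  field_simp
  ring

/-- Where two strings cross, the heights are ordered in the same way for the billiard curve and for
the Lissajous profile. -/
theorem billiardProfile_crossing {s k : ℕ} (hs : 0 < s) (hk : 2 ≤ k) {w φ : ℝ} {N : ℤ}
    (hN : ¬ (s : ℤ) ∣ N) (h : sawtooth ((s + 1) * (w + N / s)) = sawtooth ((s + 1) * w)) :
    ((billiardProfile s k φ (w + N / s)).2 = (billiardProfile s k φ w).2 ↔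
      (lissajous s φ (w + N / s)).2 = (lissajous s φ w).2) ∧
    ((billiardProfile s k φ (w + N / s)).2 ≠ (billiardProfile s k φ w).2 →
      0 < ((billiardProfile s k φ (w + N / s)).2 - (billiardProfile s k φ w).2) *
        ((lissajous s φ (w + N / s)).2 - (lissajous s φ w).2)) := by
  have h0 := halfAngle_pos hs hk
  have h1 := halfAngle_lt (s := s) hk
  have hs' : (0 : ℝ) < s := by positivity
  set α := halfAngle s k
  have hd : ((s : ℝ) + 1) * (w + N / s) - (s + 1) * w = (s + 1) * (N / s) := by ring
  obtain ⟨M, hM⟩ := int_of_sawtooth_eq h fun n => by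
    rw [hd]
    exact freq_div_ne_int hs hN n
  set z := ((s : ℝ) + 1) * w with hz
  set z' := ((s : ℝ) + 1) * (w + N / s) with hz'
  have hzM : z' = -z + M := by linarith
  -- The change from angle to time is odd and commutes with integer translations, so the two times
  -- have the same sum as the two angles. Only the sines of the differences remain to be compared.
  have htime : edgeTime α z' = -edgeTime α z + M := by
    rw [hzM, edgeTime_add_int, edgeTime_neg h0 h1]
  have hzint : Int.fract z ≠ 0 := by
    intro hf
    have : z = ⌊z⌋ := sub_eq_zero.1 hf
    refine freq_div_ne_int hs hN (M - 2 * ⌊z⌋) ?_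
    push_cast
    rw [← hd, hzM]
    linarith
  set m := ⌊z⌋
  have hf0 : 0 < Int.fract z := lt_of_le_of_ne (Int.fract_nonneg z) (Ne.symm hzint)
  have hz1 : (m : ℝ) < z := by
    have : Int.fract z = z - m := rfl
    linarith
  have hz2 : z < m + 1 := Int.lt_floor_add_one z
  have ht1 : (m : ℝ) < edgeTime α z := by
    have := strictMono_edgeTime h0 h1 hz1
    have e := edgeTime_add_int (α := α) 0 m
    have e0 : edgeTime α 0 = 0 := by simp [edgeTime, edgeFraction_zero h0 h1]
    rw [e0, zero_add] at e
    linarith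
  have ht2 : edgeTime α z < m + 1 := by
    have := Int.lt_floor_add_one (edgeTime α z)
    rwa [floor_edgeTime h0 h1] at this
  have hq : (0 : ℤ) < s + 1 := by omega
  have hq' : (0 : ℝ) < s + 1 := by positivity
  let D : ℤ := M - 2 * m - 1
  -- For `x` in the edge `(m, m + 1)`, the quantity `M - 2 x` ranges over `(D - 1, D + 1)`. A
  -- multiple of `s + 1` at the centre `D` would be at distance less than 1 from `(s + 1) N / s`,
  -- but that distance is a nonzero multiple of `(s + 1) / s`.
  have hmod : D % (s + 1) ≠ 0 := by
    intro h0'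
    obtain ⟨e, he⟩ := Int.dvd_of_emod_eq_zero h0'
    have h2 : |((s : ℝ) + 1) * (N / s) - (s + 1) * e| < 1 := by
      have h3 : ((s : ℝ) + 1) * e = M - 2 * m - 1 := by
        have : ((D : ℤ) : ℝ) = (((s + 1) * e : ℤ) : ℝ) := by rw [he]
        simp only [D] at this
        push_cast at this
        linarith
      rw [h3, ← hd, hzM, abs_lt]
      constructor <;> linarith
    have h4 : ((s : ℝ) + 1) * (N / s) - (s + 1) * e = (s + 1) / s * ((N - s * e : ℤ) : ℝ) := by
      push_cast
      field_simp
    have h5 : N - s * e ≠ 0 := fun h6 => hN ⟨e, by linarith⟩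
    have h6 : (1 : ℝ) ≤ |((N - s * e : ℤ) : ℝ)| := by exact_mod_cast Int.one_le_abs h5
    rw [h4, abs_mul, abs_of_pos (by positivity)] at h2
    have h7 : (1 : ℝ) < (s + 1) / s := by
      rw [lt_div_iff₀ hs']
      linarith
    nlinarith
  let e : ℤ := D / (s + 1)
  have he1 : (s + 1) * e + 1 ≤ D := by
    have := Int.emod_add_mul_ediv D (s + 1)
    have h3 := Int.emod_nonneg D hq.ne'
    simp only [e]
    omega
  have he2 : D + 1 ≤ (s + 1) * (e + 1) := by
    have := Int.emod_add_mul_ediv D (s + 1)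
    have h3 := Int.emod_lt_of_pos D hq
    simp only [e]
    rw [mul_add, mul_one]
    omega
  have he1' : ((s : ℝ) + 1) * e ≤ M - 2 * m - 2 := by
    have : (((s + 1) * e + 1 : ℤ) : ℝ) ≤ D := by exact_mod_cast he1
    simp only [D] at this
    push_cast at this
    linarith
  have he2' : (M : ℝ) - 2 * m ≤ (s + 1) * (e + 1) := by
    have : ((D + 1 : ℤ) : ℝ) ≤ (((s + 1) * (e + 1) : ℤ) : ℝ) := by exact_mod_cast he2
    simp only [D] at this
    push_cast at this
    linarith
  -- Angle and time lie on the same edge, so both halved differences fall between the same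
  -- consecutive integers after division by `s + 1`, where the sine keeps its sign.
  have hIoo : ∀ x : ℝ, (m : ℝ) < x → x < m + 1 →
      (M - 2 * x) / (s + 1) ∈ Ioo (e : ℝ) (e + 1) := by
    intro x hx1 hx2
    constructor
    · rw [lt_div_iff₀ hq']
      linarith
    · rw [div_lt_iff₀ hq']
      linarith
  have hw : ∀ v : ℝ, v + φ = ((s + 1) * v) / (s + 1) + φ := fun v => by
    field_simp
  simp only [billiardProfile, lissajous]
  rw [hw (w + N / s), hw w, ← hz, ← hz']
  apply sawtooth_same_order
  · rw [htime, hzM]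
    ring
  · have h2 := sin_mul_sin_pos (hIoo _ ht1 ht2) (hIoo _ hz1 hz2)
    convert h2 using 4
    · rw [htime]
      ring
    · rw [hzM]
      ring

theorem separated_billiardProfile_iff {s k : ℕ} (hs : 0 < s) (hk : 2 ≤ k) {φ : ℝ} :
    Separated s (billiardProfile s k φ) ↔ Separated s (lissajous s φ) := by
  have h0 := halfAngle_pos hs hk
  have h1 := halfAngle_lt (s := s) hk
  refine forall_congr' fun w => forall_congr' fun N => imp_congr_right fun hN => not_congr ?_
  have hinj : ((billiardProfile s k φ (w + N / s)).1 = (billiardProfile s k φ w).1 ↔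
      sawtooth ((s + 1) * (w + N / s)) = sawtooth ((s + 1) * w)) :=
    (strictMonoOn_edgeDistance h0 h1).injOn.eq_iff ⟨sawtooth_nonneg _, sawtooth_le_one _⟩
      ⟨sawtooth_nonneg _, sawtooth_le_one _⟩
  rw [Prod.ext_iff, Prod.ext_iff, hinj]
  have : (lissajous s φ (w + N / s)).1 = (lissajous s φ w).1 ↔
      sawtooth ((s + 1) * (w + N / s)) = sawtooth ((s + 1) * w) := by
    simp [lissajous]
  rw [this]
  exact and_congr_right fun h => (billiardProfile_crossing hs hk hN h).1

theorem ambientIsotopic_billiard_lissajous {s k : ℕ} (hs : 0 < s) (hk : 2 ≤ k)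
    (hks : Nat.Coprime k s) {φ : ℝ} (h : Separated s (billiardProfile s k φ)) :
    AmbientIsotopic (range (toricCurve s k (billiardProfile s k φ)))
      (range (toricCurve s k (lissajous s φ))) := by
  have h0 := halfAngle_pos hs hk
  have h1 := halfAngle_lt (s := s) hk
  refine ambientIsotopic_of_same_order hs (by omega) hks (isProfile_billiardProfile hs hk φ)
    (isProfile_lissajous s φ) fun w N hN => ?_
  have mem : ∀ z, sawtooth z ∈ Icc (0 : ℝ) 1 := fun z => ⟨sawtooth_nonneg _, sawtooth_le_one _⟩
  rcases lt_trichotomy (sawtooth ((s + 1) * (w + N / s))) (sawtooth ((s + 1) * w))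
    with hlt | he | hlt
  · left
    have := strictMonoOn_edgeDistance h0 h1 (mem _) (mem _) hlt
    simp only [billiardProfile, lissajous]
    exact mul_pos_of_neg_of_neg (by linarith) (by linarith)
  · right
    refine (billiardProfile_crossing hs hk hN he).2 fun h' => h w N hN (Prod.ext ?_ h')
    simp only [billiardProfile, he]
  · left
    have := strictMonoOn_edgeDistance h0 h1 (mem _) (mem _) hlt
    simp only [billiardProfile, lissajous]
    exact mul_pos (by linarith) (by linarith)

/-! ### Billiard curves as closed braids -/

/-- The vertices of the projected billiard curve. -/
noncomputable def vertex (s n : ℕ) (j : ℤ) : ℂ :=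
  Complex.exp (2 * Real.pi * Complex.I * (s / n) * j)

theorem planarCurve_eq (s n : ℕ) (t : ℝ) : planarCurve s n t =
    ((1 - Int.fract (n * t) : ℝ) : ℂ) * vertex s n ⌊n * t⌋ +
      ((Int.fract (n * t) : ℝ) : ℂ) * vertex s n (⌊n * t⌋ + 1) := by
  simp [planarCurve, vertex]

theorem vertex_eq (s k : ℕ) (j : ℤ) : vertex s (k * (s + 1)) j =
    Complex.exp ((2 * halfAngle s k * j : ℝ) * Complex.I) := by
  rw [vertex, halfAngle]
  congr 1
  push_cast
  ring

/-- Turned so that its midpoint lies on the positive real axis, the edge is the vertical segment at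
distance `cos α`; the point seen at the angle `θ` has height `cos α * tan θ`. -/
theorem edge_point {α : ℝ} (h0 : 0 < α) (h1 : α < Real.pi / 2) (z : ℝ) :
    ((1 - edgeFraction α (Int.fract z) : ℝ) : ℂ) *
        Complex.exp ((2 * α * (⌊z⌋ : ℤ) : ℝ) * Complex.I) +
      ((edgeFraction α (Int.fract z) : ℝ) : ℂ) *
        Complex.exp ((2 * α * ((⌊z⌋ + 1 : ℤ) : ℝ) : ℝ) * Complex.I) =
      (edgeDistance α (sawtooth z) : ℝ) * Complex.exp ((2 * α * z : ℝ) * Complex.I) := by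
  set y := Int.fract z - 1 / 2 with hy
  set E := Complex.exp ((α * (2 * ⌊z⌋ + 1) : ℝ) * Complex.I)
  have e1 : Complex.exp ((2 * α * (⌊z⌋ : ℤ) : ℝ) * Complex.I) =
      E * Complex.exp ((-α : ℝ) * Complex.I) := by
    rw [← Complex.exp_add]
    push_cast
    ring_nf
  have e2 : Complex.exp ((2 * α * ((⌊z⌋ + 1 : ℤ) : ℝ) : ℝ) * Complex.I) =
      E * Complex.exp ((α : ℝ) * Complex.I) := by
    rw [← Complex.exp_add]
    push_cast
    ring_nf
  have e3 : Complex.exp ((2 * α * z : ℝ) * Complex.I) =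
      E * Complex.exp ((2 * α * y : ℝ) * Complex.I) := by
    rw [← Complex.exp_add, hy, Int.fract]
    push_cast
    ring_nf
  have hc : 0 < Real.cos (2 * α * y) :=
    Real.cos_pos_of_mem_Ioo (edgeAngle_mem_Ioo h0 h1 ⟨Int.fract_nonneg z, (Int.fract_lt_one z).le⟩)
  have hca : 0 < Real.cos α := Real.cos_pos_of_mem_Ioo ⟨by linarith, h1⟩
  have hsa : 0 < Real.sin α := Real.sin_pos_of_pos_of_lt_pi h0 (by linarith)
  have hd : edgeDistance α (sawtooth z) = Real.cos α / Real.cos (2 * α * y) := by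
    rw [edgeDistance, sawtooth_eq, ← hy]
    congr 1
    rcases abs_choice y with h | h
    · rw [h]
      ring_nf
    · rw [h, ← Real.cos_neg]
      ring_nf
  have hσ : edgeFraction α (Int.fract z) =
      1 / 2 + Real.sin (2 * α * y) * Real.cos α / (2 * Real.cos (2 * α * y) * Real.sin α) := by
    rw [edgeFraction, ← hy, Real.tan_eq_sin_div_cos, Real.tan_eq_sin_div_cos]
    field_simp
  rw [e1, e2, e3, hd, Complex.exp_mul_I, Complex.exp_mul_I, Complex.exp_mul_I, ← Complex.ofReal_cos,
    ← Complex.ofReal_cos, ← Complex.ofReal_cos, ← Complex.ofReal_sin, ← Complex.ofReal_sin,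
    ← Complex.ofReal_sin, Real.cos_neg, Real.sin_neg, hσ]
  set c := Real.cos (2 * α * y)
  set d := Real.sin (2 * α * y)
  have hc' : (c : ℂ) ≠ 0 := by exact_mod_cast hc.ne'
  have hsa' : (Real.sin α : ℂ) ≠ 0 := by exact_mod_cast hsa.ne'
  push_cast
  push_cast at hsa'
  field_simp
  ring

theorem billiardCurve_edgeTime {s k : ℕ} (hs : 0 < s) (hk : 2 ≤ k) (φ w : ℝ) :
    billiardCurve s (k * (s + 1)) k φ
        (edgeTime (halfAngle s k) ((s + 1) * w) / (k * (s + 1))) =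
      toricCurve s k (billiardProfile s k φ) w := by
  have h0 := halfAngle_pos hs hk
  have h1 := halfAngle_lt (s := s) hk
  have hk' : (0 : ℝ) < k := by positivity
  have hs' : (0 : ℝ) < s := by positivity
  have e : ((k * (s + 1) : ℕ) : ℝ) * (edgeTime (halfAngle s k) ((s + 1) * w) / (k * (s + 1))) =
      edgeTime (halfAngle s k) ((s + 1) * w) := by
    push_cast
    field_simp
  refine Prod.ext ?_ ?_
  · simp only [billiardCurve, toricCurve, billiardProfile]
    rw [planarCurve_eq, e, floor_edgeTime h0 h1, fract_edgeTime h0 h1, vertex_eq, vertex_eq,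
      edge_point h0 h1]
    congr 4
    rw [halfAngle]
    field_simp
  · simp only [billiardCurve, toricCurve, billiardProfile]
    congr 1
    field_simp

theorem surjective_edgeTime_div {s k : ℕ} (hs : 0 < s) (hk : 2 ≤ k) :
    Function.Surjective
      fun w : ℝ => edgeTime (halfAngle s k) ((s + 1) * w) / ((k : ℝ) * (s + 1)) := by
  have hk' : (0 : ℝ) < k := by positivity
  intro t
  obtain ⟨z, hz⟩ := surjective_edgeTime (halfAngle_pos hs hk) (halfAngle_lt (s := s) hk)
    (t * (k * (s + 1)))
  refine ⟨z / (s + 1), ?_⟩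
  simp only
  rw [mul_div_cancel₀ _ (by positivity), hz]
  field_simp

theorem range_billiardCurve {s k : ℕ} (hs : 0 < s) (hk : 2 ≤ k) (φ : ℝ) :
    range (billiardCurve s (k * (s + 1)) k φ) = range (toricCurve s k (billiardProfile s k φ)) := by
  rw [← (surjective_edgeTime_div hs hk).range_comp]
  congr 1
  funext w
  exact billiardCurve_edgeTime hs hk φ w

theorem vertex_add (s n : ℕ) (hn : 0 < n) (j : ℤ) : vertex s n (j + n) = vertex s n j := by
  have hn' : (n : ℂ) ≠ 0 := by exact_mod_cast hn.ne'
  rw [vertex, vertex, Complex.exp_eq_exp_iff_exists_int]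
  refine ⟨s, ?_⟩
  push_cast
  field_simp

theorem billiardCurve_periodic {n : ℕ} (hn : 0 < n) (s m : ℕ) (φ : ℝ) :
    Function.Periodic (billiardCurve s n m φ) 1 := by
  intro t
  refine Prod.ext ?_ ?_
  · simp only [billiardCurve]
    have e : (n : ℝ) * (t + 1) = n * t + ((n : ℤ) : ℝ) := by
      push_cast
      ring
    rw [planarCurve_eq, planarCurve_eq, e, Int.fract_add_intCast, Int.floor_add_intCast,
      add_right_comm, vertex_add s n hn, vertex_add s n hn]
  · simp only [billiardCurve]
    rw [← sawtooth_add_int (m * t + φ) m]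
    push_cast
    ring_nf

/-- Points of a closed braid with disjoint strings are determined by the parameter. -/
theorem exists_int_of_toricCurve_eq {s k : ℕ} (hs : 0 < s) (hk : 0 < k) (hks : Nat.Coprime k s)
    {P : ℝ → ℝ × ℝ} (hP : IsProfile P) (h : Separated s P) {w w' : ℝ}
    (e : toricCurve s k P w' = toricCurve s k P w) : ∃ n : ℤ, w' = w + k * n := by
  have hs' : (s : ℝ) ≠ 0 := by positivity
  have hk' : (k : ℝ) ≠ 0 := by positivity
  obtain ⟨e1, e2⟩ := Prod.ext_iff.1 e
  simp only [toricCurve] at e1 e2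
  have hr : (P w').1 = (P w).1 := by
    have := congrArg norm e1
    simp only [norm_mul, Complex.norm_exp_ofReal_mul_I, Complex.norm_real, mul_one,
      Real.norm_eq_abs, abs_of_pos (hP.pos _)] at this
    exact this
  rw [hr] at e1
  have e3 := mul_left_cancel₀ (Complex.ofReal_ne_zero.2 (hP.pos w).ne') e1
  obtain ⟨N, hN⟩ := Complex.exp_eq_exp_iff_exists_int.1 e3
  have hN' : 2 * Real.pi * (s / k) * w' = 2 * Real.pi * (s / k) * w + N * (2 * Real.pi) := by
    have : ((2 * Real.pi * (s / k) * w' : ℝ) : ℂ) * Complex.I =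
        ((2 * Real.pi * (s / k) * w + N * (2 * Real.pi) : ℝ) : ℂ) * Complex.I := by
      rw [hN]
      push_cast
      ring
    exact_mod_cast mul_right_cancel₀ Complex.I_ne_zero this
  have hw : w' = w + ((k * N : ℤ) : ℝ) / s := by
    have hπ := Real.pi_ne_zero
    push_cast
    field_simp at hN' ⊢
    linarith
  by_cases hd : (s : ℤ) ∣ k * N
  · obtain ⟨M, hM⟩ :=
      (Int.isCoprime_iff_gcd_eq_one.2 (by simpa using hks.symm)).dvd_of_dvd_mul_left hd
    refine ⟨M, ?_⟩
    rw [hw, hM]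
    push_cast
    field_simp
  · refine absurd (Prod.ext ?_ ?_) (h w _ hd)
    · rw [← hw, hr]
    · rw [← hw, e2]

/-- Reparametrization by the angle is a bijection under which the time period 1 becomes `k`, so this
is the embedding criterion for `toricCurve`. -/
theorem injOn_billiardCurve_iff {s k : ℕ} (hs : 0 < s) (hk : 2 ≤ k) (hks : Nat.Coprime k s)
    (φ : ℝ) : InjOn (billiardCurve s (k * (s + 1)) k φ) (Ico 0 1) ↔
      Separated s (billiardProfile s k φ) := by
  have h0 := halfAngle_pos hs hk
  have h1 := halfAngle_lt (s := s) hk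
  have hs' : (s : ℝ) ≠ 0 := by positivity
  have hk0 : 0 < k := by omega
  have hk' : (0 : ℝ) < k := by positivity
  have hn : 0 < k * (s + 1) := by positivity
  have hper := billiardCurve_periodic hn s k φ
  set T : ℝ → ℝ := fun w => edgeTime (halfAngle s k) ((s + 1) * w) / ((k : ℝ) * (s + 1)) with hT
  have hTadd : ∀ (w : ℝ) (n : ℤ), T (w + k * n) = T w + n := fun w n => by
    simp only [hT]
    rw [show ((s : ℝ) + 1) * (w + k * n) = (s + 1) * w + (((s + 1) * k * n : ℤ) : ℝ) by
      push_cast; ring, edgeTime_add_int]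
    push_cast
    field_simp
  have hTinj : Function.Injective T := fun w w' h => by
    simp only [hT] at h
    rw [div_left_inj' (by positivity)] at h
    exact mul_left_cancel₀ (by positivity) ((strictMono_edgeTime h0 h1).injective h)
  have hcurve : ∀ w, billiardCurve s (k * (s + 1)) k φ (T w) =
      toricCurve s k (billiardProfile s k φ) w := billiardCurve_edgeTime hs hk φ
  have hprof := isProfile_billiardProfile hs hk φ
  constructor
  · intro hinj w N hN e
    obtain ⟨a, b, hab⟩ := Int.isCoprime_iff_gcd_eq_one.2 (by simpa using hks :
      Int.gcd (k : ℤ) (s : ℤ) = 1)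
    -- The integer translation keeps the profile and is chosen by Bézout: with `a k + b s = 1` the
    -- angle grows by exactly `N a` full turns.
    have e1 : toricCurve s k (billiardProfile s k φ) (w + N / s + ((-(N * b) : ℤ) : ℝ)) =
        toricCurve s k (billiardProfile s k φ) w := by
      simp only [toricCurve]
      rw [periodic_add_int hprof.periodic, e]
      congr 2
      rw [Complex.exp_eq_exp_iff_exists_int]
      refine ⟨N * a, ?_⟩
      have h2 : (a * k + b * s : ℝ) = 1 := by exact_mod_cast hab
      have h3 : 2 * Real.pi * (s / k) * (w + N / s + ((-(N * b) : ℤ) : ℝ)) =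
          2 * Real.pi * (s / k) * w + (N * a : ℤ) * (2 * Real.pi) := by
        push_cast
        field_simp
        linear_combination -N * h2
      rw [h3]
      push_cast
      ring
    rw [← hcurve, ← hcurve] at e1
    have hfr : ∀ t, billiardCurve s (k * (s + 1)) k φ (Int.fract t) =
        billiardCurve s (k * (s + 1)) k φ t := fun t => by
      rw [← periodic_add_int hper _ ⌊t⌋, Int.fract_add_floor]
    rw [← hfr, ← hfr (T w)] at e1
    have e2 := hinj ⟨Int.fract_nonneg _, Int.fract_lt_one _⟩
      ⟨Int.fract_nonneg _, Int.fract_lt_one _⟩ e1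
    obtain ⟨m, hm⟩ := Int.fract_eq_fract.1 e2
    have e3 : T (w + N / s + ((-(N * b) : ℤ) : ℝ)) = T (w + k * m) := by
      rw [hTadd]
      linarith
    have e4 := hTinj e3
    refine div_ne_int hs hN (k * m + N * b) ?_
    push_cast at e4 ⊢
    linarith
  · intro h t ht t' ht' e
    obtain ⟨w, rfl⟩ := surjective_edgeTime_div hs hk t
    obtain ⟨w', rfl⟩ := surjective_edgeTime_div hs hk t'
    change billiardCurve s (k * (s + 1)) k φ (T w) = billiardCurve s (k * (s + 1)) k φ (T w') at e
    change T w ∈ _ at ht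
    change T w' ∈ _ at ht'
    change T w = T w'
    rw [hcurve, hcurve] at e
    obtain ⟨n, hn⟩ := exists_int_of_toricCurve_eq hs hk0 hks hprof h e
    rw [hn, hTadd] at ht ⊢
    have h2 : (n : ℝ) < 1 := by linarith [ht.2, ht'.1]
    have h3 : (-1 : ℝ) < n := by linarith [ht.1, ht'.2]
    have h4 : n < 1 := by exact_mod_cast h2
    have h5 : -1 < n := by exact_mod_cast h3
    rw [show n = 0 by omega]
    simp

/-! ### The profile of the rosette -/

/-- The smooth step from `0` to `1` which occurs in the half turns. -/
noncomputable def halfTurnStep (a : ℝ) : ℝ := (1 - Real.cos (Real.pi * max 0 (min a 1))) / 2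

/-- The deviation from the plane of the base points during a half turn. -/
noncomputable def halfTurnBump (a : ℝ) : ℝ := Real.sin (Real.pi * max 0 (min a 1)) / 2

theorem isLipschitz_halfTurnStep : IsLipschitz halfTurnStep := by
  have h : IsLipschitz fun a : ℝ => Real.cos (Real.pi * max 0 (min a 1)) :=
    (((IsLipschitz.const 0).max (IsLipschitz.id.min (IsLipschitz.const 1))).const_mul _).cos
  have := ((IsLipschitz.const (1 : ℝ)).sub h).const_mul (1 / 2)
  convert this using 1
  funext a
  rw [halfTurnStep]
  ring

theorem isLipschitz_halfTurnBump : IsLipschitz halfTurnBump := by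
  have h : IsLipschitz fun a : ℝ => Real.sin (Real.pi * max 0 (min a 1)) :=
    (((IsLipschitz.const 0).max (IsLipschitz.id.min (IsLipschitz.const 1))).const_mul _).sin
  convert h.const_mul (1 / 2) using 1
  funext a
  rw [halfTurnBump]
  ring

theorem clamp_of_mem {a : ℝ} (h0 : 0 ≤ a) (h1 : a ≤ 1) : max 0 (min a 1) = a := by
  rw [min_eq_left h1, max_eq_right h0]

theorem clamp_of_nonpos {a : ℝ} (h : a ≤ 0) : max 0 (min a 1) = 0 := by
  rw [min_eq_left (by linarith), max_eq_left h]

theorem clamp_of_one_le {a : ℝ} (h : 1 ≤ a) : max 0 (min a 1) = 1 := by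
  rw [min_eq_right h, max_eq_right zero_le_one]

theorem halfTurnStep_of_nonpos {a : ℝ} (h : a ≤ 0) : halfTurnStep a = 0 := by
  simp [halfTurnStep, clamp_of_nonpos h]

theorem halfTurnStep_of_one_le {a : ℝ} (h : 1 ≤ a) : halfTurnStep a = 1 := by
  rw [halfTurnStep, clamp_of_one_le h, mul_one, Real.cos_pi]
  norm_num

theorem halfTurnBump_of_nonpos {a : ℝ} (h : a ≤ 0) : halfTurnBump a = 0 := by
  simp [halfTurnBump, clamp_of_nonpos h]

theorem halfTurnBump_of_one_le {a : ℝ} (h : 1 ≤ a) : halfTurnBump a = 0 := by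
  rw [halfTurnBump, clamp_of_one_le h, mul_one, Real.sin_pi, zero_div]

theorem halfTurnStep_nonneg (a : ℝ) : 0 ≤ halfTurnStep a := by
  rw [halfTurnStep]
  linarith [Real.cos_le_one (Real.pi * max 0 (min a 1))]

theorem halfTurnStep_le_one (a : ℝ) : halfTurnStep a ≤ 1 := by
  rw [halfTurnStep]
  linarith [Real.neg_one_le_cos (Real.pi * max 0 (min a 1))]

theorem halfTurnStep_pos {a : ℝ} (h : 0 < a) : 0 < halfTurnStep a := by
  rcases le_total 1 a with h1 | h1
  · rw [halfTurnStep_of_one_le h1]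
    exact one_pos
  · rw [halfTurnStep, clamp_of_mem h.le h1]
    have := Real.cos_lt_cos_of_nonneg_of_le_pi le_rfl
      (mul_le_of_le_one_right Real.pi_pos.le h1) (mul_pos Real.pi_pos h)
    rw [Real.cos_zero] at this
    linarith

/-- Of two neighbouring inward strings, the inner one makes its half turn one letter earlier; hence
the outer one never catches up with it. -/
theorem halfTurnStep_sub_one_lt (a : ℝ) : halfTurnStep (a - 1) < 1 + halfTurnStep a := by
  rcases le_or_gt a 0 with h | h
  · rw [halfTurnStep_of_nonpos (by linarith : a - 1 ≤ 0)]
    linarith [halfTurnStep_nonneg a]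
  · linarith [halfTurnStep_pos h, halfTurnStep_le_one (a - 1)]

/-- The string which moves outwards, at the time `u` of the letter number `j` of a block. -/
noncomputable def outwardPoint (j : ℕ) (u : ℝ) : ℝ × ℝ :=
  (j + 1 + halfTurnStep u, (-1) ^ j * halfTurnBump u)

/-- The string which moves inwards during the letter number `J` of a block, at the time `a` of this
block. -/
noncomputable def inwardPoint (J : ℕ) (a : ℝ) : ℝ × ℝ :=
  (J + 2 - halfTurnStep (a - J), -((-1) ^ J * halfTurnBump (a - J)))

/-- The profile of the rosette at the time `v`, measured in letters. -/
noncomputable def rosetteTrack (s : ℕ) (v : ℝ) : ℝ × ℝ :=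
  (1 + ∑ J ∈ Finset.range (s - 1),
      (halfTurnStep (v - J) - halfTurnStep (v - ((s - 1) * (s - 1 - J) + J))),
    ∑ J ∈ Finset.range (s - 1),
      (-1) ^ J * (halfTurnBump (v - J) - halfTurnBump (v - ((s - 1) * (s - 1 - J) + J))))

/-- The profile of the rosette. -/
noncomputable def rosetteProfile (s : ℕ) (w : ℝ) : ℝ × ℝ :=
  rosetteTrack s (s * (s - 1) * Int.fract w)

/-- The inward half turn over the gap `J` starts at `(s - 1) * (s - 1 - J) + J`, that is, with the
letter `J` of the block `s - 1 - J`. All of these are still to come in the block 0. -/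
theorem rosetteTrack_outward {s j : ℕ} (hj : j < s - 1) {u : ℝ} (h0 : 0 ≤ u) (h1 : u ≤ 1) :
    rosetteTrack s (j + u) = outwardPoint j u := by
  have hs : (j : ℝ) + 1 ≤ (s : ℝ) - 1 := by
    have : ((j + 2 : ℕ) : ℝ) ≤ s := by exact_mod_cast (by omega : j + 2 ≤ s)
    push_cast at this
    linarith
  have hlate : ∀ J ∈ Finset.range (s - 1), (j + u) - (((s : ℝ) - 1) * (s - 1 - J) + J) ≤ 0 := by
    intro J hJ
    have hJ' : (J : ℝ) + 1 ≤ (s : ℝ) - 1 := by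
      have : ((J + 2 : ℕ) : ℝ) ≤ s := by
        exact_mod_cast (by have := Finset.mem_range.1 hJ; omega : J + 2 ≤ s)
      push_cast at this
      linarith
    have hJ0 : (0 : ℝ) ≤ J := by positivity
    nlinarith
  refine Prod.ext ?_ ?_
  · simp only [rosetteTrack, outwardPoint]
    have h : ∀ J ∈ Finset.range (s - 1), (halfTurnStep (j + u - J) -
        halfTurnStep (j + u - ((s - 1) * (s - 1 - J) + J))) =
        (if J < j then 1 else 0) + (if J = j then halfTurnStep u else 0) := by
      intro J hJ
      rw [halfTurnStep_of_nonpos (hlate J hJ), sub_zero]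
      rcases lt_trichotomy J j with h | rfl | h
      · have : (J : ℝ) + 1 ≤ j := by exact_mod_cast h
        rw [halfTurnStep_of_one_le (by linarith), if_pos h, if_neg h.ne, add_zero]
      · simp
      · have : (j : ℝ) + 1 ≤ J := by exact_mod_cast h
        rw [halfTurnStep_of_nonpos (by linarith), if_neg h.not_gt, if_neg h.ne', add_zero]
    rw [Finset.sum_congr rfl h, Finset.sum_add_distrib, Finset.sum_ite_eq',
      if_pos (Finset.mem_range.2 hj), Finset.sum_boole]
    have : (Finset.range (s - 1)).filter (· < j) = Finset.range j := by
      ext J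
      simp only [Finset.mem_filter, Finset.mem_range]
      omega
    rw [this, Finset.card_range]
    ring
  · simp only [rosetteTrack, outwardPoint]
    rw [Finset.sum_eq_single j]
    · rw [halfTurnBump_of_nonpos (hlate j (Finset.mem_range.2 hj)), sub_zero, add_sub_cancel_left]
    · intro J hJ hne
      rw [halfTurnBump_of_nonpos (hlate J hJ), sub_zero]
      rcases lt_or_gt_of_ne hne with h | h
      · have : (J : ℝ) + 1 ≤ j := by exact_mod_cast h
        rw [halfTurnBump_of_one_le (by linarith), mul_zero]
      · have : (j : ℝ) + 1 ≤ J := by exact_mod_cast h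
        rw [halfTurnBump_of_nonpos (by linarith), mul_zero]
    · intro h
      exact absurd (Finset.mem_range.2 hj) h

/-- In the block `s - 1 - J` the outward half turns and the inward ones over larger gaps are
completed, those over smaller gaps have not begun, and only the gap `J` is active. -/
theorem rosetteTrack_inward {s J : ℕ} (hJ : J < s - 1) {a : ℝ} (h0 : 0 ≤ a)
    (h1 : a ≤ (s : ℝ) - 1) :
    rosetteTrack s ((s - 1) * (s - 1 - J) + a) = inwardPoint J a := by
  have hcast : ∀ i : ℕ, i < s - 1 → (i : ℝ) + 1 ≤ (s : ℝ) - 1 := fun i hi => by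
    have : ((i + 2 : ℕ) : ℝ) ≤ s := by exact_mod_cast (by omega : i + 2 ≤ s)
    push_cast at this
    linarith
  have hs1 : (0 : ℝ) ≤ (s : ℝ) - 1 := by linarith
  have hJ' := hcast J hJ
  have hearly : ∀ i ∈ Finset.range (s - 1),
      1 ≤ ((s : ℝ) - 1) * (s - 1 - J) + a - i := by
    intro i hi
    have hi' := hcast i (Finset.mem_range.1 hi)
    nlinarith
  have hbefore : ∀ i ∈ Finset.range (s - 1), J < i →
      1 ≤ ((s : ℝ) - 1) * (s - 1 - J) + a - (((s : ℝ) - 1) * (s - 1 - i) + i) := by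
    intro i hi h
    have hi' := hcast i (Finset.mem_range.1 hi)
    have : (J : ℝ) + 1 ≤ i := by exact_mod_cast h
    nlinarith
  have hafter : ∀ i : ℕ, i < J →
      ((s : ℝ) - 1) * (s - 1 - J) + a - (((s : ℝ) - 1) * (s - 1 - i) + i) ≤ 0 := by
    intro i h
    have : (i : ℝ) + 1 ≤ J := by exact_mod_cast h
    have hi0 : (0 : ℝ) ≤ i := by positivity
    nlinarith
  have heq : ((s : ℝ) - 1) * (s - 1 - J) + a - (((s : ℝ) - 1) * (s - 1 - J) + J) = a - J := by
    ring
  refine Prod.ext ?_ ?_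
  · simp only [rosetteTrack, inwardPoint]
    have h : ∀ i ∈ Finset.range (s - 1), (halfTurnStep ((s - 1) * (s - 1 - J) + a - i) -
        halfTurnStep ((s - 1) * (s - 1 - J) + a - ((s - 1) * (s - 1 - i) + i))) =
        (if i < J + 1 then 1 else 0) - (if i = J then halfTurnStep (a - J) else 0) := by
      intro i hi
      rw [halfTurnStep_of_one_le (hearly i hi)]
      rcases lt_trichotomy i J with h | rfl | h
      · rw [halfTurnStep_of_nonpos (hafter i h), if_pos (by omega), if_neg h.ne]
      · rw [heq, if_pos (by omega), if_pos rfl]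
      · rw [halfTurnStep_of_one_le (hbefore i hi h), if_neg (by omega), if_neg h.ne']
        ring
    rw [Finset.sum_congr rfl h, Finset.sum_sub_distrib, Finset.sum_ite_eq',
      if_pos (Finset.mem_range.2 hJ), Finset.sum_boole]
    have : (Finset.range (s - 1)).filter (· < J + 1) = Finset.range (J + 1) := by
      ext i
      simp only [Finset.mem_filter, Finset.mem_range]
      omega
    rw [this, Finset.card_range]
    push_cast
    ring
  · simp only [rosetteTrack, inwardPoint]
    rw [Finset.sum_eq_single J]
    · rw [halfTurnBump_of_one_le (hearly J (Finset.mem_range.2 hJ)), heq]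
      ring
    · intro i hi hne
      rw [halfTurnBump_of_one_le (hearly i hi)]
      rcases lt_or_gt_of_ne hne with h | h
      · rw [halfTurnBump_of_nonpos (hafter i h), sub_zero, mul_zero]
      · rw [halfTurnBump_of_one_le (hbefore i hi h), sub_zero, mul_zero]
    · intro h
      exact absurd (Finset.mem_range.2 hJ) h

/-- The point of the rosette at the time `j + u` of the block number `B`. -/
noncomputable def rosettePoint (s B j : ℕ) (u : ℝ) : ℝ × ℝ :=
  if B = 0 then outwardPoint j u else inwardPoint (s - 1 - B) (j + u)

theorem rosetteProfile_eq {s B j : ℕ} (hB : B < s) (hj : j < s - 1) {u w : ℝ} (h0 : 0 ≤ u)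
    (h1 : u < 1) (hw : Int.fract w = (B + (j + u) / (s - 1)) / s) :
    rosetteProfile s w = rosettePoint s B j u := by
  have hs : (j : ℝ) + 1 ≤ (s : ℝ) - 1 := by
    have : ((j + 2 : ℕ) : ℝ) ≤ s := by exact_mod_cast (by omega : j + 2 ≤ s)
    push_cast at this
    linarith
  have hj0 : (0 : ℝ) ≤ j := by positivity
  have hs1 : (0 : ℝ) < (s : ℝ) - 1 := by linarith
  have hs0 : (0 : ℝ) < s := by linarith
  have e : (s : ℝ) * (s - 1) * Int.fract w = (s - 1) * B + (j + u) := by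
    rw [hw]
    field_simp
  rw [rosetteProfile, e, rosettePoint]
  split_ifs with h
  · rw [h, Nat.cast_zero, mul_zero, zero_add, rosetteTrack_outward hj h0 h1.le]
  · rw [← rosetteTrack_inward (s := s) (J := s - 1 - B) (by omega) (by linarith) (by linarith)]
    congr 2
    have : ((s - 1 - B : ℕ) : ℝ) = s - 1 - B := by
      rw [Nat.cast_sub (by omega), Nat.cast_sub (by omega), Nat.cast_one]
    rw [this]
    ring

/-- Every parameter lies in a letter of a block; the letter and the time at which it is performed
are determined by the angle. -/
theorem exists_block {s : ℕ} (hs : 2 ≤ s) (w : ℝ) : ∃ B j : ℕ, ∃ u : ℝ, B < s ∧ j < s - 1 ∧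
    0 ≤ u ∧ u < 1 ∧ j = ⌊((s : ℝ) - 1) * Int.fract (s * w)⌋₊ ∧
    (j : ℝ) + u = (s - 1) * Int.fract (s * w) ∧
    Int.fract w = (B + (j + u) / (s - 1)) / s := by
  have hs' : (2 : ℝ) ≤ s := by exact_mod_cast hs
  have hs1 : (0 : ℝ) < (s : ℝ) - 1 := by linarith
  have hs0 : (0 : ℝ) < s := by linarith
  have hf0 := Int.fract_nonneg ((s : ℝ) * w)
  have hf1 := Int.fract_lt_one ((s : ℝ) * w)
  have hw0 := Int.fract_nonneg w
  have hw1 := Int.fract_lt_one w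
  set x := ((s : ℝ) - 1) * Int.fract (s * w) with hx
  have hx0 : 0 ≤ x := mul_nonneg hs1.le hf0
  refine ⟨⌊(s : ℝ) * Int.fract w⌋₊, ⌊x⌋₊, x - ⌊x⌋₊, ?_, ?_, ?_, ?_, rfl, by ring, ?_⟩
  · rw [Nat.floor_lt (by positivity)]
    nlinarith
  · rw [Nat.floor_lt hx0, Nat.cast_sub (by omega), Nat.cast_one]
    nlinarith
  · linarith [Nat.floor_le hx0]
  · linarith [Nat.lt_floor_add_one x]
  · have e : Int.fract ((s : ℝ) * Int.fract w) = Int.fract (s * w) := by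
      rw [Int.fract_eq_fract]
      refine ⟨-(s * ⌊w⌋), ?_⟩
      rw [Int.fract]
      push_cast
      ring
    have e2 := Int.fract_add_floor ((s : ℝ) * Int.fract w)
    rw [e] at e2
    have e3 : ((⌊(s : ℝ) * Int.fract w⌋ : ℤ) : ℝ) = (⌊(s : ℝ) * Int.fract w⌋₊ : ℝ) :=
      (natCast_floor_eq_intCast_floor (by positivity)).symm
    rw [e3] at e2
    rw [add_sub_cancel, hx, mul_div_cancel_left₀ _ hs1.ne', eq_div_iff hs0.ne']
    linarith

theorem isProfile_rosetteProfile {s : ℕ} (hs : 2 ≤ s) : IsProfile (rosetteProfile s) where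
  periodic w := by simp [rosetteProfile]
  lipschitz := by
    refine IsLipschitz.comp_fract (g := fun t => rosetteTrack s (s * (s - 1) * t)) ?_ ?_
    · refine IsLipschitz.comp (g := rosetteTrack s) ?_ (IsLipschitz.id.const_mul _)
      refine IsLipschitz.prodMk ((IsLipschitz.const 1).add (IsLipschitz.sum _ fun J => ?_))
        (IsLipschitz.sum _ fun J => ?_)
      · exact (isLipschitz_halfTurnStep.comp (IsLipschitz.id.sub (IsLipschitz.const _))).sub
          (isLipschitz_halfTurnStep.comp (IsLipschitz.id.sub (IsLipschitz.const _)))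
      · exact ((isLipschitz_halfTurnBump.comp (IsLipschitz.id.sub (IsLipschitz.const _))).sub
          (isLipschitz_halfTurnBump.comp (IsLipschitz.id.sub (IsLipschitz.const _)))).const_mul _
    · have hs' : (2 : ℝ) ≤ s := by exact_mod_cast hs
      have e0 : rosetteTrack s (s * (s - 1) * 0) = outwardPoint 0 0 := by
        rw [← rosetteTrack_outward (s := s) (j := 0) (by omega) le_rfl zero_le_one]
        congr 1
        push_cast
        ring
      have e1 : rosetteTrack s (s * (s - 1) * 1) = inwardPoint 0 (s - 1) := by
        rw [← rosetteTrack_inward (s := s) (J := 0) (by omega) (by linarith) le_rfl]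
        congr 1
        push_cast
        ring
      simp only [e0, e1, outwardPoint, inwardPoint]
      rw [halfTurnStep_of_nonpos le_rfl, halfTurnBump_of_nonpos le_rfl, Nat.cast_zero, sub_zero,
        halfTurnStep_of_one_le (by linarith), halfTurnBump_of_one_le (by linarith)]
      norm_num
  pos w := by
    obtain ⟨B, j, u, hB, hj, h0, h1, -, -, hw⟩ := exists_block hs w
    rw [rosetteProfile_eq hB hj h0 h1 hw, rosettePoint]
    split_ifs
    · have := halfTurnStep_nonneg u
      simp only [outwardPoint]
      positivity
    · have := halfTurnStep_le_one (j + u - (s - 1 - B : ℕ))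
      have : (0 : ℝ) ≤ (s - 1 - B : ℕ) := by positivity
      simp only [inwardPoint]
      linarith

/-! ### From the rosette to the spiral -/

theorem spiral_outward {s : ℕ} (hs : 2 ≤ s) {w : ℝ} {j : ℕ} {u : ℝ} (h0 : 0 ≤ u)
    (h1 : (j : ℝ) + u < s - 1) (hw : Int.fract w = ((j + u) / (s - 1)) / s) :
    spiral s (1 / s) w = (1 + (j + u) / (s - 1), (-1) ^ j * Real.sin (Real.pi * u)) := by
  have hs' : (2 : ℝ) ≤ s := by exact_mod_cast hs
  have hs1 : (0 : ℝ) < (s : ℝ) - 1 := by linarith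
  have hj : (0 : ℝ) ≤ j := by positivity
  set τ := ((j : ℝ) + u) / (s - 1) with hτ
  have hτ1 : τ < 1 := (div_lt_one hs1).2 h1
  have e1 : Int.fract w / (1 / s) = τ := by
    rw [hw]
    field_simp
  have e2 : τ ≤ (1 - Int.fract w) / (1 - 1 / s) := by
    rw [hw, le_div_iff₀ (by rw [sub_pos, div_lt_one (by linarith)]; linarith)]
    have : τ / s = τ * (1 / s) := by ring
    rw [this]
    linarith
  simp only [spiral, e1, min_eq_left e2, min_eq_left hτ1.le]
  congr 1
  rw [hτ, mul_div_cancel₀ _ hs1.ne', mul_add, add_comm, mul_comm Real.pi (j : ℝ),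
    Real.sin_add_nat_mul_pi]

theorem spiral_inward {s : ℕ} (hs : 2 ≤ s) {w : ℝ} {B : ℕ} (hB : 0 < B) {τ : ℝ} (h0 : 0 ≤ τ)
    (hw : Int.fract w = (B + τ) / s) :
    spiral s (1 / s) w = (1 + (s - B - τ) / (s - 1), 0) := by
  have hs' : (2 : ℝ) ≤ s := by exact_mod_cast hs
  have hs1 : (0 : ℝ) < (s : ℝ) - 1 := by linarith
  have hB' : (1 : ℝ) ≤ B := by exact_mod_cast hB
  have e1 : Int.fract w / (1 / s) = B + τ := by
    rw [hw]
    field_simp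
  have e2 : (1 - Int.fract w) / (1 - 1 / s) = (s - B - τ) / (s - 1) := by
    rw [hw]
    field_simp
    ring
  have e3 : (s - B - τ) / ((s : ℝ) - 1) ≤ B + τ := by
    rw [div_le_iff₀ hs1]
    nlinarith
  simp only [spiral, e1, e2, min_eq_right e3, min_eq_right (by linarith : (1 : ℝ) ≤ B + τ),
    mul_one, sin_pi_mul_sub_one]

/-- Two inward strings keep their radial order in both profiles. The outward string overtakes the
inward string of the gap `J` during the letter `J` in both; in this letter the heights are compared,
in all others the distances. -/
theorem rosette_spiral_same_order {s : ℕ} (hs : 2 ≤ s) {w w' : ℝ} {B B' j : ℕ} {u : ℝ}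
    (hBB' : B < B') (hB' : B' < s) (hj : j < s - 1) (h0 : 0 ≤ u) (h1 : u < 1)
    (hw : Int.fract w = (B + (j + u) / (s - 1)) / s)
    (hw' : Int.fract w' = (B' + (j + u) / (s - 1)) / s) :
    0 < ((rosetteProfile s w').1 - (rosetteProfile s w).1) *
        ((spiral s (1 / s) w').1 - (spiral s (1 / s) w).1) ∨
      0 < ((rosetteProfile s w').2 - (rosetteProfile s w).2) *
        ((spiral s (1 / s) w').2 - (spiral s (1 / s) w).2) := by
  have hs' : (2 : ℝ) ≤ s := by exact_mod_cast hs
  have hs1 : (0 : ℝ) < (s : ℝ) - 1 := by linarith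
  have hj0 : (0 : ℝ) ≤ j := by positivity
  have hj1 : (j : ℝ) + 1 ≤ (s : ℝ) - 1 := by
    have : ((j + 2 : ℕ) : ℝ) ≤ s := by exact_mod_cast (by omega : j + 2 ≤ s)
    push_cast at this
    linarith
  have hτ0 : 0 ≤ ((j : ℝ) + u) / (s - 1) := div_nonneg (by linarith) hs1.le
  have hτ1 : ((j : ℝ) + u) / (s - 1) < 1 := (div_lt_one hs1).2 (by linarith)
  have hτ2 : 0 < (j : ℝ) → 0 < ((j : ℝ) + u) / (s - 1) := fun h => div_pos (by linarith) hs1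
  have hτ : ((j : ℝ) + u) / (s - 1) * (s - 1) = j + u := div_mul_cancel₀ _ hs1.ne'
  rw [rosetteProfile_eq hB' hj h0 h1 hw', rosetteProfile_eq (hBB'.trans hB') hj h0 h1 hw,
    spiral_inward hs (by omega) hτ0 hw', rosettePoint, rosettePoint, if_neg (by omega : B' ≠ 0)]
  set τ := ((j : ℝ) + u) / (s - 1)
  obtain ⟨J, hJ⟩ : ∃ J, J = s - 1 - B' := ⟨_, rfl⟩
  have hJ' : (s : ℝ) - B' = J + 1 := by
    rw [hJ, Nat.cast_sub (by omega), Nat.cast_sub (by omega), Nat.cast_one]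
    ring
  rw [← hJ, hJ']
  split_ifs with h
  · subst h
    rw [Nat.cast_zero, zero_add] at hw
    rw [spiral_outward hs h0 (by linarith) hw]
    have hsp : (1 + ((J : ℝ) + 1 - τ) / (s - 1)) - (1 + τ) = (J + 1 - τ - (j + u)) / (s - 1) := by
      field_simp
      linarith
    rcases lt_trichotomy j J with hjJ | rfl | hjJ
    · left
      have hjJ' : (j : ℝ) + 1 ≤ J := by exact_mod_cast hjJ
      simp only [inwardPoint, outwardPoint]
      rw [hsp, halfTurnStep_of_nonpos (by linarith : (j : ℝ) + u - J ≤ 0)]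
      have := halfTurnStep_le_one u
      exact mul_pos (by linarith) (div_pos (by linarith) hs1)
    -- At the very beginning of the crossing letter the heights still agree, but the distances are
    -- ordered as before the crossing.
    · rcases h0.eq_or_lt with rfl | hu
      · left
        simp only [inwardPoint, outwardPoint]
        rw [hsp, halfTurnStep_of_nonpos (by linarith : (j : ℝ) + 0 - j ≤ 0),
          halfTurnStep_of_nonpos le_rfl]
        exact mul_pos (by linarith) (div_pos (by linarith) hs1)
      · right
        simp only [inwardPoint, outwardPoint]
        rw [add_sub_cancel_left, halfTurnBump, clamp_of_mem h0 h1.le]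
        have hsin : 0 < Real.sin (Real.pi * u) :=
          Real.sin_pos_of_pos_of_lt_pi (mul_pos Real.pi_pos hu)
            (mul_lt_of_lt_one_right Real.pi_pos h1)
        have hsgn : ((-1 : ℝ) ^ j) * (-1) ^ j = 1 := by
          rw [← mul_pow]
          norm_num
        have e : (-((-1) ^ j * (Real.sin (Real.pi * u) / 2)) -
            (-1) ^ j * (Real.sin (Real.pi * u) / 2)) * (0 - (-1) ^ j * Real.sin (Real.pi * u)) =
            Real.sin (Real.pi * u) ^ 2 := by
          linear_combination Real.sin (Real.pi * u) ^ 2 * hsgn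
        rw [e]
        positivity
    · left
      have hjJ' : (J : ℝ) + 1 ≤ j := by exact_mod_cast hjJ
      have hJ0 : (0 : ℝ) ≤ J := by positivity
      have := hτ2 (by linarith)
      simp only [inwardPoint, outwardPoint]
      rw [hsp, halfTurnStep_of_one_le (by linarith : 1 ≤ (j : ℝ) + u - J)]
      have := halfTurnStep_nonneg u
      exact mul_pos_of_neg_of_neg (by linarith) (div_neg_of_neg_of_pos (by linarith) hs1)
  · left
    rw [spiral_inward hs (by omega) hτ0 hw]
    obtain ⟨K, hK⟩ : ∃ K, K = s - 1 - B := ⟨_, rfl⟩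
    have hK' : (s : ℝ) - B = K + 1 := by
      rw [hK, Nat.cast_sub (by omega), Nat.cast_sub (by omega), Nat.cast_one]
      ring
    rw [← hK, hK']
    have hJK : J < K := by omega
    simp only [inwardPoint]
    refine mul_pos_of_neg_of_neg ?_ ?_
    · rcases (Nat.succ_le_of_lt hJK).eq_or_lt with rfl | h2
      · have := halfTurnStep_sub_one_lt (j + u - J)
        push_cast
        rw [show (j : ℝ) + u - (J + 1) = j + u - J - 1 by ring]
        linarith
      · have h3 : (J : ℝ) + 2 ≤ K := by exact_mod_cast h2
        have := halfTurnStep_nonneg (j + u - J)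
        have := halfTurnStep_le_one (j + u - K)
        linarith
    · have h3 : (J : ℝ) < K := by exact_mod_cast hJK
      have : ((J : ℝ) + 1 - τ) / (s - 1) < (K + 1 - τ) / (s - 1) :=
        div_lt_div_of_pos_right (by linarith) hs1
      linarith

theorem ambientIsotopic_rosetteProfile_spiral {s k : ℕ} (hs : 2 ≤ s) (hk : 0 < k)
    (hks : Nat.Coprime k s) : AmbientIsotopic (range (toricCurve s k (rosetteProfile s)))
      (range (toricCurve s k (spiral s (1 / s)))) := by
  have hs' : (2 : ℝ) ≤ s := by exact_mod_cast hs
  refine ambientIsotopic_of_same_order (by omega) hk hks (isProfile_rosetteProfile hs)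
    (isProfile_spiral s (by positivity) ?_) fun w N hN => ?_
  · rw [div_lt_one (by linarith)]
    linarith
  obtain ⟨B, j, u, hB, hj, h0, h1, ej, eu, hw⟩ := exists_block hs w
  obtain ⟨B', j', u', hB', hj', h0', h1', ej', eu', hw'⟩ := exists_block hs (w + N / s)
  have e : Int.fract ((s : ℝ) * (w + N / s)) = Int.fract (s * w) := by
    rw [mul_add, mul_div_cancel₀ _ (by positivity), Int.fract_add_intCast]
  rw [e] at ej' eu'
  obtain rfl : j = j' := by rw [ej, ej']
  obtain rfl : u = u' := by linarith
  rcases lt_trichotomy B B' with h | rfl | h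
  · exact rosette_spiral_same_order hs h hB' hj h0 h1 hw hw'
  · exfalso
    rw [← hw, Int.fract_eq_fract] at hw'
    obtain ⟨n, hn⟩ := hw'
    exact div_ne_int (by omega) hN n (by linarith)
  · rcases rosette_spiral_same_order hs h hB hj h0 h1 hw' hw with h2 | h2
    · left
      linarith
    · right
      linarith

/-! ### The rosette as a closed braid with a profile -/

theorem rosetteWord_length (s k : ℕ) : (rosetteWord s k).length = k * (s - 1) := by
  simp [rosetteWord]

theorem getElem?_flatten_replicate {α : Type*} (l : List α) (k i : ℕ) (hi : i < k * l.length) :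
    (List.replicate k l).flatten[i]? = l[i % l.length]? := by
  induction k generalizing i with
  | zero => simp at hi
  | succ k ih =>
    rw [List.replicate_succ, List.flatten_cons, List.getElem?_append]
    split_ifs with h
    · rw [Nat.mod_eq_of_lt h]
    · rw [ih (i - l.length) (by rw [Nat.succ_mul] at hi; omega), ← Nat.mod_eq_sub_mod (by omega)]

theorem rosetteWord_getElem? {s k i : ℕ} (hi : i < k * (s - 1)) (hj : i % (s - 1) < s - 1) :
    (rosetteWord s k)[i]? = some (⟨i % (s - 1), hj⟩, (-1) ^ (i % (s - 1))) := by
  rw [rosetteWord, getElem?_flatten_replicate _ _ _ (by simpa using hi)]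
  simp [hj]

/-- The block 0 provides the outward end of the half turn and the block `s - 1 - j` its inward end;
the remaining blocks provide the resting points, on either side of the crossing. -/
theorem letterSlice_eq {s j : ℕ} (hj : j < s - 1) {u : ℝ} (h0 : 0 ≤ u) (h1 : u < 1) :
    letterSlice s (⟨j, hj⟩, (-1) ^ j) u = {q | ∃ B < s, q = rosettePoint s B j u} := by
  have hout : outwardPoint j u = ((j : ℝ) + 3 / 2 - Real.cos (Real.pi * u) / 2,
      (-1) ^ j * Real.sin (Real.pi * u) / 2) := by
    simp only [outwardPoint, halfTurnStep, halfTurnBump, clamp_of_mem h0 h1.le]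
    refine Prod.ext ?_ ?_ <;> simp only <;> ring
  have hin : inwardPoint j (j + u) = ((j : ℝ) + 3 / 2 + Real.cos (Real.pi * u) / 2,
      -((-1) ^ j * Real.sin (Real.pi * u) / 2)) := by
    simp only [inwardPoint, halfTurnStep, halfTurnBump, add_sub_cancel_left,
      clamp_of_mem h0 h1.le]
    refine Prod.ext ?_ ?_ <;> simp only <;> ring
  have hin1 : ∀ J : ℕ, J < j → inwardPoint J (j + u) = (((J + 1 : ℕ) : ℝ), 0) := fun J hJ => by
    have : (J : ℝ) + 1 ≤ j := by exact_mod_cast hJ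
    rw [inwardPoint, halfTurnStep_of_one_le (by linarith), halfTurnBump_of_one_le (by linarith)]
    refine Prod.ext ?_ ?_
    · push_cast
      ring
    · simp
  have hin2 : ∀ J : ℕ, j < J → inwardPoint J (j + u) = (((J + 2 : ℕ) : ℝ), 0) := fun J hJ => by
    have : (j : ℝ) + 1 ≤ J := by exact_mod_cast hJ
    rw [inwardPoint, halfTurnStep_of_nonpos (by linarith), halfTurnBump_of_nonpos (by linarith)]
    refine Prod.ext ?_ ?_
    · push_cast
      ring
    · simp
  have hpt : ∀ J : ℕ, J < s - 1 → rosettePoint s (s - 1 - J) j u = inwardPoint J (j + u) :=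
    fun J hJ => by
      rw [rosettePoint, if_neg (by omega), show s - 1 - (s - 1 - J) = J by omega]
  ext q
  simp only [letterSlice, mem_union, mem_ofPred_eq, mem_insert_iff, mem_singleton_iff,
    Units.val_pow_eq_pow_val, Units.val_neg, Units.val_one, Int.cast_pow, Int.cast_neg,
    Int.cast_one]
  rw [← hout, ← hin]
  constructor
  · rintro (⟨i, hi1, his, hij, hij', rfl⟩ | rfl | rfl)
    · rcases lt_or_ge i (j + 1) with h | h
      · refine ⟨s - 1 - (i - 1), by omega, ?_⟩
        rw [hpt _ (by omega), hin1 _ (by omega), Nat.sub_add_cancel hi1]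
      · refine ⟨s - 1 - (i - 2), by omega, ?_⟩
        rw [hpt _ (by omega), hin2 _ (by omega), Nat.sub_add_cancel (by omega)]
    · exact ⟨0, by omega, by rw [rosettePoint, if_pos rfl]⟩
    · exact ⟨s - 1 - j, by omega, (hpt j hj).symm⟩
  · rintro ⟨B, hB, rfl⟩
    rw [rosettePoint]
    split_ifs with h
    · exact Or.inr (Or.inl rfl)
    · rcases lt_trichotomy (s - 1 - B) j with h2 | h2 | h2
      · exact Or.inl ⟨s - 1 - B + 1, by omega, by omega, by omega, by omega, hin1 _ h2⟩
      · exact Or.inr (Or.inr (by rw [h2]))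
      · exact Or.inl ⟨s - 1 - B + 2, by omega, by omega, by omega, by omega, hin2 _ h2⟩

theorem letterSlice_zero {s : ℕ} (a : Fin (s - 1) × ℤˣ) : letterSlice s a 0 = basePoints s := by
  have ha := a.1.2
  ext q
  simp only [letterSlice, basePoints, mem_union, mem_ofPred_eq, mem_insert_iff, mem_singleton_iff,
    mul_zero, Real.cos_zero, Real.sin_zero, zero_div, neg_zero]
  have e1 : ((a.1 : ℕ) : ℝ) + 3 / 2 - 1 / 2 = ((a.1 + 1 : ℕ) : ℝ) := by push_cast; ring
  have e2 : ((a.1 : ℕ) : ℝ) + 3 / 2 + 1 / 2 = ((a.1 + 2 : ℕ) : ℝ) := by push_cast; ring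
  rw [e1, e2]
  constructor
  · rintro (⟨i, hi1, his, -, -, rfl⟩ | rfl | rfl)
    · exact ⟨i, hi1, his, rfl⟩
    · exact ⟨_, by omega, by omega, rfl⟩
    · exact ⟨_, by omega, by omega, rfl⟩
  · rintro ⟨i, hi1, his, rfl⟩
    by_cases h1 : i = a.1 + 1
    · exact Or.inr (Or.inl (by rw [h1]))
    · by_cases h2 : i = a.1 + 2
      · exact Or.inr (Or.inr (by rw [h2]))
      · exact Or.inl ⟨i, hi1, his, h1, h2, rfl⟩

/-- The slices of the rosette at the time `t`, where `k t = β + (j + u) / (s - 1)`. -/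
theorem wordSlice_rosetteWord {s k : ℕ} (hs : 2 ≤ s) (hk : 0 < k) {t : ℝ} (ht : t ∈ Ico (0 : ℝ) 1) :
    ∃ β j : ℕ, ∃ u : ℝ, j < s - 1 ∧ 0 ≤ u ∧ u < 1 ∧ k * t = β + (j + u) / (s - 1) ∧
      wordSlice (rosetteWord s k) t = {q | ∃ B < s, q = rosettePoint s B j u} := by
  have hs' : (2 : ℝ) ≤ s := by exact_mod_cast hs
  have hs1 : (0 : ℝ) < (s : ℝ) - 1 := by linarith
  have hk' : (0 : ℝ) < k := by positivity
  have hcast : ((s - 1 : ℕ) : ℝ) = s - 1 := by rw [Nat.cast_sub (by omega), Nat.cast_one]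
  have hL : (((rosetteWord s k).length : ℕ) : ℝ) = k * (s - 1) := by
    rw [rosetteWord_length]
    push_cast
    rw [hcast]
  set x : ℝ := k * (s - 1) * t with hx
  have hx0 : 0 ≤ x := mul_nonneg (by positivity) ht.1
  obtain ⟨i, hi⟩ : ∃ i, i = ⌊x⌋₊ := ⟨_, rfl⟩
  have hil : i < k * (s - 1) := by
    rw [hi, Nat.floor_lt hx0]
    push_cast
    rw [hcast]
    exact mul_lt_of_lt_one_right (by positivity) ht.2
  have hj : i % (s - 1) < s - 1 := Nat.mod_lt _ (by omega)
  have hfl : ((⌊x⌋ : ℤ) : ℝ) = i := by rw [hi, natCast_floor_eq_intCast_floor hx0]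
  have hfr : Int.fract x = x - i := by rw [Int.fract, hfl]
  refine ⟨i / (s - 1), i % (s - 1), Int.fract x, hj, Int.fract_nonneg _, Int.fract_lt_one _, ?_, ?_⟩
  · have h2 : (i : ℝ) = (i % (s - 1) : ℕ) + (s - 1) * (i / (s - 1) : ℕ) := by
      rw [← hcast]
      exact_mod_cast (Nat.mod_add_div i (s - 1)).symm
    rw [hfr]
    set a : ℝ := ((i % (s - 1) : ℕ) : ℝ)
    set b : ℝ := ((i / (s - 1) : ℕ) : ℝ)
    rw [h2, hx]
    field_simp
    ring
  · rw [wordSlice, hL, ← hx, ← hi, rosetteWord_getElem? hil hj]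
    exact letterSlice_eq hj (Int.fract_nonneg _) (Int.fract_lt_one _)

theorem wordSlice_rosetteWord_one {s k : ℕ} (hs : 2 ≤ s) (hk : 0 < k) :
    wordSlice (rosetteWord s k) 1 = wordSlice (rosetteWord s k) 0 := by
  have h1 : wordSlice (rosetteWord s k) 1 = basePoints s := by
    rw [wordSlice, mul_one, Nat.floor_natCast, List.getElem?_eq_none le_rfl]
  have h0 : 0 < k * (s - 1) := Nat.mul_pos hk (by omega)
  rw [h1, wordSlice, mul_zero, Nat.floor_zero,
    rosetteWord_getElem? h0 (Nat.mod_lt _ (by omega))]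
  simp only [Int.fract_zero]
  rw [letterSlice_zero]

/-- One factor of the word occupies `1 / k` of a turn, which is `1 / s` of a period of the profile.
Coprimality makes the strings at a given angle run through all `s` blocks. -/
theorem rosette_eq_range {s k : ℕ} (hs : 2 ≤ s) (hk : 0 < k) (hks : Nat.Coprime k s) :
    rosette s k = range (toricCurve s k (rosetteProfile s)) := by
  have hs' : (2 : ℝ) ≤ s := by exact_mod_cast hs
  have hs1 : (0 : ℝ) < (s : ℝ) - 1 := by linarith
  have hk' : (0 : ℝ) < k := by positivity
  have hfract : ∀ (B j : ℕ) (u : ℝ), B < s → j < s - 1 → 0 ≤ u → u < 1 →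
      Int.fract ((B + ((j : ℝ) + u) / (s - 1)) / s) = (B + (j + u) / (s - 1)) / s := by
    intro B j u hB hj h0 h1
    have hj' : (j : ℝ) + 1 ≤ s - 1 := by
      have : ((j + 2 : ℕ) : ℝ) ≤ s := by exact_mod_cast (by omega : j + 2 ≤ s)
      push_cast at this
      linarith
    have hB' : (B : ℝ) + 1 ≤ s := by exact_mod_cast hB
    have hj0 : (0 : ℝ) ≤ j := by positivity
    have h2 : ((j : ℝ) + u) / (s - 1) < 1 := (div_lt_one hs1).2 (by linarith)
    have h3 : 0 ≤ ((j : ℝ) + u) / (s - 1) := div_nonneg (by linarith) hs1.le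
    refine Int.fract_eq_self.2 ⟨by positivity, ?_⟩
    rw [div_lt_one (by linarith)]
    linarith
  have hmain : ∀ t ∈ Ico (0 : ℝ) 1, ∀ q ∈ wordSlice (rosetteWord s k) t,
      ((q.1 : ℂ) * Complex.exp (2 * Real.pi * Complex.I * t), q.2) ∈
        range (toricCurve s k (rosetteProfile s)) := by
    intro t ht q hq
    obtain ⟨β, j, u, hj, h0, h1, hkt, hsl⟩ := wordSlice_rosetteWord hs hk ht
    rw [hsl] at hq
    obtain ⟨B, hB, rfl⟩ := hq
    obtain ⟨a, b, hab⟩ := Int.isCoprime_iff_gcd_eq_one.2 (by simpa using hks :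
      Int.gcd (k : ℤ) (s : ℤ) = 1)
    have hab' : (a * k + b * s : ℝ) = 1 := by exact_mod_cast hab
    -- The number of extra turns solves `k Q ≡ B - β` modulo `s`, which puts the string into the
    -- block `B`.
    let Q : ℤ := a * (B - β)
    let w : ℝ := k * (t + Q) / s
    have hw : w = (B + ((j : ℝ) + u) / (s - 1)) / s + ((-(b * (B - β)) : ℤ) : ℝ) := by
      simp only [w, Q]
      rw [mul_add, hkt]
      push_cast
      field_simp
      linear_combination ((B : ℝ) - β) * (s - 1) * hab'
    refine ⟨w, ?_⟩
    have hwf : Int.fract w = (B + (j + u) / (s - 1)) / s := by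
      rw [hw, Int.fract_add_intCast, hfract B j u hB hj h0 h1]
    rw [toricCurve, rosetteProfile_eq hB hj h0 h1 hwf]
    congr 2
    rw [Complex.exp_eq_exp_iff_exists_int]
    refine ⟨Q, ?_⟩
    have : 2 * Real.pi * (s / k) * w = 2 * Real.pi * t + Q * (2 * Real.pi) := by
      simp only [w]
      field_simp
    rw [this]
    push_cast
    ring
  apply Subset.antisymm
  · rintro _ ⟨t, ⟨ht0, ht1⟩, q, hq, rfl⟩
    rcases ht1.eq_or_lt with rfl | ht1
    · rw [wordSlice_rosetteWord_one hs hk] at hq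
      have := hmain 0 ⟨le_rfl, one_pos⟩ q hq
      convert this using 3
      simp [Complex.exp_two_pi_mul_I]
    · exact hmain t ⟨ht0, ht1⟩ q hq
  · rintro _ ⟨w, rfl⟩
    set y : ℝ := s / k * w with hy
    have ht : Int.fract y ∈ Ico (0 : ℝ) 1 := ⟨Int.fract_nonneg _, Int.fract_lt_one _⟩
    refine ⟨Int.fract y, Ico_subset_Icc_self ht, rosetteProfile s w, ?_, ?_⟩
    · obtain ⟨β, j, u, hj, h0, h1, hkt, hsl⟩ := wordSlice_rosetteWord hs hk ht
      rw [hsl]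
      -- Each full turn advances the block number by `k`, and blocks are counted modulo `s`.
      obtain ⟨B, hB⟩ : ∃ B : ℕ, (B : ℤ) = (β + k * ⌊y⌋) % s :=
        ⟨((β + k * ⌊y⌋) % s).toNat, Int.toNat_of_nonneg (Int.emod_nonneg _ (by omega))⟩
      have hBs : B < s := by
        have := Int.emod_lt_of_pos (β + k * ⌊y⌋) (by omega : (0 : ℤ) < s)
        omega
      refine ⟨B, hBs, rosetteProfile_eq hBs hj h0 h1 ?_⟩
      rw [← hfract B j u hBs hj h0 h1, Int.fract_eq_fract]
      refine ⟨(β + k * ⌊y⌋) / s, ?_⟩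
      have h2 : ((β : ℝ) + k * ⌊y⌋) = B + s * ((β + k * ⌊y⌋) / s : ℤ) := by
        have := Int.emod_add_mul_ediv (β + k * ⌊y⌋) s
        rw [← hB] at this
        exact_mod_cast this.symm
      have h3 : (s : ℝ) * w = k * Int.fract y + k * ⌊y⌋ := by
        rw [← mul_add, Int.fract_add_floor, hy]
        field_simp
      rw [hkt] at h3
      set c : ℝ := (((β + k * ⌊y⌋) / s : ℤ) : ℝ)
      have h4 : (s : ℝ) * w = s * c + (B + ((j : ℝ) + u) / (s - 1)) := by linarith
      have h5 : w = c + (B + ((j : ℝ) + u) / (s - 1)) / s := by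
        field_simp at h4 ⊢
        linarith
      linarith
    · rw [toricCurve]
      congr 2
      rw [Complex.exp_eq_exp_iff_exists_int]
      refine ⟨⌊y⌋, ?_⟩
      have : 2 * Real.pi * (s / k) * w = 2 * Real.pi * Int.fract y + ⌊y⌋ * (2 * Real.pi) := by
        have := Int.fract_add_floor y
        rw [hy] at this ⊢
        linear_combination (-2 * Real.pi) * this
      rw [this]
      push_cast
      ring

/-! ### The law of reflection -/

/-- Incoming and outgoing velocities of a piecewise affine function. -/
theorem exists_piecewise_affine {E : Type*} [AddCommGroup E] [Module ℝ E] {f : ℝ → E} {V : ℤ → E}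
    {a b : ℝ} (ha : 0 < a)
    (h : ∀ m : ℤ, ∃ A : E, ∀ t : ℝ, m ≤ a * t + b → a * t + b ≤ m + 1 → f t = A + t • V m)
    (t : ℝ) : ∃ δ : ℝ, 0 < δ ∧ ∀ u ∈ Icc (0 : ℝ) δ,
      f (t - u) = f t - u • V (⌈a * t + b⌉ - 1) ∧ f (t + u) = f t + u • V ⌊a * t + b⌋ := by
  set x := a * t + b with hx
  obtain ⟨A, hA⟩ := h (⌈x⌉ - 1)
  obtain ⟨B, hB⟩ := h ⌊x⌋
  have h1 : ((⌈x⌉ - 1 : ℤ) : ℝ) < x := by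
    push_cast
    linarith [Int.ceil_lt_add_one x]
  have h2 : x ≤ ((⌈x⌉ - 1 : ℤ) : ℝ) + 1 := by
    push_cast
    linarith [Int.le_ceil x]
  have h3 : (⌊x⌋ : ℝ) ≤ x := Int.floor_le x
  have h4 : x < (⌊x⌋ : ℝ) + 1 := Int.lt_floor_add_one x
  refine ⟨min ((x - ((⌈x⌉ - 1 : ℤ) : ℝ)) / a) ((⌊x⌋ + 1 - x) / a),
    lt_min (div_pos (by linarith) ha) (div_pos (by linarith) ha), fun u hu => ⟨?_, ?_⟩⟩
  · have hu1 : u * a ≤ x - ((⌈x⌉ - 1 : ℤ) : ℝ) := (le_div_iff₀ ha).1 (hu.2.trans (min_le_left _ _))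
    have hu0 : 0 ≤ u * a := mul_nonneg hu.1 ha.le
    rw [hA t h1.le h2, hA (t - u) (by linarith) (by linarith)]
    module
  · have hu1 : u * a ≤ ⌊x⌋ + 1 - x := (le_div_iff₀ ha).1 (hu.2.trans (min_le_right _ _))
    have hu0 : 0 ≤ u * a := mul_nonneg hu.1 ha.le
    rw [hB t h3 h4.le, hB (t + u) (by linarith) (by linarith)]
    module

/-- Validity on the closed interval, including the right end where the floor has already jumped, is
what gives the incoming velocity at a vertex. -/
theorem planarCurve_edge (s n : ℕ) {t : ℝ} {m : ℤ} (h0 : m ≤ n * t) (h1 : n * t ≤ m + 1) :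
    planarCurve s n t =
      vertex s n m + ((n * t - m : ℝ) : ℂ) * (vertex s n (m + 1) - vertex s n m) := by
  rw [planarCurve_eq]
  rcases h1.eq_or_lt with h1 | h1
  · have hf : ⌊(n : ℝ) * t⌋ = m + 1 := by
      rw [h1]
      exact_mod_cast Int.floor_intCast (R := ℝ) (m + 1)
    rw [Int.fract, hf, h1]
    push_cast
    ring
  · have hf : ⌊(n : ℝ) * t⌋ = m := Int.floor_eq_iff.2 ⟨h0, h1⟩
    rw [Int.fract, hf]
    push_cast
    ring

theorem sawtooth_edge (m : ℤ) : ∃ A : ℝ, ∀ a : ℝ, m ≤ 2 * a → 2 * a ≤ m + 1 →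
    sawtooth a = A + a * (-2 * (-1) ^ m) := by
  rcases Int.even_or_odd' m with ⟨l, rfl | rfl⟩
  · refine ⟨1 + 2 * l, fun a h0 h1 => ?_⟩
    push_cast at h0 h1
    have hf : ⌊a⌋ = l := Int.floor_eq_iff.2 ⟨by linarith, by linarith⟩
    rw [sawtooth, hf, abs_of_nonpos (by linarith), zpow_mul]
    norm_num
    ring
  · refine ⟨-1 - 2 * l, fun a h0 h1 => ?_⟩
    push_cast at h0 h1
    have hz : (-1 : ℝ) ^ (2 * l + 1) = -1 := by
      rw [zpow_add₀ (by norm_num), zpow_mul]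
      norm_num
    rw [hz]
    rcases (show a ≤ l + 1 by linarith).eq_or_lt with h | h
    · have hf : ⌊a⌋ = l + 1 := by
        rw [h]
        exact_mod_cast Int.floor_intCast (R := ℝ) (l + 1)
      rw [sawtooth, hf, h]
      push_cast
      rw [show (l : ℝ) + 1 - (l + 1) - 1 / 2 = -(1 / 2) by ring, abs_neg, abs_of_pos (by norm_num)]
      ring
    · have hf : ⌊a⌋ = l := Int.floor_eq_iff.2 ⟨by linarith, by linarith⟩
      rw [sawtooth, hf, abs_of_nonneg (by linarith)]
      ring

theorem sawtooth_pos_lt_one {a : ℝ} (h : ∀ q : ℤ, 2 * a ≠ q) : 0 < sawtooth a ∧ sawtooth a < 1 := by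
  have hf := Int.fract_add_floor a
  have h0 : Int.fract a ≠ 0 := fun h' => h (2 * ⌊a⌋) (by push_cast; linarith)
  have h1 : Int.fract a - 1 / 2 ≠ 0 := fun h' => h (2 * ⌊a⌋ + 1) (by push_cast; linarith)
  have h2 := lt_of_le_of_ne (Int.fract_nonneg a) h0.symm
  have h3 := Int.fract_lt_one a
  rw [sawtooth_eq]
  have h4 : |Int.fract a - 1 / 2| < 1 / 2 := abs_lt.2 ⟨by linarith, by linarith⟩
  exact ⟨by positivity, by linarith⟩

theorem sawtooth_half_int {a : ℝ} {q : ℤ} (h : 2 * a = q) : sawtooth a = 0 ∨ sawtooth a = 1 := by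
  rcases Int.even_or_odd' q with ⟨l, rfl | rfl⟩
  · right
    push_cast at h
    have : a = 0 + (l : ℤ) := by linarith
    rw [this, sawtooth_add_int, sawtooth_eq]
    norm_num
  · left
    push_cast at h
    have : a = 1 / 2 + (l : ℤ) := by linarith
    rw [this, sawtooth_add_int, sawtooth_eq]
    rw [Int.fract_eq_self.2 ⟨by norm_num, by norm_num⟩]
    norm_num

theorem norm_vertex (s n : ℕ) (j : ℤ) : ‖vertex s n j‖ = 1 := by
  rw [vertex, show (2 * Real.pi * Complex.I * (s / n) * j : ℂ) =
    ((2 * Real.pi * (s / n) * j : ℝ) : ℂ) * Complex.I by push_cast; ring,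
    Complex.norm_exp_ofReal_mul_I]

theorem vertex_add_one (s n : ℕ) (j : ℤ) : vertex s n (j + 1) = vertex s n j * vertex s n 1 := by
  rw [vertex, vertex, vertex, ← Complex.exp_add]
  push_cast
  ring_nf

theorem vertex_succ_ne {s n : ℕ} (hs : 0 < s) (hsn : s < n) (j : ℤ) :
    vertex s n j ≠ vertex s n (j + 1) := by
  have hn : (0 : ℝ) < n := by exact_mod_cast (by omega : 0 < n)
  intro h
  rw [vertex, vertex, Complex.exp_eq_exp_iff_exists_int] at h
  obtain ⟨m, hm⟩ := h
  have h2 : ((s / n : ℝ) : ℂ) * (2 * Real.pi * Complex.I) =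
      ((-m : ℝ) : ℂ) * (2 * Real.pi * Complex.I) := by
    push_cast at hm ⊢
    linear_combination -hm
  have h3 : (s / n : ℝ) = -m := by
    exact_mod_cast mul_right_cancel₀ Complex.two_pi_I_ne_zero h2
  have h4 : (0 : ℝ) < s / n := by positivity
  have h5 : (s / n : ℝ) < 1 := by
    rw [div_lt_one hn]
    exact_mod_cast hsn
  rw [h3] at h4 h5
  have h6 : 0 < -m := by exact_mod_cast h4
  have h7 : -m < 1 := by exact_mod_cast h5
  omega

/-- Reflection of the projected billiard curve at a vertex. -/
theorem vertex_reflection (s n : ℕ) (m : ℤ) (c : ℝ) :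
    (c : ℂ) * (vertex s n (m + 1) - vertex s n m) =
      c * (vertex s n m - vertex s n (m - 1)) -
        ((2 * ((c : ℂ) * (vertex s n m - vertex s n (m - 1)) *
          starRingEnd ℂ (vertex s n m)).re : ℝ) : ℂ) * vertex s n m := by
  set p := vertex s n m
  set ζ := vertex s n 1
  have h1 : vertex s n (m + 1) = p * ζ := vertex_add_one s n m
  have hζ : ζ * starRingEnd ℂ ζ = 1 := by
    rw [Complex.mul_conj, Complex.normSq_eq_norm_sq, norm_vertex]
    norm_num
  have hp : p * starRingEnd ℂ p = 1 := by
    rw [Complex.mul_conj, Complex.normSq_eq_norm_sq, norm_vertex]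
    norm_num
  have h2 : vertex s n (m - 1) = p * starRingEnd ℂ ζ := by
    have := vertex_add_one s n (m - 1)
    rw [sub_add_cancel] at this
    change p = _ * ζ at this
    rw [this, mul_assoc, hζ, mul_one]
  have h3 : (c : ℂ) * (p - p * starRingEnd ℂ ζ) * starRingEnd ℂ p =
      c * (1 - starRingEnd ℂ ζ) := by
    linear_combination (c : ℂ) * (1 - starRingEnd ℂ ζ) * hp
  have h4 : ((2 * ((c : ℂ) * (1 - starRingEnd ℂ ζ)).re : ℝ) : ℂ) =
      c * (1 - starRingEnd ℂ ζ) + c * (1 - ζ) := by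
    have := Complex.add_conj ((c : ℂ) * (1 - starRingEnd ℂ ζ))
    rw [← this]
    simp
  rw [h1, h2, h3, h4]
  ring

/-- The phase condition says that the wall is never hit together with the floor or the ceiling,
where the boundary is not smooth. So at each time at most one of the two coordinates of the velocity
changes, by the law of reflection. -/
theorem isBilliardKnot_billiardCurve {s n k : ℕ} (hs : 0 < s) (hsn : s < n) (hk : 0 < k) {φ : ℝ}
    (hinj : InjOn (billiardCurve s n k φ) (Ico 0 1))
    (hφ : ∀ (t : ℝ) (m q : ℤ), n * t = m → 2 * (k * t + φ) ≠ q) :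
    IsBilliardKnot (billiardCurve s n k φ) := by
  have hn : 0 < n := by omega
  have hn' : (0 : ℝ) < n := by exact_mod_cast hn
  have hk' : (0 : ℝ) < k := by exact_mod_cast hk
  have hplanar : ∀ t, planarCurve s n t = (1 - Int.fract (n * t)) • vertex s n ⌊n * t⌋ +
      Int.fract (n * t) • vertex s n (⌊n * t⌋ + 1) := fun t => by
    rw [planarCurve_eq, Complex.real_smul, Complex.real_smul]
  refine ⟨billiardCurve_periodic hn s k φ, hinj, fun t => ⟨?_, sawtooth_nonneg _,
    sawtooth_le_one _⟩, fun t => ?_⟩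
  · simp only [billiardCurve]
    rw [hplanar]
    refine (norm_add_le _ _).trans ?_
    rw [norm_smul, norm_smul, norm_vertex, norm_vertex, Real.norm_eq_abs, Real.norm_eq_abs,
      abs_of_nonneg (Int.fract_nonneg (n * t)),
      abs_of_nonneg (by linarith [Int.fract_lt_one (n * t)])]
    linarith
  · obtain ⟨δ₁, hδ₁, h₁⟩ := exists_piecewise_affine (f := planarCurve s n)
      (V := fun m => (n : ℂ) * (vertex s n (m + 1) - vertex s n m)) (b := 0) hn' (fun m =>
        ⟨vertex s n m - m * (vertex s n (m + 1) - vertex s n m), fun t h0 h1 => by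
          rw [add_zero] at h0 h1
          rw [planarCurve_edge s n h0 h1, Complex.real_smul]
          push_cast
          ring⟩) t
    obtain ⟨δ₂, hδ₂, h₂⟩ := exists_piecewise_affine (f := fun t => sawtooth (k * t + φ))
      (V := fun m : ℤ => k * (-2 * (-1 : ℝ) ^ m)) (a := 2 * k) (b := 2 * φ) (by positivity)
      (fun m => by
        obtain ⟨A, hA⟩ := sawtooth_edge m
        refine ⟨A + φ * (-2 * (-1 : ℝ) ^ m), fun t h0 h1 => ?_⟩
        rw [hA (k * t + φ) (by linarith) (by linarith), smul_eq_mul]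
        ring) t
    set x := (n : ℝ) * t + 0 with hx
    set y := 2 * (k : ℝ) * t + 2 * φ with hy
    refine ⟨((n : ℂ) * (vertex s n (⌈x⌉ - 1 + 1) - vertex s n (⌈x⌉ - 1)),
      k * (-2 * (-1 : ℝ) ^ (⌈y⌉ - 1))),
      ((n : ℂ) * (vertex s n (⌊x⌋ + 1) - vertex s n ⌊x⌋), k * (-2 * (-1 : ℝ) ^ ⌊y⌋)), ?_,
      min δ₁ δ₂, lt_min hδ₁ hδ₂, fun u hu => ⟨Prod.ext ?_ ?_, Prod.ext ?_ ?_⟩⟩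
    · have hceil : ∀ z : ℝ, (∀ m : ℤ, z ≠ m) → ⌈z⌉ - 1 = ⌊z⌋ := fun z hz => by
        have : ⌈z⌉ = ⌊z⌋ + 1 := by
          rw [Int.ceil_eq_iff]
          push_cast
          refine ⟨?_, (Int.lt_floor_add_one z).le⟩
          rw [add_sub_cancel_right]
          exact lt_of_le_of_ne (Int.floor_le z) (hz _).symm
        omega
      have hxt : x = n * t := add_zero _
      have hyt : y = 2 * (k * t + φ) := by rw [hy]; ring
      by_cases hxi : ∃ m : ℤ, x = m
      · obtain ⟨m, hm⟩ := hxi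
        have hyi : ∀ q : ℤ, y ≠ q := fun q => by
          rw [hyt]
          exact hφ t m q (by rw [← hxt, hm])
        right
        left
        have hv : planarCurve s n t = vertex s n m := by
          rw [planarCurve_edge s n (m := m) (by rw [← hxt, hm]) (by rw [← hxt, hm]; linarith),
            ← hxt, hm]
          simp
        have hsaw := sawtooth_pos_lt_one (a := k * t + φ) fun q => by rw [← hyt]; exact hyi q
        simp only [billiardCurve, hv]
        refine ⟨norm_vertex s n m, hsaw.1, hsaw.2, Prod.ext ?_ ?_⟩
        · simp only [hm, Int.floor_intCast, Int.ceil_intCast, sub_add_cancel]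
          exact vertex_reflection s n m n
        · simp only [hceil y hyi]
      · have hxi' : ∀ m : ℤ, x ≠ m := fun m hm => hxi ⟨m, hm⟩
        by_cases hyi : ∃ q : ℤ, y = q
        · obtain ⟨q, hq⟩ := hyi
          right
          right
          refine ⟨?_, sawtooth_half_int (q := q) (by rw [← hyt, hq]), Prod.ext ?_ ?_⟩
          · simp only [billiardCurve]
            rw [hplanar, ← hxt]
            have hf0 : 0 < Int.fract x := lt_of_le_of_ne (Int.fract_nonneg x) fun h0 =>
              hxi' ⌊x⌋ (by
                have := Int.fract_add_floor x
                rw [← h0, zero_add] at this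
                exact this.symm)
            -- The disc is strictly convex, so an interior point of an edge is off the wall; the
            -- edge is nondegenerate because `0 < s < n`.
            exact norm_combo_lt_of_ne (norm_vertex _ _ _).le (norm_vertex _ _ _).le
              (vertex_succ_ne hs hsn _) (by linarith [Int.fract_lt_one x]) hf0 (by ring)
          · simp only [hceil x hxi']
          · simp only [hq, Int.floor_intCast, Int.ceil_intCast]
            rw [zpow_sub₀ (by norm_num), zpow_one]
            ring
        · have hyi' : ∀ q : ℤ, y ≠ q := fun q hq => hyi ⟨q, hq⟩
          left
          rw [hceil x hxi', hceil y hyi']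
    · simp only [billiardCurve, Prod.fst_sub, Prod.smul_fst]
      exact (h₁ u ⟨hu.1, hu.2.trans (min_le_left _ _)⟩).1
    · simp only [billiardCurve, Prod.snd_sub, Prod.smul_snd]
      exact (h₂ u ⟨hu.1, hu.2.trans (min_le_right _ _)⟩).1
    · simp only [billiardCurve, Prod.fst_add, Prod.smul_fst]
      exact (h₁ u ⟨hu.1, hu.2.trans (min_le_left _ _)⟩).2
    · simp only [billiardCurve, Prod.snd_add, Prod.smul_snd]
      exact (h₂ u ⟨hu.1, hu.2.trans (min_le_right _ _)⟩).2

/-! ### Billiard curves and rosettes -/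

theorem separated_one (P : ℝ → ℝ × ℝ) : Separated 1 P :=
  fun _ N hN => absurd (by simp : ((1 : ℕ) : ℤ) ∣ N) hN

theorem rosette_one {k : ℕ} (hk : 0 < k) :
    rosette 1 k = range (toricCurve 1 k fun _ => ((1 : ℝ), (0 : ℝ))) := by
  have hk' : (k : ℝ) ≠ 0 := by positivity
  have hword : rosetteWord 1 k = [] :=
    List.eq_nil_of_length_eq_zero (by rw [rosetteWord_length]; simp)
  have hslice : ∀ t : ℝ, wordSlice (rosetteWord 1 k) t = {((1 : ℝ), (0 : ℝ))} := fun t => by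
    rw [hword]
    simp only [wordSlice, List.getElem?_nil]
    ext q
    simp only [basePoints, mem_ofPred_eq, mem_singleton_iff]
    constructor
    · rintro ⟨j, h1, h2, rfl⟩
      obtain rfl : j = 1 := by omega
      simp
    · rintro rfl
      exact ⟨1, le_rfl, le_rfl, by simp⟩
  apply Subset.antisymm
  · rintro _ ⟨t, -, q, hq, rfl⟩
    rw [hslice] at hq
    rw [mem_singleton_iff.1 hq]
    refine ⟨k * t, ?_⟩
    simp only [toricCurve]
    congr 3
    rw [show (2 * Real.pi * (((1 : ℕ) : ℝ) / k) * (k * t)) = 2 * Real.pi * t by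
      push_cast; field_simp]
    push_cast
    ring
  · rintro _ ⟨w, rfl⟩
    refine ⟨Int.fract (w / k), ⟨Int.fract_nonneg _, (Int.fract_lt_one _).le⟩, ((1 : ℝ), (0 : ℝ)),
      by rw [hslice]; rfl, ?_⟩
    simp only [toricCurve]
    congr 2
    rw [Complex.exp_eq_exp_iff_exists_int]
    refine ⟨⌊w / k⌋, ?_⟩
    have : 2 * Real.pi * (((1 : ℕ) : ℝ) / k) * w =
        2 * Real.pi * Int.fract (w / k) + ⌊w / k⌋ * (2 * Real.pi) := by
      have := Int.fract_add_floor (w / k)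
      push_cast
      linear_combination (-2 * Real.pi) * this
    rw [this]
    push_cast
    ring

/-- A single string has nothing to be separated from, so the linear homotopy to a round circle is an
isotopy for every phase. -/
theorem ambientIsotopic_billiard_rosette_one {k : ℕ} (hk : 2 ≤ k) (φ : ℝ) :
    AmbientIsotopic (range (billiardCurve 1 (k * (1 + 1)) k φ)) (rosette 1 k) := by
  rw [range_billiardCurve one_pos hk, rosette_one (by omega)]
  exact ambientIsotopic_of_segment one_pos (by omega) (Nat.coprime_one_right k)
    (isProfile_billiardProfile one_pos hk φ)
    ⟨fun _ => rfl, IsLipschitz.const _, fun _ => one_pos⟩ fun u _ => separated_one _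

theorem ambientIsotopic_billiard_spiral {s k : ℕ} (hs : 2 ≤ s) (hk : 2 ≤ k)
    (hks : Nat.Coprime k s) {φ ε : ℝ} (h : Separated s (billiardProfile s k φ))
    (hε : 0 < ε * Real.sin (2 * Real.pi * -((s + 1) * φ))) :
    AmbientIsotopic (range (billiardCurve s (k * (s + 1)) k φ))
      (range (toricCurve s k fun w => ((spiral s (1 / 2) w).1, ε * (spiral s (1 / 2) w).2))) := by
  have hs0 : 0 < s := by omega
  have hk0 : 0 < k := by omega
  rw [range_billiardCurve hs0 hk]
  exact (ambientIsotopic_billiard_lissajous hs0 hk hks h).trans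
    ((ambientIsotopic_lissajous_dual hs0 hk0 hks ((separated_billiardProfile_iff hs0 hk).1 h)).trans
      (ambientIsotopic_dualLissajous_spiral hs hk0 hks hε))

theorem ambientIsotopic_spiral_rosette {s k : ℕ} (hs : 2 ≤ s) (hk : 0 < k)
    (hks : Nat.Coprime k s) :
    AmbientIsotopic (range (toricCurve s k (spiral s (1 / 2)))) (rosette s k) := by
  rw [rosette_eq_range hs hk hks]
  exact ((ambientIsotopic_rosetteProfile_spiral hs hk hks).trans
    (ambientIsotopic_spiral hs hk hks)).symm

theorem ambientIsotopic_billiard_rosette {s k : ℕ} (hs : 2 ≤ s) (hk : 2 ≤ k)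
    (hks : Nat.Coprime k s) {φ : ℝ} (h : Separated s (billiardProfile s k φ))
    (hφ : 0 < Real.sin (2 * Real.pi * -((s + 1) * φ))) :
    AmbientIsotopic (range (billiardCurve s (k * (s + 1)) k φ)) (rosette s k) := by
  have := ambientIsotopic_billiard_spiral hs hk hks (ε := 1) h (by rwa [one_mul])
  simp only [one_mul, Prod.mk.eta] at this
  exact this.trans (ambientIsotopic_spiral_rosette hs (by omega) hks)

/-- The negative sign corresponds to `ε = -1`, the spiral with reversed heights, which is the
rosette reflected in the horizontal plane. -/
theorem ambientIsotopic_billiard_mirror_rosette {s k : ℕ} (hs : 2 ≤ s) (hk : 2 ≤ k)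
    (hks : Nat.Coprime k s) {φ : ℝ} (h : Separated s (billiardProfile s k φ))
    (hφ : Real.sin (2 * Real.pi * -((s + 1) * φ)) < 0) :
    AmbientIsotopic (range (billiardCurve s (k * (s + 1)) k φ)) (mirror (rosette s k)) := by
  have := ambientIsotopic_billiard_spiral hs hk hks (ε := -1) h (by linarith)
  simp only [neg_one_mul] at this
  rw [← heightReflection_image_toricKnot] at this
  exact this.trans (((ambientIsotopic_spiral_rosette hs (by omega) hks).image _).trans
    (ambientIsotopic_heightReflection_mirror _))

end CylinderKnots

/-! ### The main theorem -/

open CylinderKnots in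
theorem mainTheorem4 (s k : ℕ) (hk : 2 ≤ k) (hks : Nat.Coprime k s) :
    (∃ φ : ℝ, IsBilliardKnot (billiardCurve s (k * (s + 1)) k φ) ∧
      AmbientIsotopic (Set.range (billiardCurve s (k * (s + 1)) k φ)) (rosette s k)) ∧
    (∀ φ : ℝ, Set.InjOn (billiardCurve s (k * (s + 1)) k φ) (Set.Ico 0 1) →
      AmbientIsotopic (Set.range (billiardCurve s (k * (s + 1)) k φ)) (rosette s k) ∨
      AmbientIsotopic (Set.range (billiardCurve s (k * (s + 1)) k φ))
        (mirror (rosette s k))) := by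
  have hs : 0 < s := by
    rcases Nat.eq_zero_or_pos s with rfl | h
    · rw [Nat.coprime_zero_right] at hks
      omega
    · exact h
  have hk' : (0 : ℝ) < k := by positivity
  -- The phase `-1 / (4 (s + 1))` makes the dual phase `χ` equal to `1 / 4`, where the sine is
  -- largest; its positive sign gives the rosette and not its mirror image.
  have hsin : Real.sin (2 * Real.pi * -(((s : ℝ) + 1) * -(1 / (4 * (s + 1))))) = 1 := by
    rw [← Real.sin_pi_div_two]
    congr 1
    field_simp
    norm_num
  have hsep₀ : Separated s (billiardProfile s k (-(1 / (4 * (s + 1))))) :=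
    (separated_billiardProfile_iff hs hk).2 (separated_lissajous_iff.2
      (separated_dualLissajous hs (by rw [hsin]; exact one_ne_zero)))
  refine ⟨⟨-(1 / (4 * (s + 1))), ?_, ?_⟩, fun φ hinj => ?_⟩
  · refine isBilliardKnot_billiardCurve hs (by nlinarith) (by omega)
      ((injOn_billiardCurve_iff hs hk hks _).2 hsep₀) fun t m q hm hq => ?_
    push_cast at hm
    have h1 : (k : ℝ) * t * (s + 1) = m := by linarith
    have h2 : (4 * m - 1 : ℝ) = 2 * ((s + 1) * q) := by
      rw [← h1, ← hq]
      field_simp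
      ring
    -- A simultaneous hit of the wall and of the floor or ceiling would equate an odd and an even
    -- integer.
    have h3 : 4 * m - 1 = 2 * (((s : ℤ) + 1) * q) := by exact_mod_cast h2
    omega
  · rcases (Nat.succ_le_of_lt hs).eq_or_lt with rfl | hs2
    · exact ambientIsotopic_billiard_rosette_one hk _
    · exact ambientIsotopic_billiard_rosette hs2 hk hks hsep₀ (by rw [hsin]; exact one_pos)
  · have hsep := (injOn_billiardCurve_iff hs hk hks φ).1 hinj
    rcases (Nat.succ_le_of_lt hs).eq_or_lt with rfl | hs2
    · exact Or.inl (ambientIsotopic_billiard_rosette_one hk φ)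
    · have hne := sin_ne_zero_of_separated_dualLissajous hs2
        (separated_lissajous_iff.1 ((separated_billiardProfile_iff hs hk).1 hsep))
      rcases lt_or_gt_of_ne hne with h | h
      · exact Or.inr (ambientIsotopic_billiard_mirror_rosette hs2 hk hks hsep h)
      · exact Or.inl (ambientIsotopic_billiard_rosette hs2 hk hks hsep h)
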